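/- Let $\{\alpha_n\}_{n\ge 0}$ be a real sequence and $N\ge 0$ an integer with $|\alpha_n|\neq 1$ for $n<N$ and $|\alpha_n|<1$ for $n\ge N$. Let $\mathbb D$ be the open unit disk and adopt the following notation. * $\Phi_0=1$ and $\Phi_{n+1}(z)=z\Phi_n(z)-\overline{\alpha_n}\,\Phi_n^*(z)$, where $\Phi_n^*(z)=z^n\overline{\Phi_n(1/\bar z)}$. * $f_n$ ($n\ge0$) are the meromorphic functions on $\mathbb D$ with $f_n(z)=\dfrac{\alpha_n+zf_{n+1}(z)}{1+\overline{\alpha_n}zf_{n+1}(z)}$ for all $n$, such that for $n\ge N$ the function $f_n$ is a Schur function (analytic and bounded by $1$ in $\mathbb D$); and $F(z)=\dfrac{1+zf_0(z)}{1-zf_0(z)}$, as a meromorphic function on $\mathbb D$. * $B$ is the locally uniform limit on $\mathbb D$ of the Blaschke products $B_n(z)=\prod_{\lambda}\frac{|\lambda|}{\lambda}\frac{\lambda-z}{1-\bar\lambda z}$ over the zeros $\lambda$ of $\Phi_n^*$ in $\mathbb D$, counted with multiplicity. * $\mu$ is the linear functional on Laurent polynomials in $w$ (with $\bar w=w^{-1}$)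 given by $\langle 1,\mu\rangle=1$, $\langle w^n,\mu\rangle=-\sum_{j<n}t_j\langle w^j,\mu\rangle$ when $\Phi_n(z)=z^n+\sum_{j<n}t_jz^j$ ($n\ge1$), and $\langle w^{-n},\mu\rangle=\overline{\langle w^n,\mu\rangle}$. It is extended by linearity to series: $\langle g,\mu\rangle_w=\sum_{k\in\mathbb Z}a_k\langle w^k,\mu\rangle$ if $g(w)=\sum_{k\in\mathbb Z} a_kw^k$ for $|w|=1$, both series being absolutely convergent. The functional $\gamma$ is defined by $\langle g(x),\gamma\rangle_x=\langle g(w+\bar w),\mu\rangle_w$. * $P_n$ ($n\ge 0$) are the monic orthogonal polynomials of $\gamma$: $\deg P_n=n$, $\langle x^kP_n,\gamma\rangle=0$ for $k<n$, and $\langle x^nP_n,\gamma\rangle\ne0$. The real numbers $b_n,c_n$ ($n\ge1$) are their recurrence coefficients, $xP_n=P_{n+1}+b_{n+1}P_n+c_nP_{n-1}$ with $P_{-1}=0$. * $H$ is the bounded operator on $\ell^2$ with tridiagonal matrix having diagonal $b_1,b_2,\dots$, superdiagonal $\sqrt{|c_1|},\sqrt{|c_2|},\dots$ and subdiagonal $c_1/\sqrt{|c_1|},c_2/\sqrt{|c_2|},\dots$.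 Let $\Delta_1=1$, $\Delta_{n+1}=\Delta_n\operatorname{sign}c_n$, $(x,y)_G=\sum_n\Delta_nx_n\overline{y_n}$, $e=(1,0,0,\dots)^\top$. The $m$-function of $H$ is $m(z)=((H-z)^{-1}e,e)_G$, with the resolvent set of $H$ as its domain. Theorem. The objects $f_n$, $B$, $P_n$, $b_n$, $c_n$, $H$ exist, and any objects fitting these descriptions satisfy the following. 1. For all $z$ in some neighborhood of $0$, $F(z)=\left\langle\dfrac{w+z}{w-z},\mu\right\rangle_w$. 2. All $z$ in some neighborhood of infinity are in the resolvent set of $H$ and satisfy $m(z)=\left\langle\dfrac1{x-z},\gamma\right\rangle_x$. 3. For every $z\in\mathbb D$ with $B(z)\ne0$ and $z\neq 0$, the point $z+z^{-1}$ is in the resolvent set of $H$ and $$F(z)=(z-z^{-1})\,m(z+z^{-1}).$$ Moreover $B(0)\ne0$, and the formula holds at $z=0$ in the sense that $F(0)=\lim_{z\to0}(z-z^{-1})\,m(z+z^{-1})$. -/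

import Mathlib

open scoped Topology Polynomial ComplexConjugate LaurentPolynomial

noncomputable section

namespace SzegoMap

/-- The open unit disk. -/
abbrev disk : Set ℂ := Metric.ball 0 1

/-! ### Polynomials generated by the Szegő recurrence -/

/-- The reversed polynomial of degree `n`: `p^*(z) = z ^ n * conj (p (1 / conj z))`, that is, the
coefficient of `z ^ j` in `p^*` is the conjugate of the coefficient of `z ^ (n - j)` in `p`. -/
def revPoly (n : ℕ) (p : ℂ[X]) : ℂ[X] := (p.map (starRingEnd ℂ)).reflect n

/-- The monic polynomials `Φ_n`: `Φ_0 = 1` and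
`Φ_{n+1}(z) = z Φ_n(z) - conj (α_n) Φ_n^*(z)`. -/
def Phi (α : ℕ → ℂ) : ℕ → ℂ[X]
  | 0 => 1
  | n + 1 => Polynomial.X * Phi α n - Polynomial.C (conj (α n)) * revPoly n (Phi α n)

/-- The reversed polynomials `Φ_n^*`. -/
def PhiStar (α : ℕ → ℂ) (n : ℕ) : ℂ[X] := revPoly n (Phi α n)

/-! ### The distributions `μ` and `γ` -/

/-- The moments `⟨w ^ n, μ⟩` for `n ≥ 0`: `⟨1, μ⟩ = 1` and, if `Φ_n(z) = z ^ n + ∑_{j < n} t_j z ^ j`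
with `n ≥ 1`, then `⟨w ^ n, μ⟩ = - ∑_{j < n} t_j ⟨w ^ j, μ⟩`. -/
def moment (α : ℕ → ℂ) : ℕ → ℂ
  | 0 => 1
  | n + 1 => -∑ j : Fin (n + 1), (Phi α (n + 1)).coeff j * moment α j
termination_by n => n
decreasing_by exact j.2

/-- The moments `⟨w ^ k, μ⟩`, `k ∈ ℤ`, where `⟨w ^ (-n), μ⟩ = conj ⟨w ^ n, μ⟩`. -/
def intMoment (α : ℕ → ℂ) (k : ℤ) : ℂ :=
  if 0 ≤ k then moment α k.toNat else conj (moment α (-k).toNat)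

/-- The distribution `μ` as a linear functional on Laurent polynomials in `w`
(`T k` stands for `w ^ k`, and `conj w` for `w ^ (-1)`). -/
def mu (α : ℕ → ℂ) : ℂ[T;T⁻¹] →ₗ[ℂ] ℂ where
  toFun p := p.coeff.sum fun k a => a * intMoment α k
  map_add' p q := by
    rw [AddMonoidAlgebra.coeff_add]
    exact Finsupp.sum_add_index' (by simp) (by intros; ring)
  map_smul' r p := by
    rw [AddMonoidAlgebra.coeff_smul, Finsupp.sum_smul_index' (by simp)]
    simp [Finsupp.mul_sum, mul_assoc]

/-- `⟨w ^ k, μ⟩` is the `k`-th moment. -/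
theorem mu_T (α : ℕ → ℂ) (k : ℤ) : mu α (LaurentPolynomial.T k) = intMoment α k := by
  change Finsupp.sum (Finsupp.single k (1 : ℂ)) (fun k a => a * intMoment α k) = _
  rw [Finsupp.sum_single_index] <;> simp

/-- The extension by linearity of a functional `L` on Laurent polynomials to Laurent series:
`⟨g, L⟩ = s` holds if `g` is on the unit circle the sum of a series `∑_k a_k w ^ k` and
`∑_k a_k ⟨w ^ k, L⟩ = s`, both series being (unconditionally, hence absolutely) convergent.
The coefficients `a_k` are then the Fourier coefficients of `g`, so `s` is determined
by `L` and `g`. -/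
def HasPairing (L : ℂ[T;T⁻¹] →ₗ[ℂ] ℂ) (g : ℂ → ℂ) (s : ℂ) : Prop :=
  ∃ a : ℤ → ℂ, (∀ w : ℂ, ‖w‖ = 1 → HasSum (fun k => a k * w ^ k) (g w)) ∧
    HasSum (fun k => a k * L (LaurentPolynomial.T k)) s

/-- The distribution `γ` on polynomials: `⟨g(x), γ⟩ = ⟨g(w + conj w), μ⟩`. -/
def gam (α : ℕ → ℂ) : ℂ[X] →ₗ[ℂ] ℂ :=
  (mu α).comp (Polynomial.aeval
    (LaurentPolynomial.T 1 + LaurentPolynomial.T (-1) : ℂ[T;T⁻¹])).toLinearMap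

/-- `⟨g(x), γ⟩ = s` for a general test function `g`: by definition `⟨g(w + conj w), μ⟩ = s`. -/
def HasGamPairing (α : ℕ → ℂ) (g : ℂ → ℂ) (s : ℂ) : Prop :=
  HasPairing (mu α) (fun w => g (w + conj w)) s

/-! ### The functions `f_n`, `F` and `B` -/

/-- Schur functions: analytic in the unit disk and bounded there by `1`. -/
def IsSchurFunction (g : ℂ → ℂ) : Prop :=
  DifferentiableOn ℂ g disk ∧ ∀ z ∈ disk, ‖g z‖ ≤ 1

/-- The sequence `f_n`: meromorphic functions in the unit disk, with
`f_n = (α_n + z f_{n+1}) / (1 + conj (α_n) z f_{n+1})` as meromorphic functions (that is, off a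
discrete subset of the disk), such that `f_n` is a Schur function for `n ≥ N`. -/
structure IsSchurSequence (α : ℕ → ℂ) (N : ℕ) (f : ℕ → ℂ → ℂ) : Prop where
  schur : ∀ n, N ≤ n → IsSchurFunction (f n)
  meromorphic : ∀ n, MeromorphicNFOn (f n) disk
  recursion : ∀ n, f n =ᶠ[Filter.codiscreteWithin disk]
    fun z => (α n + z * f (n + 1) z) / (1 + conj (α n) * z * f (n + 1) z)

/-- The meromorphic function `F = (1 + z f) / (1 - z f)` in the unit disk; passing to the normal
form removes the removable singularities of the pointwise quotient. -/
def bigF (f : ℂ → ℂ) : ℂ → ℂ :=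
  toMeromorphicNFOn (fun z => (1 + z * f z) / (1 - z * f z)) disk

open Classical in
/-- The Blaschke product `B_n` of the zeros of `Φ_n^*` in the unit disk, with multiplicities. -/
def blaschke (α : ℕ → ℂ) (n : ℕ) (z : ℂ) : ℂ :=
  (((PhiStar α n).roots.filter fun l => ‖l‖ < 1).map
    fun l => (‖l‖ : ℂ) / l * ((l - z) / (1 - conj l * z))).prod

/-- `B` is the locally uniform limit of the Blaschke products `B_n` in the unit disk. -/
def IsBlaschkeLimit (α : ℕ → ℂ) (B : ℂ → ℂ) : Prop :=
  TendstoLocallyUniformlyOn (blaschke α) B Filter.atTop disk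

/-! ### Orthogonal polynomials on the line, the matrix `H` and its `m`-function -/

/-- `P_n` are the monic orthogonal polynomials of the functional `L` (`deg P_n = n`). -/
structure IsMonicOrthogonal (L : ℂ[X] →ₗ[ℂ] ℂ) (P : ℕ → ℂ[X]) : Prop where
  monic : ∀ n, (P n).Monic
  natDegree : ∀ n, (P n).natDegree = n
  orthogonal : ∀ n k, k < n → L (Polynomial.X ^ k * P n) = 0
  ne_zero : ∀ n, L (Polynomial.X ^ n * P n) ≠ 0

/-- The recurrence `x P_n = P_{n+1} + b_{n+1} P_n + c_n P_{n-1}`, with `P_{-1} = 0`; the values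
`b 0` and `c 0` are not used. -/
structure IsRecurrence (P : ℕ → ℂ[X]) (b c : ℕ → ℝ) : Prop where
  zero : Polynomial.X * P 0 = P 1 + Polynomial.C (b 1 : ℂ) * P 0
  succ : ∀ n, Polynomial.X * P (n + 1) =
    P (n + 2) + Polynomial.C (b (n + 2) : ℂ) * P (n + 1) + Polynomial.C (c (n + 1) : ℂ) * P n

/-- The tridiagonal matrix `H` with diagonal `b_1, b_2, …`, superdiagonal `√|c_1|, √|c_2|, …` and
subdiagonal `c_1 / √|c_1|, c_2 / √|c_2|, …` (rows and columns are numbered from `0` here). -/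
def jacobi (b c : ℕ → ℝ) (i j : ℕ) : ℝ :=
  if i = j then b (i + 1)
  else if j = i + 1 then √|c (i + 1)|
  else if i = j + 1 then c (j + 1) / √|c (j + 1)|
  else 0

/-- The Hilbert space `ℓ²`. -/
abbrev ell2 : Type := lp (fun _ : ℕ => ℂ) 2

/-- The standard basis of `ℓ²`; the vector `e` is `basisVec 0`. -/
def basisVec (j : ℕ) : ell2 := lp.single 2 j 1

/-- The bounded operator `H` on `ℓ²` has the matrix `M` in the standard basis. -/
def HasMatrix (H : ell2 →L[ℂ] ell2) (M : ℕ → ℕ → ℝ) : Prop :=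
  ∀ i j, H (basisVec j) i = (M i j : ℂ)

/-- The signs `Δ_1, Δ_2, …` (numbered from `0` here): `Δ_1 = 1` and `Δ_{n+1} = Δ_n sign(c_n)`, so that
`c_n / √|c_n| = Δ_n Δ_{n+1} √|c_n|`. -/
def signs (c : ℕ → ℝ) : ℕ → ℝ
  | 0 => 1
  | n + 1 => signs c n * SignType.sign (c (n + 1))

/-- The form `(x, y)_G = ⟨G x, y⟩` on `ℓ²` with `G = diag(Δ_1, Δ_2, …)`. -/
def gForm (c : ℕ → ℝ) (x y : ell2) : ℂ := ∑' n, (signs c n : ℂ) * x n * conj (y n)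

/-- The `m`-function `m(z) = ((H - z)⁻¹ e, e)_G`, whose domain is the resolvent set of `H`. -/
def mFun (c : ℕ → ℝ) (H : ell2 →L[ℂ] ell2) (z : ℂ) : ℂ :=
  gForm c (Ring.inverse (H - algebraMap ℂ (ell2 →L[ℂ] ell2) z) (basisVec 0)) (basisVec 0)

end SzegoMap

end

/-! Since the parameters are real, `(Φ_n, Φ_n^*)` and `(Ψ_n, -Ψ_n^*)`, where the second kind
polynomials `Ψ_n` belong to `-α`, solve one and the same linear recurrence. Its transfer matrices
have determinant `z (1 - α_n ^ 2)`, and the Schur recursion is the induced action on ratios. Hence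
`F = (Ψ_M^* + z f_M Ψ_M) / (Φ_M^* - z f_M Φ_M)` for `M ≥ N` (`bigF_eventuallyEq`), and the
determinant identity gives `F Φ_n^* - Ψ_n^* = O(z ^ (n + 1))`. Comparing top coefficients in this
relation reproduces the equations that define the moments, so `F = 1 + 2 ∑ ⟨w ^ n, μ⟩ z ^ n` near
zero (`eventually_hasSum_bigF`); this is the first claim. Expanding `1 / (w + w⁻¹ - ζ - ζ⁻¹)` in
powers of `w` turns the pairing with `γ` into `F(ζ) / (ζ - ζ⁻¹)`, so the second claim follows from
the identity in the third.

For the third claim, the Szegő mapping sends a solution `(X, Y)` to `y_n = z ^ (-n) (z X_{2n-1} +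
Y_{2n-1})`, which satisfies a three-term recurrence with the Geronimus coefficients
(`IsSzegoImage.recurrence`). Applied to `(Φ, Φ^*)` in Laurent polynomials this identifies `b_n` and
`c_n` (`gam_recPoly`). Applied at a point `z` to the solution with `Y_n = z f_n X_n` for `n ≥ N`, it
gives, after division by `∏ √|c_i|`, an `ℓ²` vector `u` with `H u = (z + z⁻¹) u + κ e`. Its first
entry and `κ` yield `m = u_0 / κ = F / (z - z⁻¹)`, where `κ` is a nonzero multiple of the
denominator `d = Φ_N^* - z f_N Φ_N`.

To see that `z + z⁻¹` is in the resolvent set when `d(z) ≠ 0`, replace the first `N` parameters by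
zero. This changes finitely many rows of `H` and gives an operator `T` with `2 ± T ≥ 0`, whose
spectrum lies in `[-2, 2]`. By the Fredholm alternative only eigenvalues could obstruct, and the
Wronskian of an eigenvector with `u` excludes them (`eq_zero_of_apply_eq_smul`).

Finally `B` must detect the zeros of `d`. Truncating the Schur algorithm after `n` steps gives
functions `d_n → d` that differ from `Φ_n^*` by zero-free factors, and by Rouché the number of zeros
of `Φ_n^*` in the disk is constant for `n ≥ N`. Along each ultrafilter these zeros converge in the
closed disk. The limits inside the disk are the zeros of `d`, while Blaschke factors of limits on
the circle equal `1`. So `B` exists and vanishes wherever `d` does (`exists_isBlaschkeLimit`,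
`blaschke_limit_ne_zero`). -/

noncomputable section

namespace SzegoMap

/-! ### The Szegő recurrence -/

/-- A real sequence as a sequence of complex numbers. -/
abbrev cx (α : ℕ → ℝ) : ℕ → ℂ := fun n => (α n : ℂ)

theorem cx_neg (α : ℕ → ℝ) (n : ℕ) : cx (-α) n = -cx α n := by
  rw [cx, Pi.neg_apply, Complex.ofReal_neg]

/-- Solutions `(X_n, Y_n)` of the Szegő recurrence with parameters `a_n` in a commutative ring. -/
structure IsSzegoSolution {R : Type*} [CommRing R] (a : ℕ → R) (z : R) (X Y : ℕ → R) : Prop where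
  fst : ∀ n, X (n + 1) = z * X n - a n * Y n
  snd : ∀ n, Y (n + 1) = Y n - a n * (z * X n)

/-- One step of the recurrence is a matrix of determinant `z (1 - a n ^ 2)`; the left-hand side is
the Wronskian of two solutions. -/
theorem IsSzegoSolution.det_eq {R : Type*} [CommRing R] {a : ℕ → R} {z : R} {X Y X' Y' : ℕ → R}
    (h : IsSzegoSolution a z X Y) (h' : IsSzegoSolution a z X' Y') (n : ℕ) :
    X n * Y' n - X' n * Y n =
      z ^ n * (∏ k ∈ Finset.range n, (1 - a k ^ 2)) * (X 0 * Y' 0 - X' 0 * Y 0) := by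
  induction n with
  | zero => simp
  | succ n ih =>
    rw [h.fst, h.snd, h'.fst, h'.snd, Finset.prod_range_succ, pow_succ]
    linear_combination z * (1 - a n ^ 2) * ih

theorem IsSzegoSolution.map {R S : Type*} [CommRing R] [CommRing S] (φ : R →+* S) {a : ℕ → R}
    {z : R} {X Y : ℕ → R} (h : IsSzegoSolution a z X Y) :
    IsSzegoSolution (fun n => φ (a n)) (φ z) (fun n => φ (X n)) (fun n => φ (Y n)) :=
  ⟨fun n => by simp [h.fst], fun n => by simp [h.snd]⟩

theorem coeff_revPoly (n : ℕ) (p : ℂ[X]) (j : ℕ) :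
    (revPoly n p).coeff j = conj (p.coeff (Polynomial.revAt n j)) := by
  simp [revPoly, Polynomial.coeff_reflect]

theorem coeff_revPoly_of_le {n j : ℕ} (p : ℂ[X]) (h : j ≤ n) :
    (revPoly n p).coeff j = conj (p.coeff (n - j)) := by
  rw [coeff_revPoly, Polynomial.revAt_le h]

theorem coeff_revPoly_of_lt {n j : ℕ} (p : ℂ[X]) (h : n < j) :
    (revPoly n p).coeff j = conj (p.coeff j) := by
  rw [coeff_revPoly, Polynomial.revAt_eq_self_of_lt h]

theorem natDegree_revPoly_le {n : ℕ} {p : ℂ[X]} (h : p.natDegree ≤ n) :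
    (revPoly n p).natDegree ≤ n := by
  rw [Polynomial.natDegree_le_iff_coeff_eq_zero]
  intro j hj
  rw [coeff_revPoly_of_lt _ hj, Polynomial.coeff_eq_zero_of_natDegree_lt (h.trans_lt hj), map_zero]

theorem revPoly_succ_X_mul {n : ℕ} {p : ℂ[X]} (h : p.natDegree ≤ n) :
    revPoly (n + 1) (Polynomial.X * p) = revPoly n p := by
  ext j
  rcases lt_trichotomy j (n + 1) with hj | rfl | hj
  · rw [coeff_revPoly_of_le _ hj.le, coeff_revPoly_of_le _ (Nat.lt_succ_iff.mp hj),
      Nat.succ_sub (Nat.lt_succ_iff.mp hj), Polynomial.coeff_X_mul]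
  · rw [coeff_revPoly_of_le _ le_rfl, coeff_revPoly_of_lt _ (Nat.lt_succ_self n),
      Polynomial.coeff_eq_zero_of_natDegree_lt (h.trans_lt (Nat.lt_succ_self n))]
    simp
  · rw [coeff_revPoly_of_lt _ hj, coeff_revPoly_of_lt _ (by omega)]
    obtain ⟨k, rfl⟩ : ∃ k, j = k + 1 := ⟨j - 1, by omega⟩
    rw [Polynomial.coeff_X_mul, Polynomial.coeff_eq_zero_of_natDegree_lt (by omega),
      Polynomial.coeff_eq_zero_of_natDegree_lt (by omega)]

theorem revPoly_succ_revPoly {n : ℕ} {p : ℂ[X]} (h : p.natDegree ≤ n) :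
    revPoly (n + 1) (revPoly n p) = Polynomial.X * p := by
  ext j
  rcases j with _ | j
  · rw [coeff_revPoly_of_le _ (Nat.zero_le _), coeff_revPoly_of_lt _ (by omega),
      Polynomial.coeff_eq_zero_of_natDegree_lt (by omega)]
    simp
  · rw [Polynomial.coeff_X_mul]
    rcases lt_or_ge n j with hj | hj
    · rw [coeff_revPoly_of_lt _ (by omega), coeff_revPoly_of_lt _ (by omega),
        Polynomial.coeff_eq_zero_of_natDegree_lt (by omega),
        Polynomial.coeff_eq_zero_of_natDegree_lt (by omega)]
      simp
    · rw [coeff_revPoly_of_le _ (by omega), coeff_revPoly_of_le _ (by omega)]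
      simp only [Complex.conj_conj]
      congr 1
      omega

theorem revPoly_sub (n : ℕ) (p q : ℂ[X]) : revPoly n (p - q) = revPoly n p - revPoly n q := by
  ext j; simp [coeff_revPoly]

theorem revPoly_C_mul (n : ℕ) (c : ℂ) (q : ℂ[X]) :
    revPoly n (Polynomial.C c * q) = Polynomial.C (conj c) * revPoly n q := by
  ext j; simp [coeff_revPoly]

theorem natDegree_Phi_le (a : ℕ → ℂ) (n : ℕ) : (Phi a n).natDegree ≤ n := by
  induction n with
  | zero => simp [Phi]
  | succ n ih =>
    rw [Phi]
    refine (Polynomial.natDegree_sub_le _ _).trans (max_le ?_ ?_)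
    · exact Polynomial.natDegree_mul_le.trans (by simp; omega)
    · exact (Polynomial.natDegree_C_mul_le _ _).trans ((natDegree_revPoly_le ih).trans n.le_succ)

theorem natDegree_PhiStar_le (a : ℕ → ℂ) (n : ℕ) : (PhiStar a n).natDegree ≤ n :=
  natDegree_revPoly_le (natDegree_Phi_le a n)

theorem PhiStar_succ (a : ℕ → ℂ) (n : ℕ) :
    PhiStar a (n + 1) = PhiStar a n - Polynomial.C (a n) * (Polynomial.X * Phi a n) := by
  have h := natDegree_Phi_le a n
  rw [PhiStar, Phi, revPoly_sub, revPoly_C_mul, revPoly_succ_X_mul h, revPoly_succ_revPoly h,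
    Complex.conj_conj, PhiStar]

theorem PhiStar_zero (a : ℕ → ℂ) : PhiStar a 0 = 1 := by
  ext j
  rcases j with _ | j
  · simp [PhiStar, coeff_revPoly, Phi]
  · rw [PhiStar, coeff_revPoly_of_lt _ (by omega)]
    simp [Phi, Polynomial.coeff_one]

theorem coeff_Phi_self (a : ℕ → ℂ) (n : ℕ) : (Phi a n).coeff n = 1 := by
  induction n with
  | zero => simp [Phi]
  | succ n ih =>
    rw [Phi, Polynomial.coeff_sub, Polynomial.coeff_X_mul, ih, Polynomial.coeff_C_mul,
      Polynomial.coeff_eq_zero_of_natDegree_lt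
        ((natDegree_revPoly_le (natDegree_Phi_le a n)).trans_lt n.lt_succ_self)]
    simp

theorem coeff_PhiStar_of_le (a : ℕ → ℂ) {n j : ℕ} (h : j ≤ n) :
    (PhiStar a n).coeff j = conj ((Phi a n).coeff (n - j)) :=
  coeff_revPoly_of_le _ h

theorem coeff_PhiStar_zero (a : ℕ → ℂ) (n : ℕ) : (PhiStar a n).coeff 0 = 1 := by
  rw [coeff_PhiStar_of_le a (Nat.zero_le n), Nat.sub_zero, coeff_Phi_self, map_one]

theorem eval_zero_PhiStar (a : ℕ → ℂ) (n : ℕ) : (PhiStar a n).eval 0 = 1 := by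
  rw [← Polynomial.coeff_zero_eq_eval_zero, coeff_PhiStar_zero]

theorem PhiStar_ne_zero (a : ℕ → ℂ) (n : ℕ) : PhiStar a n ≠ 0 := fun h => by
  simpa [h] using eval_zero_PhiStar a n

theorem isSzegoSolution_Phi (α : ℕ → ℝ) :
    IsSzegoSolution (fun n => Polynomial.C (cx α n)) Polynomial.X (Phi (cx α)) (PhiStar (cx α)) where
  fst n := by simp [Phi, PhiStar]
  snd n := PhiStar_succ _ n

/-- Negating the second component undoes the sign of the parameters, so the second kind polynomials
supply a second solution of the recurrence with parameters `α`. -/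
theorem isSzegoSolution_Phi_neg (α : ℕ → ℝ) :
    IsSzegoSolution (fun n => Polynomial.C (cx α n)) Polynomial.X (Phi (cx (-α)))
      (fun n => -PhiStar (cx (-α)) n) where
  fst n := by simp [Phi, PhiStar]
  snd n := by rw [PhiStar_succ, cx_neg, map_neg]; ring

theorem isSzegoSolution_eval_Phi (α : ℕ → ℝ) (z : ℂ) :
    IsSzegoSolution (cx α) z (fun n => (Phi (cx α) n).eval z)
      (fun n => (PhiStar (cx α) n).eval z) := by
  simpa using (isSzegoSolution_Phi α).map (Polynomial.evalRingHom z)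

theorem isSzegoSolution_eval_Phi_neg (α : ℕ → ℝ) (z : ℂ) :
    IsSzegoSolution (cx α) z (fun n => (Phi (cx (-α)) n).eval z)
      (fun n => -(PhiStar (cx (-α)) n).eval z) := by
  simpa using (isSzegoSolution_Phi_neg α).map (Polynomial.evalRingHom z)

/-- `Φ_n Ψ_n^* + Ψ_n Φ_n^* = 2 z^n ∏_{k < n} (1 - α_k ^ 2)`, with the second kind polynomials
`Ψ_n` (those of `-α`). -/
theorem Phi_mul_PhiStar_neg_add (α : ℕ → ℝ) (n : ℕ) :
    Phi (cx α) n * PhiStar (cx (-α)) n + Phi (cx (-α)) n * PhiStar (cx α) n =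
      2 * Polynomial.X ^ n * Polynomial.C (∏ k ∈ Finset.range n, (1 - cx α k ^ 2)) := by
  have h := (isSzegoSolution_Phi α).det_eq (isSzegoSolution_Phi_neg α) n
  simp only [Phi, PhiStar_zero] at h
  simp only [map_prod, map_sub, map_one, map_pow]
  linear_combination -h

theorem map_conj_Phi (α : ℕ → ℝ) (n : ℕ) :
    (Phi (cx α) n).map (starRingEnd ℂ) = Phi (cx α) n ∧
      (PhiStar (cx α) n).map (starRingEnd ℂ) = PhiStar (cx α) n := by
  induction n with
  | zero => simp [Phi, PhiStar_zero]
  | succ n ih =>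
    rw [(isSzegoSolution_Phi α).fst, (isSzegoSolution_Phi α).snd]
    simp [ih.1, ih.2]

theorem conj_coeff_Phi (α : ℕ → ℝ) (n j : ℕ) :
    conj ((Phi (cx α) n).coeff j) = (Phi (cx α) n).coeff j := by
  conv_rhs => rw [← (map_conj_Phi α n).1]
  simp

theorem coeff_PhiStar_of_le' (α : ℕ → ℝ) {n j : ℕ} (h : j ≤ n) :
    (PhiStar (cx α) n).coeff j = (Phi (cx α) n).coeff (n - j) := by
  rw [coeff_PhiStar_of_le _ h, conj_coeff_Phi]

theorem coeff_PhiStar_succ_self (α : ℕ → ℝ) (n : ℕ) :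
    (PhiStar (cx α) (n + 1)).coeff (n + 1) = -cx α n := by
  rw [PhiStar_succ, Polynomial.coeff_sub, Polynomial.coeff_C_mul, Polynomial.coeff_X_mul,
    coeff_Phi_self, Polynomial.coeff_eq_zero_of_natDegree_lt
      ((natDegree_PhiStar_le _ n).trans_lt n.lt_succ_self)]
  simp

/-! ### Real parameters: an identity of squared norms -/

theorem normSq_sub_ofReal_mul (t : ℝ) (u v : ℂ) :
    Complex.normSq (u - t * v) - Complex.normSq (v - t * u) =
      (1 - t ^ 2) * (Complex.normSq u - Complex.normSq v) := by
  simp only [Complex.normSq_apply, Complex.sub_re, Complex.sub_im, Complex.mul_re, Complex.mul_im,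
    Complex.ofReal_re, Complex.ofReal_im]
  ring

/-- On the unit circle each step multiplies `|Φ_n|² - |Φ_n^*|²` by `1 - α_n ^ 2`, and the difference
starts at zero. No bound on the parameters is needed. -/
theorem norm_eval_Phi_of_norm_eq_one (α : ℕ → ℝ) (n : ℕ) {z : ℂ} (hz : ‖z‖ = 1) :
    ‖(Phi (cx α) n).eval z‖ = ‖(PhiStar (cx α) n).eval z‖ := by
  have key : Complex.normSq ((Phi (cx α) n).eval z) -
      Complex.normSq ((PhiStar (cx α) n).eval z) = 0 := by
    induction n with
    | zero => simp [Phi, PhiStar_zero]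
    | succ n ih =>
      rw [(isSzegoSolution_eval_Phi α z).fst, (isSzegoSolution_eval_Phi α z).snd,
        normSq_sub_ofReal_mul, Complex.normSq_mul, Complex.normSq_eq_norm_sq z, hz]
      rw [one_pow, one_mul, ih, mul_zero]
  rw [← sq_eq_sq₀ (norm_nonneg _) (norm_nonneg _), ← Complex.normSq_eq_norm_sq,
    ← Complex.normSq_eq_norm_sq]
  linarith

theorem prod_one_sub_sq_ne_zero {α : ℕ → ℝ} (h : ∀ n, |α n| ≠ 1) (n : ℕ) :
    ∏ k ∈ Finset.range n, (1 - cx α k ^ 2) ≠ 0 := by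
  refine Finset.prod_ne_zero_iff.mpr fun k _ hk => h k ?_
  have h1 : α k ^ 2 = 1 := by
    have h2 : ((1 - α k ^ 2 : ℝ) : ℂ) = 0 := by push_cast; exact hk
    have := Complex.ofReal_eq_zero.mp h2
    linarith
  rwa [← sq_eq_sq₀ (abs_nonneg _) zero_le_one, sq_abs, one_pow]

/-- A zero on the circle would be a common zero of `Φ_n` and `Φ_n^*`, against the determinant
identity. -/
theorem eval_PhiStar_ne_zero_of_norm_eq_one {α : ℕ → ℝ} (h : ∀ n, |α n| ≠ 1) (n : ℕ) {z : ℂ}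
    (hz : ‖z‖ = 1) : (PhiStar (cx α) n).eval z ≠ 0 := by
  intro h0
  have h1 : (Phi (cx α) n).eval z = 0 := by
    rw [← norm_eq_zero, norm_eval_Phi_of_norm_eq_one α n hz, h0, norm_zero]
  have h2 := congrArg (Polynomial.eval z) (Phi_mul_PhiStar_neg_add α n)
  simp only [Polynomial.eval_add, Polynomial.eval_mul, h0, h1, zero_mul, mul_zero, add_zero,
    Polynomial.eval_pow, Polynomial.eval_X, Polynomial.eval_C] at h2
  have hz0 : z ≠ 0 := fun h => by simp [h] at hz
  have := prod_one_sub_sq_ne_zero h n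
  simp_all

/-! ### Schur iterates at a point of the disk -/

theorem mem_disk_iff {z : ℂ} : z ∈ disk ↔ ‖z‖ < 1 := mem_ball_zero_iff

theorem zero_mem_disk : (0 : ℂ) ∈ disk := by simp [disk]

theorem one_sub_norm_sq_pos {z : ℂ} (hz : z ∈ disk) : 0 < 1 - ‖z‖ ^ 2 := by
  rw [mem_disk_iff] at hz
  nlinarith [norm_nonneg z]

theorem norm_ofReal_mul_mul_lt_one {t : ℝ} (ht : |t| < 1) {z w : ℂ} (hz : z ∈ disk)
    (hw : ‖w‖ ≤ 1) : ‖(t : ℂ) * z * w‖ < 1 := by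
  rw [mem_disk_iff] at hz
  rw [norm_mul, norm_mul, Complex.norm_real, Real.norm_eq_abs]
  calc |t| * ‖z‖ * ‖w‖ ≤ 1 * ‖z‖ * 1 := by gcongr
    _ < 1 := by simpa using hz

theorem one_add_ne_zero_of_norm_lt_one {w : ℂ} (h : ‖w‖ < 1) : 1 + w ≠ 0 := fun h0 => by
  rw [eq_neg_of_add_eq_zero_right h0] at h
  simp at h

/-- The numbers `g_N, …, g_m` in the closed unit disk are related by the Schur recursion at `z`. -/
structure IsSchurChain (α : ℕ → ℝ) (z : ℂ) (N m : ℕ) (g : ℕ → ℂ) : Prop where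
  norm_le : ∀ k, N ≤ k → k ≤ m → ‖g k‖ ≤ 1
  recursion : ∀ k, N ≤ k → k < m → g k * (1 + α k * z * g (k + 1)) = α k + z * g (k + 1)

theorem IsSchurChain.mono {α : ℕ → ℝ} {z : ℂ} {N m m' : ℕ} {g : ℕ → ℂ}
    (h : IsSchurChain α z N m g) (hm : m' ≤ m) : IsSchurChain α z N m' g :=
  ⟨fun k h1 h2 => h.norm_le k h1 (h2.trans hm), fun k h1 h2 => h.recursion k h1 (h2.trans_le hm)⟩

theorem norm_sq_add_sub (t : ℝ) (w : ℂ) :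
    ‖1 + t * w‖ ^ 2 - ‖t + w‖ ^ 2 = (1 - t ^ 2) * (1 - ‖w‖ ^ 2) := by
  have := normSq_sub_ofReal_mul (-t) 1 w
  simp only [Complex.normSq_eq_norm_sq] at this
  push_cast at this
  rw [show (1 : ℂ) - -t * w = 1 + t * w by ring, show w - -(t : ℂ) * 1 = t + w by ring] at this
  rw [this]
  simp

theorem norm_sq_schurStep {t : ℝ} {w g : ℂ} (hne : 1 + t * w ≠ 0) (h : g * (1 + t * w) = t + w) :
    1 - ‖g‖ ^ 2 = (1 - t ^ 2) / ‖1 + t * w‖ ^ 2 * (1 - ‖w‖ ^ 2) := by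
  have h1 := norm_sq_add_sub t w
  rw [← h, norm_mul, mul_pow] at h1
  have h2 : ‖1 + t * w‖ ^ 2 ≠ 0 := by simpa using hne
  field_simp
  linear_combination h1

/-- The product of the squared contraction factors of a chain of Schur iterates. -/
def chainFactor (α : ℕ → ℝ) (z : ℂ) (g : ℕ → ℂ) (N m : ℕ) : ℝ :=
  ∏ k ∈ Finset.Ico N m, (1 - α k ^ 2) / ‖1 + α k * z * g (k + 1)‖ ^ 2

theorem chainFactor_nonneg {α : ℕ → ℝ} {N : ℕ} (hα : ∀ n, N ≤ n → |α n| < 1) (z : ℂ)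
    (g : ℕ → ℂ) (m : ℕ) : 0 ≤ chainFactor α z g N m := by
  refine Finset.prod_nonneg fun k hk => div_nonneg ?_ (sq_nonneg _)
  have := (sq_lt_one_iff_abs_lt_one (α k)).mpr (hα k (Finset.mem_Ico.mp hk).1)
  linarith

theorem IsSchurChain.denom_ne_zero {α : ℕ → ℝ} {z : ℂ} {N m : ℕ} {g : ℕ → ℂ}
    (h : IsSchurChain α z N m g) (hα : ∀ n, N ≤ n → |α n| < 1) (hz : z ∈ disk) {k : ℕ}
    (h1 : N ≤ k) (h2 : k < m) : 1 + α k * z * g (k + 1) ≠ 0 :=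
  one_add_ne_zero_of_norm_lt_one
    (norm_ofReal_mul_mul_lt_one (hα k h1) hz (h.norm_le _ (h1.trans k.le_succ) h2))

/-- The quantity `chainFactor · (1 - |z g_m|²)` does not increase with `m`: a Schur step turns it
into the previous factor times `1 - |g_m|²`, which is at most `1 - |z g_m|²`. The bound is uniform
in `m` and drives both the convergence of the Schur algorithm and the decay of the `ℓ²` solution. -/
theorem IsSchurChain.chainFactor_le {α : ℕ → ℝ} {z : ℂ} {N m : ℕ} {g : ℕ → ℂ}
    (h : IsSchurChain α z N m g) (hα : ∀ n, N ≤ n → |α n| < 1) (hz : z ∈ disk) (hm : N ≤ m) :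
    chainFactor α z g N m ≤ 1 / (1 - ‖z‖ ^ 2) := by
  have hz1 : ‖z‖ ≤ 1 := (mem_disk_iff.mp hz).le
  have key : chainFactor α z g N m * (1 - ‖z * g m‖ ^ 2) ≤ 1 := by
    induction m, hm using Nat.le_induction with
    | base => simp [chainFactor]; positivity
    | succ m hm ih =>
      have ih := ih (h.mono m.le_succ)
      have hne := h.denom_ne_zero hα hz hm m.lt_succ_self
      rw [mul_assoc] at hne
      have h1 := norm_sq_schurStep hne
        (by have := h.recursion m hm m.lt_succ_self; rwa [mul_assoc (α m : ℂ)] at this)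
      have h2 : chainFactor α z g N (m + 1) * (1 - ‖z * g (m + 1)‖ ^ 2) =
          chainFactor α z g N m * (1 - ‖g m‖ ^ 2) := by
        rw [chainFactor, Finset.prod_Ico_succ_top hm, h1, chainFactor]
        simp only [mul_assoc]
      rw [h2]
      refine le_trans (mul_le_mul_of_nonneg_left ?_ (chainFactor_nonneg hα z g m)) ih
      rw [norm_mul, mul_pow]
      have : ‖z‖ ^ 2 ≤ 1 := pow_le_one₀ (norm_nonneg _) hz1
      nlinarith [sq_nonneg ‖g m‖]
  rw [le_div_iff₀ (one_sub_norm_sq_pos hz)]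
  refine le_trans (mul_le_mul_of_nonneg_left ?_ (chainFactor_nonneg hα z g m)) key
  rw [norm_mul, mul_pow]
  have : ‖g m‖ ^ 2 ≤ 1 := pow_le_one₀ (norm_nonneg _) (h.norm_le m hm le_rfl)
  nlinarith [sq_nonneg ‖z‖]

theorem IsSchurChain.sub_eq {α : ℕ → ℝ} {z : ℂ} {N m : ℕ} {g g' : ℕ → ℂ}
    (h : IsSchurChain α z N m g) (h' : IsSchurChain α z N m g')
    (hα : ∀ n, N ≤ n → |α n| < 1) (hz : z ∈ disk) (hm : N ≤ m) :
    g N - g' N = (∏ k ∈ Finset.Ico N m, z * (1 - α k ^ 2) /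
      ((1 + α k * z * g (k + 1)) * (1 + α k * z * g' (k + 1)))) * (g m - g' m) := by
  induction m, hm using Nat.le_induction with
  | base => simp
  | succ m hm ih =>
    have hne := h.denom_ne_zero hα hz hm m.lt_succ_self
    have hne' := h'.denom_ne_zero hα hz hm m.lt_succ_self
    rw [ih (h.mono m.le_succ) (h'.mono m.le_succ), Finset.prod_Ico_succ_top hm, mul_assoc]
    congr 1
    rw [eq_div_of_mul_eq hne (h.recursion m hm m.lt_succ_self),
      eq_div_of_mul_eq hne' (h'.recursion m hm m.lt_succ_self)]
    field_simp
    ring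

/-- The squared modulus of the product in `sub_eq` is `|z| ^ (2 (m - N))` times the chain factors of
the two chains, each of which is at most `1 / (1 - |z|²)`. -/
theorem IsSchurChain.norm_sub_le {α : ℕ → ℝ} {z : ℂ} {N m : ℕ} {g g' : ℕ → ℂ}
    (h : IsSchurChain α z N m g) (h' : IsSchurChain α z N m g')
    (hα : ∀ n, N ≤ n → |α n| < 1) (hz : z ∈ disk) (hm : N ≤ m) :
    ‖g N - g' N‖ ≤ ‖z‖ ^ (m - N) / (1 - ‖z‖ ^ 2) * ‖g m - g' m‖ := by
  rw [h.sub_eq h' hα hz hm, norm_mul]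
  refine mul_le_mul_of_nonneg_right ?_ (norm_nonneg _)
  have hpos := one_sub_norm_sq_pos hz
  rw [← abs_of_nonneg (norm_nonneg (∏ k ∈ Finset.Ico N m, _)),
    ← abs_of_nonneg (div_nonneg (pow_nonneg (norm_nonneg z) (m - N)) hpos.le), ← sq_le_sq]
  have key : ‖∏ k ∈ Finset.Ico N m, z * (1 - α k ^ 2) /
      ((1 + α k * z * g (k + 1)) * (1 + α k * z * g' (k + 1)))‖ ^ 2 =
      (‖z‖ ^ (m - N)) ^ 2 * (chainFactor α z g N m * chainFactor α z g' N m) := by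
    rw [norm_prod, ← Finset.prod_pow, chainFactor, chainFactor, ← Finset.prod_mul_distrib,
      ← Nat.card_Ico, ← Finset.prod_const, ← Finset.prod_pow, ← Finset.prod_mul_distrib]
    refine Finset.prod_congr rfl fun k hk => ?_
    rw [norm_div, norm_mul, norm_mul]
    have : ‖(1 - (α k : ℂ) ^ 2)‖ ^ 2 = (1 - α k ^ 2) ^ 2 := by
      rw [show (1 - (α k : ℂ) ^ 2) = ((1 - α k ^ 2 : ℝ) : ℂ) by push_cast; rfl, Complex.norm_real,
        Real.norm_eq_abs, sq_abs]
    rw [div_pow, mul_pow, mul_pow, this]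
    ring
  rw [key, div_pow, div_eq_mul_one_div (_ ^ 2)]
  refine mul_le_mul_of_nonneg_left ?_ (sq_nonneg _)
  rw [sq, show 1 / ((1 - ‖z‖ ^ 2) * (1 - ‖z‖ ^ 2)) =
    (1 / (1 - ‖z‖ ^ 2)) * (1 / (1 - ‖z‖ ^ 2)) by field_simp]
  exact mul_le_mul (h.chainFactor_le hα hz hm) (h'.chainFactor_le hα hz hm)
    (chainFactor_nonneg hα _ _ _) (by positivity)

/-! ### The finite Schur iterates and their limit -/

/-- The Schur iterate with parameters `α_n, …, α_{n+j-1}, 0`. -/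
def schurIter (α : ℕ → ℝ) : ℕ → ℕ → ℂ → ℂ
  | 0, _, _ => 0
  | j + 1, n, z =>
    (α n + z * schurIter α j (n + 1) z) / (1 + α n * z * schurIter α j (n + 1) z)

theorem norm_schurStep_le {t : ℝ} (ht : |t| < 1) {z w : ℂ} (hz : z ∈ disk) (hw : ‖w‖ ≤ 1) :
    ‖(t + z * w) / (1 + t * z * w)‖ ≤ 1 := by
  have hne := one_add_ne_zero_of_norm_lt_one (norm_ofReal_mul_mul_lt_one ht hz hw)
  have h := norm_sq_schurStep (t := t) (w := z * w) (g := (t + z * w) / (1 + t * z * w))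
    (by rwa [← mul_assoc]) (by rw [← mul_assoc]; exact div_mul_cancel₀ _ hne)
  have h1 : 0 ≤ 1 - t ^ 2 := by
    have := (sq_lt_one_iff_abs_lt_one t).mpr ht
    linarith
  have h2 : ‖z * w‖ ≤ 1 := by
    rw [norm_mul]
    exact mul_le_one₀ (mem_disk_iff.mp hz).le (norm_nonneg _) hw
  have h3 : 0 ≤ 1 - ‖z * w‖ ^ 2 := by nlinarith [norm_nonneg (z * w)]
  have h4 : 0 ≤ 1 - ‖(t + z * w) / (1 + t * z * w)‖ ^ 2 := by rw [h]; positivity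
  nlinarith [norm_nonneg ((t + z * w) / (1 + t * z * w))]

theorem norm_schurIter_le {α : ℕ → ℝ} {z : ℂ} (hz : z ∈ disk) (j : ℕ) {n : ℕ}
    (hα : ∀ k, n ≤ k → |α k| < 1) : ‖schurIter α j n z‖ ≤ 1 := by
  induction j generalizing n with
  | zero => simp [schurIter]
  | succ j ih =>
    rw [schurIter]
    exact norm_schurStep_le (hα n le_rfl) hz (ih fun k hk => hα k (by omega))

theorem isSchurChain_schurIter {α : ℕ → ℝ} {N : ℕ} (hα : ∀ n, N ≤ n → |α n| < 1) {z : ℂ}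
    (hz : z ∈ disk) (m : ℕ) : IsSchurChain α z N m fun k => schurIter α (m - k) k z where
  norm_le k h1 _ := norm_schurIter_le hz _ fun n hn => hα n (h1.trans hn)
  recursion k h1 h2 := by
    have h3 : m - k = m - (k + 1) + 1 := by omega
    rw [h3, schurIter]
    exact div_mul_cancel₀ _ (one_add_ne_zero_of_norm_lt_one (norm_ofReal_mul_mul_lt_one (hα k h1) hz
      (norm_schurIter_le hz _ fun n hn => hα n (by omega))))

theorem differentiableOn_schurIter {α : ℕ → ℝ} (j : ℕ) {n : ℕ}
    (hα : ∀ k, n ≤ k → |α k| < 1) : DifferentiableOn ℂ (schurIter α j n) disk := by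
  induction j generalizing n with
  | zero => exact differentiableOn_const 0
  | succ j ih =>
    have h := ih (n := n + 1) fun k hk => hα k (by omega)
    have e : schurIter α (j + 1) n = fun z => (α n + z * schurIter α j (n + 1) z) /
        (1 + α n * z * schurIter α j (n + 1) z) := by
      funext z; rw [schurIter]
    rw [e]
    refine DifferentiableOn.div (by fun_prop) (by fun_prop) fun z hz => ?_
    exact one_add_ne_zero_of_norm_lt_one (norm_ofReal_mul_mul_lt_one (hα n le_rfl) hz
      (norm_schurIter_le hz _ fun k hk => hα k (by omega)))

/-- The truncated chain ends in `0` at index `n + j`, so there the two chains differ by `g (n + j)`,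
of modulus at most one. This gives existence, analyticity and uniqueness of the Schur functions at
once. -/
theorem IsSchurChain.norm_schurIter_sub_le {α : ℕ → ℝ} {z : ℂ} {n j : ℕ} {g : ℕ → ℂ}
    (h : IsSchurChain α z n (n + j) g) (hα : ∀ k, n ≤ k → |α k| < 1) (hz : z ∈ disk) :
    ‖schurIter α j n z - g n‖ ≤ ‖z‖ ^ j / (1 - ‖z‖ ^ 2) := by
  have h1 := (isSchurChain_schurIter hα hz (n + j)).norm_sub_le h hα hz (Nat.le_add_right n j)
  simp only [Nat.sub_self, Nat.add_sub_cancel_left, schurIter, zero_sub, norm_neg] at h1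
  refine h1.trans (mul_le_of_le_one_right ?_ (h.norm_le _ (Nat.le_add_right n j) le_rfl))
  have := one_sub_norm_sq_pos hz
  positivity

theorem tendsto_pow_div_disk {z : ℂ} (hz : z ∈ disk) :
    Filter.Tendsto (fun j : ℕ => ‖z‖ ^ j / (1 - ‖z‖ ^ 2)) Filter.atTop (𝓝 0) := by
  simpa using (tendsto_pow_atTop_nhds_zero_of_lt_one (norm_nonneg z)
    (mem_disk_iff.mp hz)).div_const (1 - ‖z‖ ^ 2)

/-- The Schur function with parameters `α_n, α_{n+1}, …`. -/
def schurFun (α : ℕ → ℝ) (n : ℕ) (z : ℂ) : ℂ :=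
  Filter.limUnder Filter.atTop fun j => schurIter α j n z

theorem tendsto_schurIter {α : ℕ → ℝ} {n : ℕ} (hα : ∀ k, n ≤ k → |α k| < 1) {z : ℂ}
    (hz : z ∈ disk) :
    Filter.Tendsto (fun j => schurIter α j n z) Filter.atTop (𝓝 (schurFun α n z)) := by
  refine CauchySeq.tendsto_limUnder ?_
  refine cauchySeq_of_le_tendsto_0' _ (fun j j' hj => ?_) (tendsto_pow_div_disk hz)
  rw [dist_eq_norm]
  have := ((isSchurChain_schurIter hα hz (n + j')).mono
    (Nat.add_le_add_left hj n)).norm_schurIter_sub_le hα hz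
  simpa using this

theorem isSchurChain_schurFun {α : ℕ → ℝ} {n : ℕ} (hα : ∀ k, n ≤ k → |α k| < 1) {z : ℂ}
    (hz : z ∈ disk) (m : ℕ) : IsSchurChain α z n m fun k => schurFun α k z where
  norm_le k h1 _ := by
    have hk : ∀ l, k ≤ l → |α l| < 1 := fun l hl => hα l (h1.trans hl)
    exact le_of_tendsto (tendsto_schurIter hk hz).norm
      (Filter.Eventually.of_forall fun j => norm_schurIter_le hz j hk)
  recursion k h1 _ := by
    have hk : ∀ l, k ≤ l → |α l| < 1 := fun l hl => hα l (h1.trans hl)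
    have hk' : ∀ l, k + 1 ≤ l → |α l| < 1 := fun l hl => hk l (by omega)
    have t1 := (tendsto_schurIter hk hz).comp (Filter.tendsto_add_atTop_nat 1)
    have t2 := tendsto_schurIter hk' hz
    refine tendsto_nhds_unique (t1.mul ((t2.const_mul (α k * z : ℂ)).const_add 1))
      (((t2.const_mul z).const_add (α k : ℂ)).congr fun j => ?_)
    simp only [Function.comp]
    rw [schurIter]
    exact (div_mul_cancel₀ _ (one_add_ne_zero_of_norm_lt_one
      (norm_ofReal_mul_mul_lt_one (hα k h1) hz (norm_schurIter_le hz _ hk')))).symm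

theorem tendstoLocallyUniformlyOn_of_norm_sub_le {F : ℕ → ℂ → ℂ} {f : ℂ → ℂ}
    (h : ∀ j, ∀ z ∈ disk, ‖F j z - f z‖ ≤ ‖z‖ ^ j / (1 - ‖z‖ ^ 2)) :
    TendstoLocallyUniformlyOn F f Filter.atTop disk := by
  rw [Metric.tendstoLocallyUniformlyOn_iff]
  intro ε hε x hx
  obtain ⟨r, hr1, hr2⟩ := exists_between (mem_disk_iff.mp hx)
  have hr0 : 0 ≤ r := (norm_nonneg x).trans hr1.le
  have hrd : (r : ℂ) ∈ disk := by
    rw [mem_disk_iff, Complex.norm_real, Real.norm_of_nonneg hr0]; exact hr2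
  have hlim := tendsto_pow_div_disk hrd
  rw [Complex.norm_real, Real.norm_of_nonneg hr0] at hlim
  refine ⟨Metric.ball 0 r, mem_nhdsWithin_of_mem_nhds
    (Metric.isOpen_ball.mem_nhds (mem_ball_zero_iff.mpr hr1)), ?_⟩
  filter_upwards [hlim.eventually (gt_mem_nhds hε)] with j hj y hy
  rw [mem_ball_zero_iff] at hy
  have hyd : y ∈ disk := mem_disk_iff.mpr (hy.trans hr2)
  rw [dist_comm, dist_eq_norm]
  refine ((h j y hyd).trans ?_).trans_lt hj
  have : 0 < 1 - r ^ 2 := by nlinarith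
  gcongr

theorem isSchurFunction_schurFun {α : ℕ → ℝ} {n : ℕ} (hα : ∀ k, n ≤ k → |α k| < 1) :
    IsSchurFunction (schurFun α n) := by
  refine ⟨?_, fun z hz => (isSchurChain_schurFun hα hz n).norm_le n le_rfl le_rfl⟩
  refine (tendstoLocallyUniformlyOn_of_norm_sub_le fun j z hz =>
    (isSchurChain_schurFun hα hz (n + j)).norm_schurIter_sub_le hα hz).differentiableOn
    (Filter.Eventually.of_forall fun j => differentiableOn_schurIter j hα) Metric.isOpen_ball

/-! ### Existence of the sequence `f_n` -/

/-- The continuation of the sequence of Schur functions to the `j`-th function below `f_N`. -/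
def schurBelow (α : ℕ → ℝ) (N : ℕ) : ℕ → ℂ → ℂ
  | 0 => schurFun α N
  | j + 1 => toMeromorphicNFOn (fun z =>
      (α (N - (j + 1)) + z * schurBelow α N j z) /
        (1 + α (N - (j + 1)) * z * schurBelow α N j z)) disk

theorem eventuallyEq_nhdsNE_of_codiscreteWithin {f g : ℂ → ℂ}
    (h : f =ᶠ[Filter.codiscreteWithin disk] g) {z : ℂ} (hz : z ∈ disk) : f =ᶠ[𝓝[≠] z] g := by
  have h1 := mem_codiscreteWithin.mp h z hz
  rw [Filter.disjoint_principal_right] at h1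
  filter_upwards [h1, mem_nhdsWithin_of_mem_nhds (Metric.isOpen_ball.mem_nhds hz)] with w hw hd
  by_contra hne
  exact hw ⟨hd, hne⟩

theorem IsSchurFunction.analyticOnNhd {g : ℂ → ℂ} (h : IsSchurFunction g) :
    AnalyticOnNhd ℂ g disk :=
  h.1.analyticOnNhd Metric.isOpen_ball

theorem exists_isSchurSequence {α : ℕ → ℝ} {N : ℕ} (hα : ∀ n, N ≤ n → |α n| < 1) :
    ∃ f, IsSchurSequence (cx α) N f := by
  have hs : ∀ n, N ≤ n → IsSchurFunction (schurFun α n) := fun n hn =>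
    isSchurFunction_schurFun fun k hk => hα k (hn.trans hk)
  have hb : ∀ j, MeromorphicNFOn (schurBelow α N j) disk := by
    intro j
    cases j with
    | zero => exact (hs N le_rfl).analyticOnNhd.meromorphicNFOn
    | succ j => exact meromorphicNFOn_toMeromorphicNFOn _ _
  refine ⟨fun n => if N ≤ n then schurFun α n else schurBelow α N (N - n), ?_, ?_, ?_⟩
  · intro n hn
    simpa [hn] using hs n hn
  · intro n
    by_cases hn : N ≤ n
    · simpa [hn] using (hs n hn).analyticOnNhd.meromorphicNFOn
    · simpa [hn] using hb _
  · intro n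
    by_cases hn : N ≤ n
    · have hn' : N ≤ n + 1 := hn.trans n.le_succ
      simp only [hn, hn', if_true]
      filter_upwards [Filter.self_mem_codiscreteWithin disk] with z hz
      have h := isSchurChain_schurFun (fun k hk => hα k (hn.trans hk)) hz (n + 1)
      rw [Complex.conj_ofReal]
      exact eq_div_of_mul_eq (h.denom_ne_zero (fun k hk => hα k (hn.trans hk)) hz le_rfl
        n.lt_succ_self) (h.recursion n le_rfl n.lt_succ_self)
    · have h1 : (if N ≤ n + 1 then schurFun α (n + 1) else schurBelow α N (N - (n + 1))) =
          schurBelow α N (N - (n + 1)) := by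
        -- The two branches overlap only at `n + 1 = N`, where `schurBelow α N 0` is `schurFun α N`.
        split_ifs with h
        · have : N = n + 1 := by omega
          subst this
          simp [schurBelow]
        · rfl
      simp only [hn, if_false, h1]
      have h2 : N - n = N - (n + 1) + 1 := by omega
      have h3 : N - (N - (n + 1) + 1) = n := by omega
      rw [h2, schurBelow, h3]
      simp only [Complex.conj_ofReal]
      refine (toMeromorphicNFOn_eqOn_codiscrete ?_).symm
      have hm := (hb (N - (n + 1))).meromorphicOn
      intro z hz
      have := hm z hz
      fun_prop

/-! ### `f_0` and `F` as quotients of analytic functions -/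

/-- The recursion is given only off a discrete set. From index `N` on, the denominator has no zeros
in the disk, so both sides are continuous and the recursion holds at every point. -/
theorem IsSchurSequence.isSchurChain {α : ℕ → ℝ} {N : ℕ} {f : ℕ → ℂ → ℂ}
    (hf : IsSchurSequence (cx α) N f) (hα : ∀ n, N ≤ n → |α n| < 1) {z : ℂ} (hz : z ∈ disk)
    (m : ℕ) : IsSchurChain α z N m fun k => f k z where
  norm_le k h1 _ := (hf.schur k h1).2 z hz
  recursion k h1 _ := by
    have h2 : N ≤ k + 1 := h1.trans k.le_succ
    have c1 := ((hf.schur k h1).analyticOnNhd z hz).continuousAt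
    have c2 := ((hf.schur (k + 1) h2).analyticOnNhd z hz).continuousAt
    have hne := one_add_ne_zero_of_norm_lt_one
      (norm_ofReal_mul_mul_lt_one (hα k h1) hz ((hf.schur (k + 1) h2).2 z hz))
    have h3 := eventuallyEq_nhdsNE_of_codiscreteWithin (hf.recursion k) hz
    simp only [Complex.conj_ofReal] at h3
    have c3 : ContinuousAt (fun z => ((α k : ℂ) + z * f (k + 1) z) /
        (1 + (α k : ℂ) * z * f (k + 1) z)) z :=
      ContinuousAt.div (by fun_prop) (by fun_prop) hne
    have := tendsto_nhds_unique ((c3.tendsto.mono_left nhdsWithin_le_nhds).congr' h3.symm)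
      (c1.tendsto.mono_left nhdsWithin_le_nhds)
    rw [← this, div_mul_cancel₀ _ hne]

/-- The denominator `Φ_M^* - z f_M Φ_M` in the representation of `F` through `f_M`. -/
def denomF (α : ℕ → ℝ) (g : ℂ → ℂ) (M : ℕ) (z : ℂ) : ℂ :=
  (PhiStar (cx α) M).eval z - z * g z * (Phi (cx α) M).eval z

/-- The numerator `Ψ_M^* + z f_M Ψ_M` in the representation of `F` through `f_M`. -/
def numerF (α : ℕ → ℝ) (g : ℂ → ℂ) (M : ℕ) (z : ℂ) : ℂ :=
  (PhiStar (cx (-α)) M).eval z + z * g z * (Phi (cx (-α)) M).eval z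

theorem denomF_zero (α : ℕ → ℝ) (g : ℂ → ℂ) (M : ℕ) : denomF α g M 0 = 1 := by
  simp [denomF, eval_zero_PhiStar]

theorem numerF_zero (α : ℕ → ℝ) (g : ℂ → ℂ) (M : ℕ) : numerF α g M 0 = 1 := by
  simp [numerF, eval_zero_PhiStar]

theorem analyticAt_polynomial_eval (p : ℂ[X]) (z : ℂ) : AnalyticAt ℂ (fun z => p.eval z) z :=
  AnalyticOnNhd.eval_polynomial p z (Set.mem_univ z)

theorem analyticAt_denomF (α : ℕ → ℝ) {g : ℂ → ℂ} (M : ℕ) {z : ℂ} (hg : AnalyticAt ℂ g z) :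
    AnalyticAt ℂ (denomF α g M) z :=
  (analyticAt_polynomial_eval _ z).sub
    ((analyticAt_id.mul hg).mul (analyticAt_polynomial_eval _ z))

theorem analyticAt_numerF (α : ℕ → ℝ) {g : ℂ → ℂ} (M : ℕ) {z : ℂ} (hg : AnalyticAt ℂ g z) :
    AnalyticAt ℂ (numerF α g M) z :=
  (analyticAt_polynomial_eval _ z).add
    ((analyticAt_id.mul hg).mul (analyticAt_polynomial_eval _ z))

theorem eventually_ne_zero_nhdsNE_of_analyticOnNhd {B : ℂ → ℂ} (hB : AnalyticOnNhd ℂ B disk)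
    (h0 : B 0 ≠ 0) {z : ℂ} (hz : z ∈ disk) : ∀ᶠ w in 𝓝[≠] z, B w ≠ 0 := by
  rcases (hB z hz).eventually_eq_zero_or_eventually_ne_zero with h | h
  · exact absurd (hB.eqOn_zero_of_preconnected_of_eventuallyEq_zero
      (convex_ball (0 : ℂ) 1).isPreconnected hz h zero_mem_disk) h0
  · exact h

/-- Descending induction on the index `k = M - j`. A backward Schur step sends `(A, B)` to `(α B + z
A, B + α z A)`; by the Szegő recurrence this leaves `Φ_k^* B - z A Φ_k` and its second kind
counterpart unchanged. The condition `B 0 = 1` keeps the quotient meaningful. -/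
theorem IsSchurSequence.exists_quotient {α : ℕ → ℝ} {N : ℕ} {f : ℕ → ℂ → ℂ}
    (hf : IsSchurSequence (cx α) N f) {M : ℕ} (hM : N ≤ M) (j : ℕ) (hj : j ≤ M) :
    ∃ A B : ℂ → ℂ, AnalyticOnNhd ℂ A disk ∧ AnalyticOnNhd ℂ B disk ∧ B 0 = 1 ∧
      (∀ z ∈ disk, f (M - j) =ᶠ[𝓝[≠] z] fun w => A w / B w) ∧
      (∀ z, (PhiStar (cx α) (M - j)).eval z * B z - z * A z * (Phi (cx α) (M - j)).eval z =
        denomF α (f M) M z) ∧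
      (∀ z, (PhiStar (cx (-α)) (M - j)).eval z * B z +
        z * A z * (Phi (cx (-α)) (M - j)).eval z = numerF α (f M) M z) := by
  induction j with
  | zero =>
    refine ⟨f M, fun _ => 1, (hf.schur M hM).analyticOnNhd, analyticOnNhd_const, rfl, ?_, ?_, ?_⟩
    · intro z _; simp
    · intro z; simp [denomF]
    · intro z; simp [numerF]
  | succ j ih =>
    obtain ⟨A, B, hA, hB, hB0, hq, hd, hn⟩ := ih (by omega)
    obtain ⟨k, hk⟩ : ∃ k, M - j = k + 1 := ⟨M - j - 1, by omega⟩
    have hk' : M - (j + 1) = k := by omega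
    rw [hk] at hq hd hn
    rw [hk']
    have hB' : AnalyticOnNhd ℂ (fun z => B z + α k * (z * A z)) disk := fun z hz =>
      (hB z hz).add (analyticAt_const.mul (analyticAt_id.mul (hA z hz)))
    refine ⟨fun z => α k * B z + z * A z, fun z => B z + α k * (z * A z), ?_, hB', ?_, ?_, ?_, ?_⟩
    · exact fun z hz => (analyticAt_const.mul (hB z hz)).add (analyticAt_id.mul (hA z hz))
    · simp [hB0]
    · intro z hz
      filter_upwards [hq z hz, eventuallyEq_nhdsNE_of_codiscreteWithin (hf.recursion k) hz,
        eventually_ne_zero_nhdsNE_of_analyticOnNhd hB (by simp [hB0]) hz] with w h1 h2 h3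
      rw [h2, h1, Complex.conj_ofReal,
        show (α k : ℂ) + w * (A w / B w) = (α k * B w + w * A w) / B w by field_simp,
        show 1 + (α k : ℂ) * w * (A w / B w) = (B w + α k * (w * A w)) / B w by field_simp,
        div_div_div_cancel_right₀ h3]
    · intro z
      have h := isSzegoSolution_eval_Phi α z
      rw [← hd z, h.fst, h.snd]
      ring
    · intro z
      have h := isSzegoSolution_eval_Phi_neg α z
      have h1 := h.fst k
      have h2 := h.snd k
      rw [← hn z, h1, neg_eq_iff_eq_neg.mp h2]
      ring

/-- At index zero all polynomials are `1`, so the invariants read `B - z A` and `B + z A`, whose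
quotient is `F`. Equality on a punctured neighborhood extends to the center because both sides are
in meromorphic normal form. -/
theorem IsSchurSequence.bigF_eventuallyEq {α : ℕ → ℝ} {N : ℕ} {f : ℕ → ℂ → ℂ}
    (hf : IsSchurSequence (cx α) N f) {M : ℕ} (hM : N ≤ M) {z : ℂ} (hz : z ∈ disk)
    (hd : denomF α (f M) M z ≠ 0) :
    bigF (f 0) =ᶠ[𝓝 z] fun w => numerF α (f M) M w / denomF α (f M) M w := by
  obtain ⟨A, B, hA, hB, hB0, hq, hD, hN⟩ := hf.exists_quotient hM M le_rfl
  simp only [Nat.sub_self, Phi, PhiStar_zero, Polynomial.eval_one, one_mul, mul_one] at hq hD hN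
  have hg := (hf.schur M hM).analyticOnNhd z hz
  have hana : AnalyticAt ℂ (fun w => numerF α (f M) M w / denomF α (f M) M w) z :=
    (analyticAt_numerF α M hg).div (analyticAt_denomF α M hg) hd
  have hmer : MeromorphicOn (fun z => (1 + z * f 0 z) / (1 - z * f 0 z)) disk := by
    intro w hw
    have := (hf.meromorphic 0).meromorphicOn w hw
    fun_prop
  refine ((meromorphicNFOn_toMeromorphicNFOn _ disk
    hz).eventuallyEq_nhdsNE_iff_eventuallyEq_nhds hana.meromorphicNFAt).mp ?_
  refine Filter.EventuallyEq.trans (hmer.toMeromorphicNFOn_eq_self_on_nhdsNE hz) ?_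
  filter_upwards [hq z hz, eventually_ne_zero_nhdsNE_of_analyticOnNhd hB (by simp [hB0]) hz]
    with w h1 h2
  rw [h1, ← hD, ← hN, show 1 + w * (A w / B w) = (B w + w * A w) / B w by field_simp,
    show 1 - w * (A w / B w) = (B w - w * A w) / B w by field_simp,
    div_div_div_cancel_right₀ h2]

/-! ### The Taylor coefficients of `F` are given by the moments -/

theorem coeff_eq_zero_of_isBigO (m : ℕ) (p : ℂ[X])
    (h : (fun z => p.eval z) =O[𝓝[≠] 0] fun z : ℂ => z ^ m) : ∀ j < m, p.coeff j = 0 := by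
  induction m generalizing p with
  | zero => intro j hj; omega
  | succ m ih =>
    have h0 : p.coeff 0 = 0 := by
      rw [Polynomial.coeff_zero_eq_eval_zero]
      have t1 : Filter.Tendsto (fun z : ℂ => p.eval z) (𝓝[≠] 0) (𝓝 (p.eval 0)) :=
        p.continuous.continuousAt.tendsto.mono_left nhdsWithin_le_nhds
      have t2 : Filter.Tendsto (fun z : ℂ => z ^ (m + 1)) (𝓝[≠] 0) (𝓝 0) := by
        have : ContinuousAt (fun z : ℂ => z ^ (m + 1)) 0 := by fun_prop
        simpa using this.tendsto.mono_left (nhdsWithin_le_nhds (s := {0}ᶜ))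
      exact tendsto_nhds_unique t1 (h.trans_tendsto t2)
    have hp : p = Polynomial.X * p.divX := by
      conv_lhs => rw [← Polynomial.divX_mul_X_add p, h0]
      simp [mul_comm]
    have h1 : (fun z => p.divX.eval z) =O[𝓝[≠] 0] fun z : ℂ => z ^ m := by
      obtain ⟨C, hC⟩ := h.bound
      refine Asymptotics.IsBigO.of_bound C ?_
      filter_upwards [hC, self_mem_nhdsWithin] with z hz hz0
      have hz0 : 0 < ‖z‖ := norm_pos_iff.mpr hz0
      rw [hp, Polynomial.eval_mul, Polynomial.eval_X, norm_mul, norm_pow, pow_succ] at hz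
      rw [norm_pow]
      refine le_of_mul_le_mul_left ?_ hz0
      linarith
    intro j hj
    rcases j with _ | j
    · exact h0
    · rw [hp, Polynomial.coeff_X_mul]
      exact ih _ h1 j (by omega)

/-- For fixed `n` the two expressions form one solution of the recurrence, the combination of `(Φ,
Φ^*)` and `(Ψ, -Ψ^*)` with weights `Ψ_n^*` and `Φ_n^*`. At `k = 0` it is `(2 z ^ n ∏ (1 - α_k ^ 2),
0)`, and a step preserves divisibility by `(X ^ n, X ^ (n + 1))`. -/
theorem X_pow_dvd_szegoSolution (α : ℕ → ℝ) (n k : ℕ) :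
    Polynomial.X ^ n ∣ Phi (cx (-α)) (n + k) * PhiStar (cx α) n +
        Phi (cx α) (n + k) * PhiStar (cx (-α)) n ∧
      Polynomial.X ^ (n + 1) ∣ PhiStar (cx α) (n + k) * PhiStar (cx (-α)) n -
        PhiStar (cx (-α)) (n + k) * PhiStar (cx α) n := by
  induction k with
  | zero =>
    refine ⟨⟨2 * Polynomial.C (∏ k ∈ Finset.range n, (1 - cx α k ^ 2)), ?_⟩, ?_⟩
    · rw [add_zero]
      linear_combination Phi_mul_PhiStar_neg_add α n
    · rw [add_zero, mul_comm, sub_self]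
      exact dvd_zero _
  | succ k ih =>
    obtain ⟨⟨u, hu⟩, ⟨v, hv⟩⟩ := ih
    have h := isSzegoSolution_Phi α
    have h' := isSzegoSolution_Phi_neg α
    have h1 := h'.fst (n + k)
    have h2 := neg_eq_iff_eq_neg.mp (h'.snd (n + k))
    rw [← add_assoc, h.fst, h.snd, h1, h2]
    refine ⟨⟨Polynomial.X * u - Polynomial.C (cx α (n + k)) * (Polynomial.X * v), ?_⟩,
      ⟨v - Polynomial.C (cx α (n + k)) * u, ?_⟩⟩
    · linear_combination Polynomial.X * hu - Polynomial.C (cx α (n + k)) * hv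
    · linear_combination hv - Polynomial.C (cx α (n + k)) * Polynomial.X * hu

theorem moment_succ (a : ℕ → ℂ) (n : ℕ) :
    moment a (n + 1) = -∑ j ∈ Finset.range (n + 1), (Phi a (n + 1)).coeff j * moment a j := by
  rw [moment, Finset.sum_range]

theorem moment_zero (a : ℕ → ℂ) : moment a 0 = 1 := by rw [moment]

theorem sum_coeff_Phi_mul_moment (a : ℕ → ℂ) (n : ℕ) :
    ∑ j ∈ Finset.range (n + 2), (Phi a (n + 1)).coeff j * moment a j = 0 := by
  rw [Finset.sum_range_succ, coeff_Phi_self, moment_succ]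
  ring

theorem eq_moment_of_sum_eq_zero (a : ℕ → ℂ) (t : ℕ → ℂ) (h0 : t 0 = 1)
    (h : ∀ n, ∑ j ∈ Finset.range (n + 2), (Phi a (n + 1)).coeff j * t j = 0) (n : ℕ) :
    t n = moment a n := by
  induction n using Nat.strong_induction_on with
  | _ n ih =>
    rcases n with _ | n
    · rw [h0, moment_zero]
    · have h1 := h n
      rw [Finset.sum_range_succ, coeff_Phi_self, one_mul] at h1
      rw [moment_succ, eq_neg_iff_add_eq_zero, add_comm, ← h1]
      congr 1
      exact Finset.sum_congr rfl fun j hj => by rw [ih j (Finset.mem_range.mp hj)]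

theorem conj_moment (α : ℕ → ℝ) (n : ℕ) : conj (moment (cx α) n) = moment (cx α) n := by
  refine eq_moment_of_sum_eq_zero (cx α) (fun n => conj (moment (cx α) n)) (by simp [moment_zero])
    (fun n => ?_) n
  rw [← map_zero (starRingEnd ℂ), ← sum_coeff_Phi_mul_moment (cx α) n, map_sum]
  simp [conj_coeff_Phi]

theorem intMoment_natCast (a : ℕ → ℂ) (n : ℕ) : intMoment a n = moment a n := by
  simp [intMoment]

theorem intMoment_neg (α : ℕ → ℝ) (k : ℤ) : intMoment (cx α) (-k) = intMoment (cx α) k := by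
  rcases lt_trichotomy k 0 with h | rfl | h
  · simp [intMoment, h.le, not_le.mpr h, conj_moment]
  · simp
  · simp [intMoment, h.le, h, conj_moment]

theorem intMoment_eq (α : ℕ → ℝ) (k : ℤ) : intMoment (cx α) k = moment (cx α) k.natAbs := by
  rcases le_total 0 k with h | h
  · lift k to ℕ using h
    simp [intMoment_natCast]
  · rw [← intMoment_neg]
    obtain ⟨n, hn⟩ := Int.eq_ofNat_of_zero_le (neg_nonneg.mpr h)
    rw [hn, intMoment_natCast]
    congr 1
    omega

theorem IsSchurSequence.isBigO_bigF {α : ℕ → ℝ} {N : ℕ} {f : ℕ → ℂ → ℂ}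
    (hf : IsSchurSequence (cx α) N f) (n : ℕ) :
    (fun z => bigF (f 0) z * (PhiStar (cx α) n).eval z - (PhiStar (cx (-α)) n).eval z)
      =O[𝓝 0] fun z : ℂ => z ^ (n + 1) := by
  -- The index must be at least `N` for `f_M` to be a Schur function and at least `n` for the
  -- divisibility lemma.
  set M := n + N with hM
  have hNM : N ≤ M := by omega
  obtain ⟨⟨u, hu⟩, ⟨v, hv⟩⟩ := X_pow_dvd_szegoSolution α n N
  rw [← hM] at hu hv
  have hg := (hf.schur M hNM).analyticOnNhd 0 zero_mem_disk
  have hd : denomF α (f M) M 0 ≠ 0 := by simp [denomF_zero]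
  have hdc := (analyticAt_denomF α M hg).continuousAt
  have hgc := hg.continuousAt
  have hb : ContinuousAt (fun z => (f M z * u.eval z - v.eval z) / denomF α (f M) M z) 0 :=
    ContinuousAt.div (by fun_prop) hdc hd
  have key : (fun z => bigF (f 0) z * (PhiStar (cx α) n).eval z - (PhiStar (cx (-α)) n).eval z)
      =ᶠ[𝓝 0] fun z => z ^ (n + 1) * ((f M z * u.eval z - v.eval z) / denomF α (f M) M z) := by
    filter_upwards [hf.bigF_eventuallyEq hNM zero_mem_disk hd, hdc.eventually_ne hd] with z h1 h2
    rw [h1]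
    field_simp
    have hu' := congrArg (Polynomial.eval z) hu
    have hv' := congrArg (Polynomial.eval z) hv
    simp only [Polynomial.eval_add, Polynomial.eval_sub, Polynomial.eval_mul, Polynomial.eval_pow,
      Polynomial.eval_X] at hu' hv'
    rw [numerF, denomF]
    linear_combination z * f M z * hu' - hv'
  refine key.trans_isBigO ?_
  simpa using (Asymptotics.isBigO_refl (fun z : ℂ => z ^ (n + 1)) (𝓝 0)).mul
    (hb.isBigO_one ℂ)

theorem IsSchurSequence.bigF_zero {α : ℕ → ℝ} {N : ℕ} {f : ℕ → ℂ → ℂ}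
    (hf : IsSchurSequence (cx α) N f) : bigF (f 0) 0 = 1 := by
  rw [(hf.bigF_eventuallyEq le_rfl zero_mem_disk (by simp [denomF_zero])).eq_of_nhds, denomF_zero,
    numerF_zero, div_one]

theorem IsSchurSequence.analyticAt_bigF {α : ℕ → ℝ} {N : ℕ} {f : ℕ → ℂ → ℂ}
    (hf : IsSchurSequence (cx α) N f) {z : ℂ} (hz : z ∈ disk) (hd : denomF α (f N) N z ≠ 0) :
    AnalyticAt ℂ (bigF (f 0)) z := by
  have hg := (hf.schur N le_rfl).analyticOnNhd z hz
  exact ((analyticAt_numerF α N hg).div (analyticAt_denomF α N hg) hd).congr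
    (hf.bigF_eventuallyEq le_rfl hz hd).symm

/-- The coefficients of `(1 + q) / (1 - q)`. -/
def caraCoeff (n : ℕ) : ℂ := if n = 0 then 1 else 2

/-- `F(z) = 1 + 2 ∑_{n ≥ 1} ⟨w ^ n, μ⟩ z ^ n` near the origin. -/
theorem IsSchurSequence.eventually_hasSum_bigF {α : ℕ → ℝ} {N : ℕ} {f : ℕ → ℂ → ℂ}
    (hf : IsSchurSequence (cx α) N f) :
    ∀ᶠ z in 𝓝 (0 : ℂ), HasSum (fun n => caraCoeff n * moment (cx α) n * z ^ n)
      (bigF (f 0) z) := by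
  obtain ⟨p, hp⟩ := hf.analyticAt_bigF zero_mem_disk (by simp [denomF_zero])
  have happ : ∀ (n : ℕ) (z : ℂ), (p n fun _ => z) = p.coeff n * z ^ n := fun n z => by
    rw [FormalMultilinearSeries.apply_eq_pow_smul_coeff, smul_eq_mul, mul_comm]
  have hp0 : p.coeff 0 = 1 := by
    rw [FormalMultilinearSeries.coeff, hp.coeff_zero, hf.bigF_zero]
  have hcoef : ∀ n, p.coeff n / caraCoeff n = moment (cx α) n := by
    refine eq_moment_of_sum_eq_zero (cx α) _ (by simp [hp0, caraCoeff]) fun n => ?_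
    set T : ℂ[X] := ∑ k ∈ Finset.range (n + 2), Polynomial.C (p.coeff k) * Polynomial.X ^ k
      with hT
    have hTc : ∀ k < n + 2, T.coeff k = p.coeff k := by
      intro k hk
      simp [hT, Polynomial.finsetSum_coeff, Polynomial.coeff_X_pow, hk]
    have hO1 : (fun z => bigF (f 0) z - T.eval z) =O[𝓝 0] fun z : ℂ => z ^ (n + 2) := by
      have h1 := hp.isBigO_sub_partialSum_pow (n + 2)
      simp only [zero_add, FormalMultilinearSeries.partialSum, happ] at h1
      refine (Asymptotics.isBigO_norm_right.mp (by simpa using h1.norm_right)).congr_left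
        fun z => ?_
      simp [hT, Polynomial.eval_finsetSum]
    have hO2 : (fun z => (T * PhiStar (cx α) (n + 1) - PhiStar (cx (-α)) (n + 1)).eval z)
        =O[𝓝[≠] 0] fun z : ℂ => z ^ (n + 2) := by
      have hc : (fun z => (PhiStar (cx α) (n + 1)).eval z) =O[𝓝 0] fun _ : ℂ => (1 : ℂ) :=
        (PhiStar (cx α) (n + 1)).continuous.continuousAt.isBigO_one ℂ
      have h2 : (fun z => (bigF (f 0) z - T.eval z) * (PhiStar (cx α) (n + 1)).eval z)
        =O[𝓝 0] fun z : ℂ => z ^ (n + 2) := by simpa using hO1.mul hc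
      refine (((hf.isBigO_bigF (n + 1)).sub h2).congr_left fun z => ?_).mono nhdsWithin_le_nhds
      simp only [Polynomial.eval_sub, Polynomial.eval_mul]
      ring
    -- The coefficient of `z ^ (n + 1)` in `F Φ_{n+1}^* - Ψ_{n+1}^*` vanishes. Reversal turns the
    -- convolution into the pairing of `Φ_{n+1}` with the Taylor coefficients; `Ψ_{n+1}^*`
    -- contributes `-α_n`, as does the constant term of `Φ_{n+1}`. So the remaining terms sum to `2
    -- α_n`, and halving the Taylor coefficients of positive index gives the moment equation.
    have h3 := coeff_eq_zero_of_isBigO _ _ hO2 (n + 1) (by omega)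
    rw [Polynomial.coeff_sub, Polynomial.coeff_mul, coeff_PhiStar_succ_self,
      Finset.Nat.sum_antidiagonal_eq_sum_range_succ
        (fun i j => T.coeff i * (PhiStar (cx α) (n + 1)).coeff j)] at h3
    have h4 : ∑ k ∈ Finset.range (n + 2), T.coeff k * (PhiStar (cx α) (n + 1)).coeff (n + 1 - k) =
        ∑ k ∈ Finset.range (n + 2), (Phi (cx α) (n + 1)).coeff k * p.coeff k := by
      refine Finset.sum_congr rfl fun k hk => ?_
      have hk := Finset.mem_range.mp hk
      rw [hTc k hk, coeff_PhiStar_of_le' α (by omega), Nat.sub_sub_self (by omega), mul_comm]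
    have h5 : (Phi (cx α) (n + 1)).coeff 0 = -cx α n := by
      rw [← coeff_PhiStar_succ_self, coeff_PhiStar_of_le' α le_rfl, Nat.sub_self]
    rw [h4, Finset.sum_range_succ', h5, hp0, cx_neg] at h3
    rw [Finset.sum_range_succ', h5, hp0]
    have h6 : ∑ k ∈ Finset.range (n + 1), (Phi (cx α) (n + 1)).coeff (k + 1) *
        (p.coeff (k + 1) / caraCoeff (k + 1)) = (∑ k ∈ Finset.range (n + 1),
          (Phi (cx α) (n + 1)).coeff (k + 1) * p.coeff (k + 1)) / 2 := by
      rw [Finset.sum_div]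
      exact Finset.sum_congr rfl fun k _ => by simp [caraCoeff, mul_div_assoc]
    rw [h6, caraCoeff, if_pos rfl]
    linear_combination h3 / 2
  filter_upwards [hp.eventually_hasSum] with z hz
  rw [zero_add] at hz
  refine hz.congr_fun fun n => ?_
  have hne : caraCoeff n ≠ 0 := by unfold caraCoeff; split_ifs <;> norm_num
  rw [happ, ← hcoef, mul_div_cancel₀ _ hne]

/-! ### Pairings with the Carathéodory kernel and with the resolvent kernel -/

theorem hasSum_caraCoeff {q : ℂ} (hq : ‖q‖ < 1) :
    HasSum (fun n => caraCoeff n * q ^ n) ((1 + q) / (1 - q)) := by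
  have hne : 1 - q ≠ 0 := by
    rw [sub_eq_add_neg]
    exact one_add_ne_zero_of_norm_lt_one (by rwa [norm_neg])
  have h := ((hasSum_geometric_of_norm_lt_one hq).mul_left 2).sub (hasSum_ite_eq 0 (1 : ℂ))
  rw [show (1 + q) / (1 - q) = 2 * (1 - q)⁻¹ - 1 by field_simp; ring]
  refine h.congr_fun fun n => ?_
  unfold caraCoeff
  split_ifs with h0
  · subst h0; norm_num
  · ring

theorem hasPairing_caratheodory (α : ℕ → ℝ) {z s : ℂ} (hz : z ∈ disk)
    (h : HasSum (fun n => caraCoeff n * moment (cx α) n * z ^ n) s) :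
    HasPairing (mu (cx α)) (fun w => (w + z) / (w - z)) s := by
  have hinj : Function.Injective fun n : ℕ => -(n : ℤ) := fun a b hab => by
    simpa using hab
  have hout : ∀ k : ℤ, k ∉ Set.range (fun n : ℕ => -(n : ℤ)) → ¬ k ≤ 0 := fun k hk h0 =>
    hk ⟨k.natAbs, by simp only []; omega⟩
  -- Geometric expansion in `z / w`: only nonpositive powers of `w` occur.
  refine ⟨fun k => if k ≤ 0 then caraCoeff k.natAbs * z ^ k.natAbs else 0, fun w hw => ?_, ?_⟩
  · have hw0 : w ≠ 0 := fun h => by simp [h] at hw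
    rw [← hinj.hasSum_iff (fun k hk => by simp [hout k hk])]
    have hq : ‖z / w‖ < 1 := by rwa [norm_div, hw, div_one, ← mem_disk_iff]
    have := hasSum_caraCoeff hq
    rw [show (1 + z / w) / (1 - z / w) = (w + z) / (w - z) by
      rw [show 1 + z / w = (w + z) / w by field_simp, show 1 - z / w = (w - z) / w by field_simp,
        div_div_div_cancel_right₀ hw0]] at this
    refine this.congr_fun fun n => ?_
    simp [Function.comp, div_pow, zpow_neg]
    field_simp
  · rw [← hinj.hasSum_iff (fun k hk => by simp [hout k hk])]
    refine h.congr_fun fun n => ?_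
    simp [Function.comp, mu_T, intMoment_eq]
    ring

theorem hasGamPairing_resolvent (α : ℕ → ℝ) {ζ s : ℂ} (hζ : ζ ∈ disk) (hζ0 : ζ ≠ 0)
    (h : HasSum (fun n => caraCoeff n * moment (cx α) n * ζ ^ n) s) :
    HasGamPairing (cx α) (fun x => 1 / (x - (ζ + ζ⁻¹))) (s / (ζ - ζ⁻¹)) := by
  have hζ' := mem_disk_iff.mp hζ
  -- Poisson-type expansion: `∑_k ζ ^ |k| w ^ k = (1 - ζ ^ 2) / ((1 - ζ w) (1 - ζ / w))`, and the
  -- denominator is `-ζ (w + w⁻¹ - ζ - ζ⁻¹)`. Since the moments are even in `k`, pairing the sum on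
  -- the left with `μ` gives `s`.
  refine ⟨fun k => ζ ^ k.natAbs / (ζ - ζ⁻¹), fun w hw => ?_, ?_⟩
  · have hw0 : w ≠ 0 := fun h => by simp [h] at hw
    have hwc : conj w = w⁻¹ := by
      rw [Complex.inv_def, Complex.normSq_eq_norm_sq, hw]; simp
    have hq1 : ‖ζ * w‖ < 1 := by rwa [norm_mul, hw, mul_one]
    have hq2 : ‖ζ / w‖ < 1 := by rwa [norm_div, hw, div_one]
    have hne1 : 1 - ζ * w ≠ 0 := by
      rw [sub_eq_add_neg]; exact one_add_ne_zero_of_norm_lt_one (by rwa [norm_neg])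
    have hne2 : w - ζ ≠ 0 := sub_ne_zero.mpr fun h => by
      rw [← h, hw] at hζ'; exact lt_irrefl _ hζ'
    have hne3 : ζ ^ 2 - 1 ≠ 0 := fun h => by
      have h1 : ζ ^ 2 = 1 := by linear_combination h
      have h2 := congrArg norm h1
      rw [norm_pow, norm_one] at h2
      nlinarith [norm_nonneg ζ]
    have h1 := hasSum_geometric_of_norm_lt_one hq1
    have h2 := (hasSum_geometric_of_norm_lt_one hq2).mul_left (ζ / w)
    have h3 : HasSum (fun k : ℤ => ζ ^ k.natAbs * w ^ k)
        ((1 - ζ * w)⁻¹ + ζ / w * (1 - ζ / w)⁻¹) := by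
      refine HasSum.of_nat_of_neg_add_one ?_ ?_
      · refine h1.congr_fun fun n => ?_
        simp [mul_pow]
      · refine h2.congr_fun fun n => ?_
        rw [show (-((n : ℤ) + 1)).natAbs = n + 1 by omega,
          show (-((n : ℤ) + 1)) = -((n + 1 : ℕ) : ℤ) by push_cast; ring, zpow_neg, zpow_natCast,
          div_pow]
        field_simp
        ring
    have h4 := h3.div_const (ζ - ζ⁻¹)
    beta_reduce
    rw [hwc]
    have hx : w + w⁻¹ - (ζ + ζ⁻¹) = -((1 - ζ * w) * (w - ζ)) / (ζ * w) := by field_simp; ring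
    have hy : 1 - ζ / w = (w - ζ) / w := by field_simp
    have hz : ζ - ζ⁻¹ = (ζ ^ 2 - 1) / ζ := by field_simp
    have e : ((1 - ζ * w)⁻¹ + ζ / w * (1 - ζ / w)⁻¹) / (ζ - ζ⁻¹) =
        1 / (w + w⁻¹ - (ζ + ζ⁻¹)) := by
      rw [hx, hy, hz]
      field_simp
      ring
    rw [e] at h4
    exact h4.congr_fun fun k => by ring
  · have h0 : HasSum (fun n : ℕ => moment (cx α) (n + 1) * ζ ^ (n + 1)) ((s - 1) / 2) := by
      have h1 := ((hasSum_nat_add_iff' 1).mpr h).div_const 2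
      simp only [Finset.sum_range_one, moment_zero, caraCoeff, if_pos, pow_zero, mul_one] at h1
      refine h1.congr_fun fun n => ?_
      simp
      ring
    have h1 : HasSum (fun n : ℕ => moment (cx α) n * ζ ^ n) ((s - 1) / 2 + 1) := by
      rw [← hasSum_nat_add_iff' 1]
      simpa [moment_zero] using h0
    have h2 : HasSum (fun k : ℤ => moment (cx α) k.natAbs * ζ ^ k.natAbs)
        ((s - 1) / 2 + 1 + (s - 1) / 2) := by
      refine HasSum.of_nat_of_neg_add_one (by simpa using h1) ?_
      refine h0.congr_fun fun n => ?_
      rw [show (-((n : ℤ) + 1)).natAbs = n + 1 by omega]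
    have h3 := h2.div_const (ζ - ζ⁻¹)
    rw [show (s - 1) / 2 + 1 + (s - 1) / 2 = s by ring] at h3
    refine h3.congr_fun fun k => ?_
    rw [mu_T, intMoment_eq]
    ring

/-! ### Counting the zeros of polynomials in the unit disk -/

open Classical in
/-- The zeros of a polynomial in the open unit disk, with multiplicities. -/
def diskRoots (p : ℂ[X]) : Multiset ℂ := p.roots.filter fun l => ‖l‖ < 1

theorem eval_derivative_multiset_prod (s : Multiset ℂ) {z : ℂ} (hz : z ∉ s) :
    (s.map fun a => Polynomial.X - Polynomial.C a).prod.derivative.eval z =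
      (s.map fun a => Polynomial.X - Polynomial.C a).prod.eval z *
        (s.map fun a => (z - a)⁻¹).sum := by
  induction s using Multiset.induction_on with
  | empty => simp
  | cons a s ih =>
    rw [Multiset.mem_cons, not_or] at hz
    have h1 : z - a ≠ 0 := sub_ne_zero.mpr hz.1
    simp only [Multiset.map_cons, Multiset.prod_cons, Multiset.sum_cons, Polynomial.derivative_mul,
      Polynomial.eval_add, Polynomial.eval_mul, ih hz.2, Polynomial.derivative_sub,
      Polynomial.derivative_X, Polynomial.derivative_C, Polynomial.eval_sub, Polynomial.eval_X,
      Polynomial.eval_C, sub_zero, Polynomial.eval_one]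
    field_simp

theorem eq_leadingCoeff_mul_prod_roots (p : ℂ[X]) :
    p = Polynomial.C p.leadingCoeff * (p.roots.map fun a => Polynomial.X - Polynomial.C a).prod :=
  (Polynomial.Splits.eq_prod_roots (IsAlgClosed.splits p))

theorem eval_derivative_div_eval (p : ℂ[X]) {z : ℂ} (hz : p.eval z ≠ 0) :
    p.derivative.eval z / p.eval z = (p.roots.map fun a => (z - a)⁻¹).sum := by
  have hp : p ≠ 0 := fun h => by simp [h] at hz
  have hz' : z ∉ p.roots := fun h => hz ((Polynomial.mem_roots hp).mp h)
  rw [div_eq_iff hz]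
  conv_lhs => rw [eq_leadingCoeff_mul_prod_roots p]
  conv_rhs => rw [mul_comm]; enter [1]; rw [eq_leadingCoeff_mul_prod_roots p]
  rw [Polynomial.derivative_C_mul, Polynomial.eval_mul, Polynomial.eval_mul,
    eval_derivative_multiset_prod _ hz', mul_assoc]

open Classical in
theorem circleIntegral_sum_inv_sub (s : Multiset ℂ) (hs : ∀ a ∈ s, ‖a‖ ≠ 1) :
    CircleIntegrable (fun z => (s.map fun a => (z - a)⁻¹).sum) 0 1 ∧
      (∮ z in C(0, 1), (s.map fun a => (z - a)⁻¹).sum) =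
        2 * Real.pi * Complex.I * (s.filter fun l => ‖l‖ < 1).card := by
  induction s using Multiset.induction_on with
  | empty => simp [circleIntegral]
  | cons a s ih =>
    obtain ⟨h1, h2⟩ := ih fun b hb => hs b (Multiset.mem_cons_of_mem hb)
    have ha := hs a (Multiset.mem_cons_self a s)
    have hc : CircleIntegrable (fun z => (z - a)⁻¹) 0 1 := by
      have hne : ∀ z ∈ Metric.sphere (0 : ℂ) 1, z - a ≠ 0 := fun z hz h => by
        rw [mem_sphere_zero_iff_norm, sub_eq_zero.mp h] at hz
        exact ha hz
      exact ContinuousOn.circleIntegrable zero_le_one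
        (ContinuousOn.inv₀ (by fun_prop) hne)
    simp only [Multiset.map_cons, Multiset.sum_cons]
    refine ⟨hc.add h1, ?_⟩
    rw [circleIntegral.integral_add hc h1, h2]
    rcases lt_or_gt_of_ne ha with h | h
    · rw [Multiset.filter_cons_of_pos (p := fun l : ℂ => ‖l‖ < 1) _ h, Multiset.card_cons,
        circleIntegral.integral_sub_inv_of_mem_ball (by simpa using h)]
      push_cast
      ring
    · rw [Multiset.filter_cons_of_neg (p := fun l : ℂ => ‖l‖ < 1) _ (by simpa using h.le)]
      have h0 : (∮ z in C(0, 1), (z - a)⁻¹) = 0 := by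
        have hne : ∀ z ∈ Metric.closedBall (0 : ℂ) 1, z - a ≠ 0 := fun z hz h' => by
          rw [mem_closedBall_zero_iff, sub_eq_zero.mp h'] at hz
          exact absurd hz (not_le.mpr h)
        refine Complex.circleIntegral_eq_zero_of_differentiable_on_off_countable zero_le_one
          Set.countable_empty ?_ ?_
        · exact ContinuousOn.inv₀ (by fun_prop) hne
        · intro z hz
          have := hne z (Metric.ball_subset_closedBall hz.1)
          fun_prop (disch := assumption)
      rw [h0, zero_add]

theorem circleIntegral_logDeriv (p : ℂ[X]) (hp : ∀ z : ℂ, ‖z‖ = 1 → p.eval z ≠ 0) :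
    CircleIntegrable (fun z => p.derivative.eval z / p.eval z) 0 1 ∧
      (∮ z in C(0, 1), p.derivative.eval z / p.eval z) =
        2 * Real.pi * Complex.I * (diskRoots p).card := by
  have hp0 : p ≠ 0 := fun h => hp 1 (by simp) (by simp [h])
  have h := circleIntegral_sum_inv_sub p.roots fun a ha h1 =>
    hp a h1 ((Polynomial.mem_roots hp0).mp ha)
  refine ⟨?_, ?_⟩
  · refine ContinuousOn.circleIntegrable zero_le_one fun z hz => ?_
    rw [mem_sphere_zero_iff_norm] at hz
    exact (ContinuousAt.div p.derivative.continuous.continuousAt p.continuous.continuousAt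
      (hp z hz)).continuousWithinAt
  · rw [diskRoots, ← h.2]
    refine circleIntegral.integral_congr zero_le_one fun z hz => ?_
    rw [mem_sphere_zero_iff_norm] at hz
    exact eval_derivative_div_eval p (hp z hz)

/-- Rouché's theorem for polynomials in the unit disk. -/
theorem card_diskRoots_eq {p q : ℂ[X]}
    (h : ∀ z : ℂ, ‖z‖ = 1 → ‖q.eval z - p.eval z‖ < ‖p.eval z‖) :
    (diskRoots q).card = (diskRoots p).card := by
  have hp : ∀ z : ℂ, ‖z‖ = 1 → p.eval z ≠ 0 := fun z hz h0 => by
    have := h z hz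
    rw [h0, norm_zero] at this
    exact absurd (norm_nonneg _) (not_le.mpr this)
  have hq : ∀ z : ℂ, ‖z‖ = 1 → q.eval z ≠ 0 := fun z hz h0 => by
    have := h z hz
    rw [h0, zero_sub, norm_neg] at this
    exact lt_irrefl _ this
  have hslit : ∀ z : ℂ, ‖z‖ = 1 → q.eval z / p.eval z ∈ Complex.slitPlane := by
    intro z hz
    have h1 := hp z hz
    have : q.eval z / p.eval z = 1 + (q.eval z - p.eval z) / p.eval z := by field_simp; ring
    rw [this]
    refine Complex.mem_slitPlane_of_norm_lt_one ?_
    rw [norm_div, div_lt_one (norm_pos_iff.mpr h1)]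
    exact h z hz
  -- On the circle `q / p` stays within distance less than one of `1`, so its principal logarithm is
  -- a primitive of the difference of logarithmic derivatives.
  have h0 : (∮ z in C(0, 1), (q.derivative.eval z / q.eval z - p.derivative.eval z / p.eval z)) =
      0 := by
    refine circleIntegral.integral_eq_zero_of_hasDerivWithinAt
      (f := fun z => Complex.log (q.eval z / p.eval z)) zero_le_one fun z hz => ?_
    rw [mem_sphere_zero_iff_norm] at hz
    have h1 := hp z hz
    have h2 := hq z hz
    have h3 := ((q.hasDerivAt z).div (p.hasDerivAt z) h1).clog (hslit z hz)
    refine (h3.congr_deriv ?_).hasDerivWithinAt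
    simp only [Pi.div_apply]
    field_simp
  have hP := circleIntegral_logDeriv p hp
  have hQ := circleIntegral_logDeriv q hq
  rw [circleIntegral.integral_sub hQ.1 hP.1, hQ.2, hP.2, ← mul_sub] at h0
  have h4 : (2 * Real.pi * Complex.I : ℂ) ≠ 0 := by simp [Real.pi_ne_zero, Complex.I_ne_zero]
  have h5 := sub_eq_zero.mp ((mul_eq_zero.mp h0).resolve_left h4)
  exact_mod_cast h5

/-- On the circle `|Φ_{n+1}^* - Φ_n^*| = |α_n| |Φ_n^*| < |Φ_n^*|` for `n ≥ N`, so Rouché applies at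
each step. -/
theorem card_diskRoots_PhiStar {α : ℕ → ℝ} {N : ℕ} (hα1 : ∀ n, |α n| ≠ 1)
    (hα : ∀ n, N ≤ n → |α n| < 1) {n : ℕ} (hn : N ≤ n) :
    (diskRoots (PhiStar (cx α) n)).card = (diskRoots (PhiStar (cx α) N)).card := by
  induction n, hn using Nat.le_induction with
  | base => rfl
  | succ n hn ih =>
    rw [← ih]
    refine card_diskRoots_eq fun z hz => ?_
    have h0 := norm_pos_iff.mpr (eval_PhiStar_ne_zero_of_norm_eq_one hα1 n hz)
    rw [(isSzegoSolution_eval_Phi α z).snd, sub_sub_cancel_left, norm_neg, norm_mul, norm_mul, hz,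
      one_mul, norm_eval_Phi_of_norm_eq_one α n hz, Complex.norm_real, Real.norm_eq_abs]
    exact mul_lt_of_lt_one_left h0 (hα n hn)

open Classical in
theorem exists_eq_prod_diskRoots_mul {p : ℂ[X]} (hp : p ≠ 0) :
    ∃ Q : ℂ[X], p = ((diskRoots p).map fun a => Polynomial.X - Polynomial.C a).prod * Q ∧
      ∀ z ∈ disk, Q.eval z ≠ 0 := by
  refine ⟨Polynomial.C p.leadingCoeff * ((p.roots.filter fun l => ¬ ‖l‖ < 1).map
    fun a => Polynomial.X - Polynomial.C a).prod, ?_, fun z hz => ?_⟩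
  · conv_lhs => rw [eq_leadingCoeff_mul_prod_roots p,
      ← Multiset.filter_add_not (fun l : ℂ => ‖l‖ < 1) p.roots]
    rw [Multiset.map_add, Multiset.prod_add, diskRoots]
    ring
  · rw [Polynomial.eval_mul, Polynomial.eval_C, Polynomial.eval_multiset_prod, Multiset.map_map]
    refine mul_ne_zero (Polynomial.leadingCoeff_ne_zero.mpr hp) (Multiset.prod_ne_zero fun h0 => ?_)
    obtain ⟨a, ha, h1⟩ := Multiset.mem_map.mp h0
    rw [Multiset.mem_filter] at ha
    simp only [Function.comp, Polynomial.eval_sub, Polynomial.eval_X, Polynomial.eval_C,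
      sub_eq_zero] at h1
    rw [h1, mem_disk_iff] at hz
    exact ha.2 hz

theorem exists_fin_map_eq {κ : ℕ} (s : Multiset ℂ) (h : s.card = κ) :
    ∃ l : Fin κ → ℂ, Finset.univ.val.map l = s := by
  obtain ⟨L, rfl⟩ := Quot.exists_rep s
  subst h
  exact ⟨L.get, (Fin.univ_val_map L.get).trans (congrArg _ (List.ofFn_get L))⟩

/-! ### Convergence of the Blaschke products -/

/-- A single Blaschke factor. -/
def blaschkeFactor (l z : ℂ) : ℂ := (‖l‖ : ℂ) / l * ((l - z) / (1 - conj l * z))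

theorem blaschke_eq_prod_diskRoots (a : ℕ → ℂ) (n : ℕ) (z : ℂ) :
    blaschke a n z = ((diskRoots (PhiStar a n)).map fun l => blaschkeFactor l z).prod := rfl

/-- Each step multiplies `Φ_k^* - z g_k Φ_k` by `1 + α_k z g_{k+1}`, which has no zero in the disk
when `|α_k| < 1`. For a truncated chain, ending in `g_m = 0`, this compares `Φ_m^*` with a
denominator at index `N`. -/
theorem IsSchurChain.PhiStar_sub_eq {α : ℕ → ℝ} {z : ℂ} {N m : ℕ} {g : ℕ → ℂ}
    (h : IsSchurChain α z N m g) (hm : N ≤ m) :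
    (PhiStar (cx α) m).eval z - z * g m * (Phi (cx α) m).eval z =
      ((PhiStar (cx α) N).eval z - z * g N * (Phi (cx α) N).eval z) *
        ∏ k ∈ Finset.Ico N m, (1 + α k * z * g (k + 1)) := by
  induction m, hm using Nat.le_induction with
  | base => simp
  | succ m hm ih =>
    have hs := isSzegoSolution_eval_Phi α z
    rw [Finset.prod_Ico_succ_top hm, ← mul_assoc, ← ih (h.mono m.le_succ), hs.fst, hs.snd]
    linear_combination z * (Phi (cx α) m).eval z * h.recursion m hm m.lt_succ_self

theorem exists_rootFamily {α : ℕ → ℝ} {N : ℕ} (hα1 : ∀ n, |α n| ≠ 1)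
    (hα : ∀ n, N ≤ n → |α n| < 1) :
    ∃ (κ : ℕ) (lam : ℕ → Fin κ → ℂ), ∀ n, N ≤ n → (∀ i, ‖lam n i‖ < 1) ∧
      (∀ z, blaschke (cx α) n z = ∏ i, blaschkeFactor (lam n i) z) ∧
      ∃ e : ℂ → ℂ, DifferentiableOn ℂ e disk ∧ (∀ z ∈ disk, e z ≠ 0) ∧
        ∀ z ∈ disk, denomF α (schurIter α (n - N) N) N z = (∏ i, (z - lam n i)) * e z := by
  classical
  have h1 : ∀ n, ∃ l : Fin (diskRoots (PhiStar (cx α) N)).card → ℂ,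
      N ≤ n → Finset.univ.val.map l = diskRoots (PhiStar (cx α) n) := fun n => by
    by_cases hn : N ≤ n
    · obtain ⟨l, hl⟩ := exists_fin_map_eq _ (card_diskRoots_PhiStar hα1 hα hn)
      exact ⟨l, fun _ => hl⟩
    · exact ⟨fun _ => 0, fun h => absurd h hn⟩
  choose lam hlam using h1
  refine ⟨_, lam, fun n hn => ⟨fun i => ?_, fun z => ?_, ?_⟩⟩
  · have : lam n i ∈ diskRoots (PhiStar (cx α) n) := by
      rw [← hlam n hn]
      exact Multiset.mem_map_of_mem _ (Finset.mem_univ i)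
    exact (Multiset.mem_filter.mp this).2
  · rw [blaschke_eq_prod_diskRoots, ← hlam n hn, Multiset.map_map]
    rfl
  · obtain ⟨Q, hQ, hQ0⟩ := exists_eq_prod_diskRoots_mul (PhiStar_ne_zero (cx α) n)
    have hd : ∀ k ∈ Finset.Ico N n, ∀ z ∈ disk,
        1 + α k * z * schurIter α (n - (k + 1)) (k + 1) z ≠ 0 := fun k hk z hz => by
      have hk := Finset.mem_Ico.mp hk
      exact one_add_ne_zero_of_norm_lt_one (norm_ofReal_mul_mul_lt_one (hα k hk.1) hz
        (norm_schurIter_le hz _ fun l hl => hα l (by omega)))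
    refine ⟨fun z => Q.eval z /
      ∏ k ∈ Finset.Ico N n, (1 + α k * z * schurIter α (n - (k + 1)) (k + 1) z), ?_, ?_, ?_⟩
    · refine DifferentiableOn.div Q.differentiable.differentiableOn ?_
        fun z hz => Finset.prod_ne_zero_iff.mpr fun k hk => hd k hk z hz
      refine DifferentiableOn.fun_finsetProd fun k hk => ?_
      have hk := Finset.mem_Ico.mp hk
      have := differentiableOn_schurIter (n - (k + 1)) (n := k + 1) (α := α)
        fun l hl => hα l (by omega)
      fun_prop
    · exact fun z hz => div_ne_zero (hQ0 z hz) (Finset.prod_ne_zero_iff.mpr fun k hk => hd k hk z hz)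
    · intro z hz
      have h2 := (isSchurChain_schurIter hα hz n).PhiStar_sub_eq hn
      simp only [Nat.sub_self, schurIter, mul_zero, zero_mul, sub_zero] at h2
      have h3 : (PhiStar (cx α) n).eval z = (∏ i, (z - lam n i)) * Q.eval z := by
        conv_lhs => rw [hQ]
        rw [Polynomial.eval_mul, Polynomial.eval_multiset_prod, ← hlam n hn, Multiset.map_map,
          Multiset.map_map]
        congr 1
        change (Multiset.map (fun i => (Polynomial.X - Polynomial.C (lam n i)).eval z) _).prod = _
        simp only [Polynomial.eval_sub, Polynomial.eval_X, Polynomial.eval_C]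
        rfl
      rw [h3] at h2
      rw [denomF, ← mul_div_assoc, eq_div_iff
        (Finset.prod_ne_zero_iff.mpr fun k hk => hd k hk z hz)]
      exact h2.symm

theorem tendstoLocallyUniformlyOn_denomF {α : ℕ → ℝ} {N : ℕ} {f : ℕ → ℂ → ℂ}
    (hf : IsSchurSequence (cx α) N f) (hα : ∀ n, N ≤ n → |α n| < 1) :
    TendstoLocallyUniformlyOn (fun n z => denomF α (schurIter α (n - N) N) N z)
      (denomF α (f N) N) Filter.atTop disk := by
  have h1 : TendstoLocallyUniformlyOn (fun j => schurIter α j N) (f N) Filter.atTop disk :=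
    tendstoLocallyUniformlyOn_of_norm_sub_le fun j z hz =>
      (hf.isSchurChain hα hz (N + j)).norm_schurIter_sub_le hα hz
  rw [Metric.tendstoLocallyUniformlyOn_iff] at h1 ⊢
  intro ε hε x hx
  obtain ⟨C, hC⟩ := (isCompact_closedBall (0 : ℂ) 1).exists_bound_of_continuousOn
    (f := fun z => (Phi (cx α) N).eval z) (Phi (cx α) N).continuous.continuousOn
  have hC0 : 0 < |C| + 1 := by positivity
  obtain ⟨t, ht, h2⟩ := h1 (ε / (|C| + 1)) (by positivity) x hx
  refine ⟨t ∩ disk, Filter.inter_mem ht self_mem_nhdsWithin, ?_⟩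
  filter_upwards [(Filter.tendsto_sub_atTop_nat N).eventually h2] with n hn y hy
  have h3 := hn y hy.1
  have hy1 := mem_disk_iff.mp hy.2
  rw [dist_eq_norm] at h3 ⊢
  have h4 : denomF α (f N) N y - denomF α (schurIter α (n - N) N) N y =
      -(y * (f N y - schurIter α (n - N) N y) * (Phi (cx α) N).eval y) := by
    rw [denomF, denomF]; ring
  rw [h4, norm_neg, norm_mul, norm_mul]
  have h5 : ‖(Phi (cx α) N).eval y‖ ≤ |C| + 1 :=
    (hC y (by simpa using hy1.le)).trans (by linarith [le_abs_self C])
  calc ‖y‖ * ‖f N y - schurIter α (n - N) N y‖ * ‖(Phi (cx α) N).eval y‖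
      ≤ 1 * ‖f N y - schurIter α (n - N) N y‖ * (|C| + 1) := by gcongr
    _ < 1 * (ε / (|C| + 1)) * (|C| + 1) := by gcongr
    _ = ε := by field_simp

/-- If `d_n = ∏_i (z - λ_{n,i}) e_n` with zero-free `e_n` in the disk, `d_n → d` and
`λ_{n,i} → l_i`, then `d` and `∏_i (z - l_i)` are locally comparable. -/
theorem eventually_comparable {κ : ℕ} {F : Filter ℕ} [F.NeBot] {dn e : ℕ → ℂ → ℂ} {d : ℂ → ℂ}
    {lam : ℕ → Fin κ → ℂ} {l : Fin κ → ℂ} (hd : AnalyticOnNhd ℂ d disk) (hd0 : d 0 ≠ 0)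
    (hlim : TendstoLocallyUniformlyOn dn d F disk)
    (hl : ∀ i, Filter.Tendsto (fun n => lam n i) F (𝓝 (l i)))
    (hlam : ∀ᶠ n in F, (∀ i, ‖lam n i‖ < 1) ∧ DifferentiableOn ℂ (e n) disk ∧
      (∀ z ∈ disk, e n z ≠ 0) ∧ ∀ z ∈ disk, dn n z = (∏ i, (z - lam n i)) * e n z)
    {a : ℂ} (ha : a ∈ disk) :
    ∃ C : ℝ, ∀ᶠ z in 𝓝 a, ‖d z‖ ≤ C * ‖∏ i, (z - l i)‖ ∧ ‖∏ i, (z - l i)‖ ≤ C * ‖d z‖ := by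
  obtain ⟨ε1, hε1, hball⟩ := Metric.isOpen_iff.mp Metric.isOpen_ball a ha
  have hdn := eventually_ne_zero_nhdsNE_of_analyticOnNhd hd hd0 ha
  rw [eventually_nhdsWithin_iff, Metric.eventually_nhds_iff] at hdn
  obtain ⟨ε2, hε2, hdne⟩ := hdn
  have hsep : ∀ i, ∃ ε > 0, ∀ r < ε, l i = a ∨ 2 * r ≤ ‖l i - a‖ := fun i => by
    by_cases h : l i = a
    · exact ⟨1, one_pos, fun r _ => Or.inl h⟩
    · have := norm_pos_iff.mpr (sub_ne_zero.mpr h)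
      exact ⟨‖l i - a‖ / 2, by positivity, fun r hr => Or.inr (by linarith)⟩
  choose ε3 hε3 hsep using hsep
  -- The circle of radius `r` lies in the disk, avoids the zeros of `d`, and keeps distance at least
  -- `r` from every `l i`, since each `l i` is either the center or at least `2 r` away from it.
  obtain ⟨r, hr0, hr1, hr2, hr3⟩ : ∃ r > 0, r < ε1 ∧ r < ε2 ∧ ∀ i, r < ε3 i := by
    have h1 : ∀ᶠ r in 𝓝[>] (0 : ℝ), r < ε1 ∧ r < ε2 ∧ ∀ i, r < ε3 i := by
      have h2 : ∀ ε > 0, ∀ᶠ r in 𝓝[>] (0 : ℝ), r < ε := fun ε hε =>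
        mem_nhdsWithin_of_mem_nhds (gt_mem_nhds hε)
      exact (h2 _ hε1).and ((h2 _ hε2).and (Filter.eventually_all.mpr fun i => h2 _ (hε3 i)))
    obtain ⟨r, h, hr⟩ := (h1.and self_mem_nhdsWithin).exists
    exact ⟨r, hr, h⟩
  have hcb : Metric.closedBall a r ⊆ disk :=
    (Metric.closedBall_subset_ball hr1).trans hball
  have hSd : Metric.sphere a r ⊆ disk := Metric.sphere_subset_closedBall.trans hcb
  have hSc : IsCompact (Metric.sphere a r) := isCompact_sphere a r
  have hdc : ContinuousOn d (Metric.sphere a r) := hd.continuousOn.mono hSd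
  have hdS : ∀ z ∈ Metric.sphere a r, d z ≠ 0 := fun z hz => by
    have hza : dist z a = r := hz
    refine hdne (by rw [hza]; exact hr2) fun h => ?_
    rw [h, dist_self] at hza
    exact hr0.ne hza
  obtain ⟨M, hM⟩ := hSc.exists_bound_of_continuousOn hdc
  obtain ⟨K, hK⟩ := hSc.exists_bound_of_continuousOn (hdc.inv₀ hdS)
  have hSne : (Metric.sphere a r).Nonempty := NormedSpace.sphere_nonempty.mpr hr0.le
  obtain ⟨z0, hz0⟩ := hSne
  have hK0 : 0 < K := by
    refine lt_of_lt_of_le ?_ (hK z0 hz0)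
    simpa using hdS z0 hz0
  have hlow : ∀ z ∈ Metric.sphere a r, K⁻¹ ≤ ‖d z‖ := fun z hz => by
    have := hK z hz
    rw [Pi.inv_apply, norm_inv] at this
    exact inv_le_of_inv_le₀ (norm_pos_iff.mpr (hdS z hz)) this
  have hM0 : 0 ≤ M := (norm_nonneg _).trans (hM z0 hz0)
  have hunif : ∀ᶠ n in F, ∀ z ∈ Metric.sphere a r, dist (d z) (dn n z) < K⁻¹ / 2 := by
    have h1 := (tendstoLocallyUniformlyOn_iff_tendstoUniformlyOn_of_compact hSc).mp
      (hlim.mono hSd)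
    exact Metric.tendstoUniformlyOn_iff.mp h1 _ (by positivity)
  have hclose : ∀ᶠ n in F, ∀ i, ‖lam n i - l i‖ < r / 2 :=
    Filter.eventually_all.mpr fun i => by
      have := (Metric.tendsto_nhds.mp (hl i)) (r / 2) (by positivity)
      simpa [dist_eq_norm] using this
  set C1 : ℝ := (M + K⁻¹) / (r / 2) ^ κ with hC1
  set C2 : ℝ := 2 ^ κ / (K⁻¹ / 2) with hC2
  have hmain : ∀ᶠ n in F, ∀ z ∈ Metric.ball a r,
      ‖dn n z‖ ≤ C1 * ‖∏ i, (z - lam n i)‖ ∧ ‖∏ i, (z - lam n i)‖ ≤ C2 * ‖dn n z‖ := by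
    filter_upwards [hlam, hunif, hclose] with n ⟨hn1, hn2, hn3, hn4⟩ hn5 hn6
    have hRlow : ∀ z ∈ Metric.sphere a r, (r / 2) ^ κ ≤ ‖∏ i, (z - lam n i)‖ := fun z hz => by
      rw [norm_prod]
      calc (r / 2) ^ κ = ∏ _i : Fin κ, (r / 2) := by
            rw [Finset.prod_const, Finset.card_univ, Fintype.card_fin]
        _ ≤ _ := Finset.prod_le_prod (fun _ _ => by positivity) fun i _ => ?_
      have hza : ‖z - a‖ = r := by rw [← dist_eq_norm]; exact hz
      have h1 : r ≤ ‖z - l i‖ := by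
        rcases hsep i r (hr3 i) with h | h
        · rw [h, hza]
        · have := norm_sub_norm_le (l i - a) (z - a)
          rw [sub_sub_sub_cancel_right, norm_sub_rev (l i) z] at this
          linarith
      have h2 := norm_sub_norm_le (z - l i) (lam n i - l i)
      rw [sub_sub_sub_cancel_right] at h2
      linarith [hn6 i]
    have hRup : ∀ z ∈ Metric.sphere a r, ‖∏ i, (z - lam n i)‖ ≤ 2 ^ κ := fun z hz => by
      rw [norm_prod]
      calc _ ≤ ∏ _i : Fin κ, (2 : ℝ) := Finset.prod_le_prod (fun _ _ => norm_nonneg _) fun i _ => ?_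
        _ = 2 ^ κ := by rw [Finset.prod_const, Finset.card_univ, Fintype.card_fin]
      have := mem_disk_iff.mp (hSd hz)
      linarith [norm_sub_le z (lam n i), hn1 i]
    have hdup : ∀ z ∈ Metric.sphere a r, ‖dn n z‖ ≤ M + K⁻¹ := fun z hz => by
      have h1 := hn5 z hz
      rw [dist_comm, dist_eq_norm] at h1
      have h2 := norm_sub_norm_le (dn n z) (d z)
      linarith [hM z hz, inv_pos.mpr hK0]
    have hdlow : ∀ z ∈ Metric.sphere a r, K⁻¹ / 2 ≤ ‖dn n z‖ := fun z hz => by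
      have h1 := hn5 z hz
      rw [dist_eq_norm] at h1
      have h2 := norm_sub_norm_le (d z) (dn n z)
      linarith [hlow z hz]
    -- On the circle both `d_n` and the root product are bounded above and away from zero, uniformly
    -- in `n`. The maximum principle for `e_n` and, as it is zero-free, for `1 / e_n` carries the
    -- bounds on the quotient to the ball.
    have hdiff : DiffContOnCl ℂ (e n) (Metric.ball a r) :=
      (hn2.mono hcb).diffContOnCl_ball le_rfl
    have hdiff' : DiffContOnCl ℂ (fun z => (e n z)⁻¹) (Metric.ball a r) :=
      ((hn2.mono hcb).inv fun z hz => hn3 z (hcb hz)).diffContOnCl_ball le_rfl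
    have he1 : ∀ z ∈ Metric.ball a r, ‖e n z‖ ≤ C1 := fun z hz => by
      refine Complex.norm_le_of_forall_mem_frontier_norm_le Metric.isBounded_ball hdiff
        (fun w hw => ?_) (subset_closure hz)
      rw [frontier_ball a hr0.ne'] at hw
      have h1 := hdup w hw
      rw [hn4 w (hSd hw), norm_mul] at h1
      rw [hC1, le_div_iff₀ (by positivity)]
      calc ‖e n w‖ * (r / 2) ^ κ ≤ ‖e n w‖ * ‖∏ i, (w - lam n i)‖ := by gcongr; exact hRlow w hw
        _ ≤ M + K⁻¹ := by linarith
    have he2 : ∀ z ∈ Metric.ball a r, ‖(e n z)⁻¹‖ ≤ C2 := fun z hz => by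
      refine Complex.norm_le_of_forall_mem_frontier_norm_le Metric.isBounded_ball hdiff'
        (fun w hw => ?_) (subset_closure hz)
      rw [frontier_ball a hr0.ne'] at hw
      have h1 := hdlow w hw
      rw [hn4 w (hSd hw), norm_mul] at h1
      have hpos := norm_pos_iff.mpr (hn3 w (hSd hw))
      rw [norm_inv, hC2, le_div_iff₀ (by positivity), inv_mul_le_iff₀ hpos]
      calc K⁻¹ / 2 ≤ ‖∏ i, (w - lam n i)‖ * ‖e n w‖ := h1
        _ ≤ 2 ^ κ * ‖e n w‖ := by gcongr; exact hRup w hw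
        _ = ‖e n w‖ * 2 ^ κ := mul_comm _ _
    intro z hz
    have hzd := hcb (Metric.ball_subset_closedBall hz)
    rw [hn4 z hzd, norm_mul]
    refine ⟨?_, ?_⟩
    · rw [mul_comm]
      gcongr
      exact he1 z hz
    · have hpos := norm_pos_iff.mpr (hn3 z hzd)
      have h1 := he2 z hz
      rw [norm_inv] at h1
      calc ‖∏ i, (z - lam n i)‖
          = ‖e n z‖⁻¹ * (‖∏ i, (z - lam n i)‖ * ‖e n z‖) := by field_simp
        _ ≤ C2 * (‖∏ i, (z - lam n i)‖ * ‖e n z‖) := by gcongr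
  refine ⟨max C1 C2, ?_⟩
  filter_upwards [Metric.ball_mem_nhds a hr0] with z hz
  have hzd := hcb (Metric.ball_subset_closedBall hz)
  have t1 : Filter.Tendsto (fun n => ‖dn n z‖) F (𝓝 ‖d z‖) := (hlim.tendsto_at hzd).norm
  have t2 : Filter.Tendsto (fun n => ‖∏ i, (z - lam n i)‖) F (𝓝 ‖∏ i, (z - l i)‖) :=
    (tendsto_finsetProd _ fun i _ => tendsto_const_nhds.sub (hl i)).norm
  refine ⟨(le_of_tendsto_of_tendsto t1 (t2.const_mul C1)
      (hmain.mono fun n hn => (hn z hz).1)).trans ?_,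
    (le_of_tendsto_of_tendsto t2 (t1.const_mul C2) (hmain.mono fun n hn => (hn z hz).2)).trans ?_⟩
  · gcongr; exact le_max_left _ _
  · gcongr; exact le_max_right _ _

/-- Otherwise division by the power of `z - a` in `P` leaves a cofactor that is nonzero at `a` but
dominated by a function vanishing there. -/
theorem rootMultiplicity_le_of_norm_eval_le {P Q : ℂ[X]} (hP : P ≠ 0) (hQ : Q ≠ 0) {a : ℂ} {C : ℝ}
    (h : ∀ᶠ z in 𝓝 a, ‖P.eval z‖ ≤ C * ‖Q.eval z‖) :
    Q.rootMultiplicity a ≤ P.rootMultiplicity a := by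
  obtain ⟨S, hS, hS0⟩ := P.exists_eq_pow_rootMultiplicity_mul_and_not_dvd hP a
  obtain ⟨T, hT, -⟩ := Q.exists_eq_pow_rootMultiplicity_mul_and_not_dvd hQ a
  set m := P.rootMultiplicity a
  by_contra! hlt
  obtain ⟨k, hk⟩ : ∃ k, Q.rootMultiplicity a = m + k + 1 := ⟨Q.rootMultiplicity a - m - 1, by omega⟩
  rw [hk] at hT
  rw [Polynomial.dvd_iff_isRoot, Polynomial.IsRoot.def] at hS0
  have h1 : ∀ᶠ z in 𝓝[≠] a, ‖S.eval z‖ ≤ C * ‖(z - a) ^ (k + 1) * T.eval z‖ := by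
    filter_upwards [h.filter_mono nhdsWithin_le_nhds, self_mem_nhdsWithin] with z hz hza
    have hpos : 0 < ‖z - a‖ ^ m := pow_pos (norm_pos_iff.mpr (sub_ne_zero.mpr hza)) _
    rw [hS, hT] at hz
    simp only [Polynomial.eval_mul, Polynomial.eval_pow, Polynomial.eval_sub, Polynomial.eval_X,
      Polynomial.eval_C, norm_mul, norm_pow] at hz ⊢
    refine le_of_mul_le_mul_left ?_ hpos
    refine hz.trans (le_of_eq ?_)
    ring
  have t1 : Filter.Tendsto (fun z => ‖S.eval z‖) (𝓝[≠] a) (𝓝 ‖S.eval a‖) :=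
    (S.continuous.norm.tendsto a).mono_left nhdsWithin_le_nhds
  have t2 : Filter.Tendsto (fun z => C * ‖(z - a) ^ (k + 1) * T.eval z‖) (𝓝[≠] a) (𝓝 0) := by
    have hT := T.continuous
    have : Continuous fun z => C * ‖(z - a) ^ (k + 1) * T.eval z‖ := by fun_prop
    simpa using (this.tendsto a).mono_left (nhdsWithin_le_nhds (s := {a}ᶜ))
  have := le_of_tendsto_of_tendsto t1 t2 h1
  exact hS0 (norm_le_zero_iff.mp this)

-- Local comparability fixes the multiplicity at each point of the disk and says nothing about the
-- points on or outside the circle; hence the filter.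
open Classical in
theorem filter_map_eq_of_comparable {κ : ℕ} {l l' : Fin κ → ℂ}
    (h : ∀ a ∈ disk, ∃ C : ℝ, ∀ᶠ z in 𝓝 a, ‖∏ i, (z - l i)‖ ≤ C * ‖∏ i, (z - l' i)‖)
    (h' : ∀ a ∈ disk, ∃ C : ℝ, ∀ᶠ z in 𝓝 a, ‖∏ i, (z - l' i)‖ ≤ C * ‖∏ i, (z - l i)‖) :
    (Finset.univ.val.map l).filter (fun a => ‖a‖ < 1) =
      (Finset.univ.val.map l').filter (fun a => ‖a‖ < 1) := by
  have key : ∀ (l : Fin κ → ℂ) (a : ℂ), (Finset.univ.val.map l).count a =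
      (((Finset.univ.val.map l).map
        fun a => Polynomial.X - Polynomial.C a).prod).rootMultiplicity a := fun l a => by
    rw [← Polynomial.count_roots, Polynomial.roots_multiset_prod_X_sub_C]
  have hne : ∀ l : Fin κ → ℂ, ((Finset.univ.val.map l).map
      fun a => Polynomial.X - Polynomial.C a).prod ≠ 0 := fun l =>
    (Polynomial.monic_multisetProd_X_sub_C _).ne_zero
  have hev : ∀ (l : Fin κ → ℂ) (z : ℂ), (((Finset.univ.val.map l).map
      fun a => Polynomial.X - Polynomial.C a).prod).eval z = ∏ i, (z - l i) := fun l z => by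
    rw [Polynomial.eval_multiset_prod, Multiset.map_map, Multiset.map_map]
    change (Multiset.map (fun i => (Polynomial.X - Polynomial.C (l i)).eval z) _).prod = _
    simp only [Polynomial.eval_sub, Polynomial.eval_X, Polynomial.eval_C]
    rfl
  ext a
  by_cases ha : ‖a‖ < 1
  · rw [Multiset.count_filter_of_pos (p := fun a : ℂ => ‖a‖ < 1) ha,
      Multiset.count_filter_of_pos (p := fun a : ℂ => ‖a‖ < 1) ha, key, key]
    obtain ⟨C, hC⟩ := h a (mem_disk_iff.mpr ha)
    obtain ⟨C', hC'⟩ := h' a (mem_disk_iff.mpr ha)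
    exact le_antisymm
      (rootMultiplicity_le_of_norm_eval_le (hne _) (hne _) (by simpa only [hev] using hC'))
      (rootMultiplicity_le_of_norm_eval_le (hne _) (hne _) (by simpa only [hev] using hC))
  · rw [Multiset.count_filter_of_neg (p := fun a : ℂ => ‖a‖ < 1) ha,
      Multiset.count_filter_of_neg (p := fun a : ℂ => ‖a‖ < 1) ha]

theorem one_sub_conj_mul_ne_zero {l z : ℂ} (hl : ‖l‖ ≤ 1) (hz : z ∈ disk) :
    1 - conj l * z ≠ 0 := by
  rw [sub_eq_add_neg]
  refine one_add_ne_zero_of_norm_lt_one ?_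
  rw [norm_neg, norm_mul, RCLike.norm_conj]
  exact (mul_le_of_le_one_left (norm_nonneg _) hl).trans_lt (mem_disk_iff.mp hz)

/-- As `conj l = l⁻¹`, the factor `l - z` cancels. Zeros that escape to the circle therefore leave
no trace in the limit of the Blaschke products. -/
theorem blaschkeFactor_of_norm_eq_one {l z : ℂ} (hl : ‖l‖ = 1) (hz : z ∈ disk) :
    blaschkeFactor l z = 1 := by
  have h1 := one_sub_conj_mul_ne_zero hl.le hz
  have hl0 : l ≠ 0 := fun h => by simp [h] at hl
  have hc : conj l = l⁻¹ := by
    rw [Complex.inv_def, Complex.normSq_eq_norm_sq, hl]; simp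
  rw [hc] at h1
  have h2 : l - z ≠ 0 := fun h => h1 (by rw [← sub_eq_zero.mp h, inv_mul_cancel₀ hl0, sub_self])
  rw [blaschkeFactor, hl, hc, show 1 - l⁻¹ * z = (l - z) / l by field_simp]
  field_simp
  simp

theorem tendsto_blaschkeFactor {ι : Type*} {F : Filter ι} {u v : ι → ℂ} {l z : ℂ}
    (hl0 : l ≠ 0) (hl : ‖l‖ ≤ 1) (hz : z ∈ disk) (hu : Filter.Tendsto u F (𝓝 l))
    (hv : Filter.Tendsto v F (𝓝 z)) :
    Filter.Tendsto (fun i => blaschkeFactor (u i) (v i)) F (𝓝 (blaschkeFactor l z)) := by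
  have hc : Filter.Tendsto (fun i => conj (u i)) F (𝓝 (conj l)) :=
    (Complex.continuous_conj.tendsto l).comp hu
  have hn : Filter.Tendsto (fun i => (‖u i‖ : ℂ)) F (𝓝 (‖l‖ : ℂ)) :=
    (Complex.continuous_ofReal.tendsto _).comp hu.norm
  exact (hn.div hu hl0).mul ((hu.sub hv).div (tendsto_const_nhds.sub (hc.mul hv))
    (one_sub_conj_mul_ne_zero hl hz))

open Classical in
theorem prod_blaschkeFactor_eq {κ : ℕ} {l : Fin κ → ℂ} (hl : ∀ i, ‖l i‖ ≤ 1) {z : ℂ}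
    (hz : z ∈ disk) : ∏ i, blaschkeFactor (l i) z =
      (((Finset.univ.val.map l).filter (fun a => ‖a‖ < 1)).map fun a => blaschkeFactor a z).prod := by
  have h1 : ∏ i, blaschkeFactor (l i) z =
      ((Finset.univ.val.map l).map fun a => blaschkeFactor a z).prod := by
    rw [Multiset.map_map]; rfl
  have h2 : (((Finset.univ.val.map l).filter fun a => ¬ ‖a‖ < 1).map
      fun a => blaschkeFactor a z).prod = 1 := by
    refine Multiset.prod_eq_one fun x hx => ?_
    obtain ⟨a, ha, rfl⟩ := Multiset.mem_map.mp hx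
    obtain ⟨ha1, ha2⟩ := Multiset.mem_filter.mp ha
    obtain ⟨i, -, rfl⟩ := Multiset.mem_map.mp ha1
    exact blaschkeFactor_of_norm_eq_one (le_antisymm (hl i) (not_lt.mp ha2)) hz
  rw [h1]
  conv_lhs => rw [← Multiset.filter_add_not (fun a : ℂ => ‖a‖ < 1) (Finset.univ.val.map l),
    Multiset.map_add, Multiset.prod_add, h2, mul_one]

/-- Along every ultrafilter the zeros of `Φ_n^*` in the disk converge; the limits in the disk are
the zeros of the denominator of `F`. -/
theorem IsSchurSequence.exists_limit_roots {α : ℕ → ℝ} {N : ℕ} {f : ℕ → ℂ → ℂ}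
    (hf : IsSchurSequence (cx α) N f) (hα1 : ∀ n, |α n| ≠ 1) (hα : ∀ n, N ≤ n → |α n| < 1) :
    ∃ (κ : ℕ) (lam : ℕ → Fin κ → ℂ),
      (∀ n, N ≤ n → ∀ z, blaschke (cx α) n z = ∏ i, blaschkeFactor (lam n i) z) ∧
      ∀ F : Ultrafilter ℕ, (F : Filter ℕ) ≤ Filter.atTop → ∃ l : Fin κ → ℂ,
        (∀ i, l i ≠ 0 ∧ ‖l i‖ ≤ 1 ∧ Filter.Tendsto (fun n => lam n i) F (𝓝 (l i))) ∧
        ∀ a ∈ disk, ∃ C : ℝ, ∀ᶠ z in 𝓝 a, ‖denomF α (f N) N z‖ ≤ C * ‖∏ i, (z - l i)‖ ∧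
          ‖∏ i, (z - l i)‖ ≤ C * ‖denomF α (f N) N z‖ := by
  obtain ⟨κ, lam, h⟩ := exists_rootFamily hα1 hα
  refine ⟨κ, lam, fun n hn => (h n hn).2.1, fun F hF => ?_⟩
  have hev : ∀ᶠ n in (F : Filter ℕ), N ≤ n := hF (Filter.eventually_ge_atTop N)
  have h1 : ∀ i, ∃ l, ‖l‖ ≤ 1 ∧ Filter.Tendsto (fun n => lam n i) F (𝓝 l) := fun i => by
    obtain ⟨l, hl, hl'⟩ := (isCompact_closedBall (0 : ℂ) 1).ultrafilter_le_nhds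
      (F.map fun n => lam n i) (by
        rw [Filter.le_principal_iff, Ultrafilter.coe_map, Filter.mem_map]
        filter_upwards [hev] with n hn
        simpa using ((h n hn).1 i).le)
    exact ⟨l, by simpa using hl, hl'⟩
  choose l hl1 hl2 using h1
  have he : ∀ n, ∃ e : ℂ → ℂ, N ≤ n → DifferentiableOn ℂ e disk ∧ (∀ z ∈ disk, e z ≠ 0) ∧
      ∀ z ∈ disk, denomF α (schurIter α (n - N) N) N z = (∏ i, (z - lam n i)) * e z := fun n => by
    by_cases hn : N ≤ n
    · exact ⟨(h n hn).2.2.choose, fun _ => (h n hn).2.2.choose_spec⟩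
    · exact ⟨0, fun h => absurd h hn⟩
  choose e he using he
  have hcomp : ∀ a ∈ disk, ∃ C : ℝ, ∀ᶠ z in 𝓝 a,
      ‖denomF α (f N) N z‖ ≤ C * ‖∏ i, (z - l i)‖ ∧
        ‖∏ i, (z - l i)‖ ≤ C * ‖denomF α (f N) N z‖ := fun a ha =>
    eventually_comparable (F := F) (e := e) (lam := lam)
      (fun z hz => analyticAt_denomF α N ((hf.schur N le_rfl).analyticOnNhd z hz))
      (by simp [denomF_zero])
      (fun u hu x hx => by
        obtain ⟨t, ht, h2⟩ := tendstoLocallyUniformlyOn_denomF hf hα u hu x hx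
        exact ⟨t, ht, hF h2⟩) hl2
      (hev.mono fun n hn => ⟨(h n hn).1, he n hn⟩) ha
  refine ⟨l, fun i => ⟨fun hi => ?_, hl1 i, hl2 i⟩, hcomp⟩
  -- No zero tends to the origin: the denominator equals `1` there, while the comparable product
  -- would vanish.
  obtain ⟨C, hC⟩ := hcomp 0 zero_mem_disk
  have h2 := hC.self_of_nhds.1
  rw [denomF_zero, Finset.prod_eq_zero (Finset.mem_univ i) (by simp [hi])] at h2
  norm_num at h2

/-- Locally uniform convergence is tested along ultrafilters on pairs `(n, z)`. Different
ultrafilters may order the limiting zeros differently and push others to different points of the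
circle, but the zeros inside the disk are always those of the denominator, so all ultrafilters give
the same product. -/
theorem IsSchurSequence.exists_isBlaschkeLimit {α : ℕ → ℝ} {N : ℕ} {f : ℕ → ℂ → ℂ}
    (hf : IsSchurSequence (cx α) N f) (hα1 : ∀ n, |α n| ≠ 1) (hα : ∀ n, N ≤ n → |α n| < 1) :
    ∃ B, IsBlaschkeLimit (cx α) B := by
  obtain ⟨κ, lam, hB, hU⟩ := hf.exists_limit_roots hα1 hα
  obtain ⟨l₀, hl₀, hc₀⟩ := hU (Filter.hyperfilter ℕ) Nat.hyperfilter_le_atTop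
  refine ⟨fun z => ∏ i, blaschkeFactor (l₀ i) z, ?_⟩
  rw [IsBlaschkeLimit, tendstoLocallyUniformlyOn_iff_forall_tendsto]
  intro x hx
  rw [Filter.tendsto_iff_ultrafilter]
  intro W hW
  have hW1 : Filter.Tendsto Prod.fst (W : Filter (ℕ × ℂ)) Filter.atTop :=
    Filter.tendsto_fst.mono_left hW
  have hW2 : Filter.Tendsto Prod.snd (W : Filter (ℕ × ℂ)) (𝓝 x) :=
    (Filter.tendsto_snd.mono_left hW).mono_right nhdsWithin_le_nhds
  obtain ⟨l, hl, hc⟩ := hU (W.map Prod.fst) hW1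
  have heq : ∏ i, blaschkeFactor (l₀ i) x = ∏ i, blaschkeFactor (l i) x := by
    have htrans : ∀ {l l' : Fin κ → ℂ},
        (∀ a ∈ disk, ∃ C : ℝ, ∀ᶠ z in 𝓝 a, ‖denomF α (f N) N z‖ ≤ C * ‖∏ i, (z - l i)‖ ∧
          ‖∏ i, (z - l i)‖ ≤ C * ‖denomF α (f N) N z‖) →
        (∀ a ∈ disk, ∃ C : ℝ, ∀ᶠ z in 𝓝 a, ‖denomF α (f N) N z‖ ≤ C * ‖∏ i, (z - l' i)‖ ∧
          ‖∏ i, (z - l' i)‖ ≤ C * ‖denomF α (f N) N z‖) →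
        ∀ a ∈ disk, ∃ C : ℝ, ∀ᶠ z in 𝓝 a, ‖∏ i, (z - l i)‖ ≤ C * ‖∏ i, (z - l' i)‖ := by
      intro l l' h h' a ha
      obtain ⟨C, hC⟩ := h a ha
      obtain ⟨C', hC'⟩ := h' a ha
      refine ⟨|C| * C', ?_⟩
      filter_upwards [hC, hC'] with z hz hz'
      calc _ ≤ C * ‖denomF α (f N) N z‖ := hz.2
        _ ≤ |C| * ‖denomF α (f N) N z‖ := by gcongr; exact le_abs_self C
        _ ≤ |C| * (C' * ‖∏ i, (z - l' i)‖) := by gcongr; exact hz'.1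
        _ = _ := by ring
    rw [prod_blaschkeFactor_eq (fun i => (hl₀ i).2.1) hx,
      prod_blaschkeFactor_eq (fun i => (hl i).2.1) hx,
      filter_map_eq_of_comparable (htrans hc₀ hc) (htrans hc hc₀)]
  have t1 : Filter.Tendsto (fun y : ℕ × ℂ => ∏ i, blaschkeFactor (l₀ i) y.2) W
      (𝓝 (∏ i, blaschkeFactor (l₀ i) x)) :=
    tendsto_finsetProd _ fun i _ =>
      tendsto_blaschkeFactor (hl₀ i).1 (hl₀ i).2.1 hx tendsto_const_nhds hW2
  have t2 : Filter.Tendsto (fun y : ℕ × ℂ => blaschke (cx α) y.1 y.2) W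
      (𝓝 (∏ i, blaschkeFactor (l₀ i) x)) := by
    rw [heq]
    have t3 : Filter.Tendsto (fun y : ℕ × ℂ => ∏ i, blaschkeFactor (lam y.1 i) y.2) W
        (𝓝 (∏ i, blaschkeFactor (l i) x)) :=
      tendsto_finsetProd _ fun i _ => tendsto_blaschkeFactor (hl i).1 (hl i).2.1 hx
        ((hl i).2.2.comp (Filter.tendsto_map (f := Prod.fst))) hW2
    refine t3.congr' ?_
    filter_upwards [hW1.eventually (Filter.eventually_ge_atTop N)] with y hy
    exact (hB y.1 hy y.2).symm
  exact (t1.prodMk_nhds t2).mono_right (nhds_le_uniformity _)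

/-- `B` is the product of the Blaschke factors of limiting zeros `l_i`, none of which is zero. Where
the denominator vanishes, comparability puts some `l_i` there, and `B` vanishes too. -/
theorem IsSchurSequence.blaschke_limit_ne_zero {α : ℕ → ℝ} {N : ℕ} {f : ℕ → ℂ → ℂ}
    (hf : IsSchurSequence (cx α) N f) (hα1 : ∀ n, |α n| ≠ 1) (hα : ∀ n, N ≤ n → |α n| < 1)
    {B : ℂ → ℂ} (hB : IsBlaschkeLimit (cx α) B) :
    B 0 ≠ 0 ∧ ∀ z ∈ disk, B z ≠ 0 → denomF α (f N) N z ≠ 0 := by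
  obtain ⟨κ, lam, hb, hU⟩ := hf.exists_limit_roots hα1 hα
  obtain ⟨l, hl, hc⟩ := hU (Filter.hyperfilter ℕ) Nat.hyperfilter_le_atTop
  have hBl : ∀ z ∈ disk, B z = ∏ i, blaschkeFactor (l i) z := by
    intro z hz
    refine tendsto_nhds_unique
      ((TendstoLocallyUniformlyOn.tendsto_at hB hz).mono_left Nat.hyperfilter_le_atTop) ?_
    have t : Filter.Tendsto (fun n => ∏ i, blaschkeFactor (lam n i) z) (Filter.hyperfilter ℕ)
        (𝓝 (∏ i, blaschkeFactor (l i) z)) :=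
      tendsto_finsetProd _ fun i _ =>
        tendsto_blaschkeFactor (hl i).1 (hl i).2.1 hz (hl i).2.2 tendsto_const_nhds
    refine t.congr' ?_
    filter_upwards [Nat.hyperfilter_le_atTop (Filter.eventually_ge_atTop N)] with n hn
    exact (hb n hn z).symm
  refine ⟨?_, fun z hz hBz hd => hBz ?_⟩
  · rw [hBl 0 zero_mem_disk]
    refine Finset.prod_ne_zero_iff.mpr fun i _ => ?_
    have := (hl i).1
    simp [blaschkeFactor, this]
  · obtain ⟨C, hC⟩ := hc z hz
    have h1 := hC.self_of_nhds.2
    rw [hd, norm_zero, mul_zero] at h1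
    obtain ⟨i, -, hi⟩ := Finset.prod_eq_zero_iff.mp (norm_le_zero_iff.mp h1)
    rw [hBl z hz]
    refine Finset.prod_eq_zero (Finset.mem_univ i) ?_
    rw [← sub_eq_zero.mp hi]
    simp [blaschkeFactor]

/-! ### The Geronimus relations -/

/-- The sequence `-1, α_0, α_1, …`. -/
def shiftParam (α : ℕ → ℝ) : ℕ → ℝ
  | 0 => -1
  | n + 1 => α n

/-- The coefficient `c_{n+1}` given by the Geronimus relations. -/
def geronimusC (α : ℕ → ℝ) (n : ℕ) : ℝ :=
  (1 - shiftParam α (2 * n)) * (1 - α (2 * n) ^ 2) * (1 + α (2 * n + 1))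

/-- The coefficient `b_{n+1}` given by the Geronimus relations. -/
def geronimusB (α : ℕ → ℝ) (n : ℕ) : ℝ :=
  (1 - shiftParam α (2 * n)) * α (2 * n) - (1 + shiftParam α (2 * n)) * shiftParam α (2 * n - 1)

/-- The truncated index `2 * 0 - 1 = 0` is harmless, because the factor `1 + shiftParam α 0` in
front is zero. -/
theorem geronimusB_zero (α : ℕ → ℝ) : geronimusB α 0 = 2 * α 0 := by
  change (1 - -1) * α 0 - (1 + -1) * -1 = 2 * α 0
  ring

theorem geronimusB_succ (α : ℕ → ℝ) (n : ℕ) : geronimusB α (n + 1) =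
    (1 - α (2 * n + 1)) * α (2 * n + 2) - (1 + α (2 * n + 1)) * α (2 * n) := rfl

theorem geronimusC_succ (α : ℕ → ℝ) (n : ℕ) : geronimusC α (n + 1) =
    (1 - α (2 * n + 1)) * (1 - α (2 * n + 2) ^ 2) * (1 + α (2 * n + 3)) := rfl

theorem geronimusC_ne_zero {α : ℕ → ℝ} (hα1 : ∀ n, |α n| ≠ 1) (n : ℕ) : geronimusC α n ≠ 0 := by
  have h1 : ∀ n, 1 - α n ≠ 0 := fun n h => hα1 n (by
    rw [← sub_eq_zero.mp h, abs_one])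
  have h2 : ∀ n, 1 + α n ≠ 0 := fun n h => hα1 n (by
    rw [eq_neg_of_add_eq_zero_right h, abs_neg, abs_one])
  have h3 : ∀ n, 1 - α n ^ 2 ≠ 0 := fun n => by
    rw [show 1 - α n ^ 2 = (1 - α n) * (1 + α n) by ring]
    exact mul_ne_zero (h1 n) (h2 n)
  have h4 : ∀ n, 1 - shiftParam α n ≠ 0 := fun n => by
    cases n with
    | zero => norm_num [shiftParam]
    | succ n => exact h1 n
  exact mul_ne_zero (mul_ne_zero (h4 _) (h3 _)) (h2 _)

/-- The image of a solution of the Szegő recurrence under the Szegő mapping. -/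
structure IsSzegoImage {R : Type*} [CommRing R] (z zi : R) (X Y y : ℕ → R) : Prop where
  mul_eq_one : z * zi = 1
  zero : 2 * y 0 = X 0 + Y 0
  succ : ∀ n, y (n + 1) = zi ^ (n + 1) * (z * X (2 * n + 1) + Y (2 * n + 1))

/-- One Szegő step with parameter `a` turns `z X + Y` into `X + Y` times `1 - a`, as `(z X - a Y) +
(Y - a z X) = (1 - a) (z X + Y)`. The convention `α_{-1} = -1` accounts for the factor `2` at `n =
0`. -/
theorem IsSzegoImage.even {R : Type*} [CommRing R] [Algebra ℝ R] {α : ℕ → ℝ} {z zi : R}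
    {X Y y : ℕ → R} (h : IsSzegoImage z zi X Y y)
    (hs : IsSzegoSolution (fun n => algebraMap ℝ R (α n)) z X Y) (n : ℕ) :
    algebraMap ℝ R (1 - shiftParam α (2 * n)) * y n = zi ^ n * (X (2 * n) + Y (2 * n)) := by
  cases n with
  | zero =>
    have h0 := h.zero
    simp only [mul_zero, shiftParam, pow_zero, one_mul]
    rw [← h0, show (1 - -1 : ℝ) = 2 by norm_num, map_ofNat]
  | succ n =>
    rw [h.succ, show 2 * (n + 1) = 2 * n + 1 + 1 by ring, hs.fst (2 * n + 1), hs.snd (2 * n + 1),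
      shiftParam, map_sub, map_one]
    ring

/-- The image of a solution of the Szegő recurrence satisfies the three-term recurrence with the
Geronimus coefficients. -/
theorem IsSzegoImage.recurrence {R : Type*} [CommRing R] [Algebra ℝ R] {α : ℕ → ℝ} {z zi : R}
    {X Y y : ℕ → R} (h : IsSzegoImage z zi X Y y)
    (hs : IsSzegoSolution (fun n => algebraMap ℝ R (α n)) z X Y) (n : ℕ) :
    (z + zi) * y (n + 1) = y (n + 2) + algebraMap ℝ R (geronimusB α (n + 1)) * y (n + 1) +
      algebraMap ℝ R (geronimusC α n) * y n := by
  have h1 := h.even hs n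
  -- The first factor of `c_{n+1}` is absorbed by the even-index form of `y n`. Now every term is
  -- expressed through `X (2 n)` and `Y (2 n)`, including the case `n = 0`.
  have hc : algebraMap ℝ R (geronimusC α n) * y n =
      (1 - algebraMap ℝ R (α (2 * n)) ^ 2) * (1 + algebraMap ℝ R (α (2 * n + 1))) *
        (zi ^ n * (X (2 * n) + Y (2 * n))) := by
    rw [← h1, geronimusC]
    simp only [map_mul, map_sub, map_add, map_pow, map_one]
    ring
  rw [hc, h.succ (n + 1), h.succ n, geronimusB_succ, show 2 * (n + 1) + 1 = 2 * n + 1 + 1 + 1 by ring,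
    hs.fst (2 * n + 1 + 1), hs.snd (2 * n + 1 + 1), hs.fst (2 * n + 1), hs.snd (2 * n + 1),
    hs.fst (2 * n), hs.snd (2 * n), show n + 1 + 1 = n + 2 by ring]
  have hz := h.mul_eq_one
  have e1 : zi ^ (n + 1) = zi ^ (n + 2) * z := by
    rw [pow_succ zi (n + 1), mul_assoc, mul_comm zi z, hz, mul_one]
  have e0 : zi ^ n = zi ^ (n + 2) * z ^ 2 := by
    rw [sq, ← mul_assoc, ← e1, pow_succ, mul_assoc, mul_comm zi z, hz, mul_one]
  rw [e1, e0]
  simp only [map_mul, map_sub, map_add, map_one, show 2 * n + 1 + 1 = 2 * n + 2 by ring]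
  linear_combination zi ^ (n + 2) * (z * (z * X (2 * n) - algebraMap ℝ R (α (2 * n)) * Y (2 * n)) +
    (Y (2 * n) - algebraMap ℝ R (α (2 * n)) * (z * X (2 * n)))) * hz

/-- The boundary equation. Over `ℂ` the right-hand side differs from `(z + z⁻¹) y_0` by `(z - z⁻¹)
(X_0 - Y_0) / 2`, the inhomogeneity that determines the `m`-function. -/
theorem IsSzegoImage.first {R : Type*} [CommRing R] [Algebra ℝ R] {α : ℕ → ℝ} {z zi : R}
    {X Y y : ℕ → R} (h : IsSzegoImage z zi X Y y)
    (hs : IsSzegoSolution (fun n => algebraMap ℝ R (α n)) z X Y) :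
    y 1 + algebraMap ℝ R (geronimusB α 0) * y 0 = z * X 0 + zi * Y 0 := by
  have h1 := h.succ 0
  rw [mul_zero, hs.fst, hs.snd] at h1
  rw [h1, geronimusB_zero, map_mul, map_ofNat]
  linear_combination algebraMap ℝ R (α 0) * h.zero +
    (z * X 0 - algebraMap ℝ R (α 0) * (X 0 + Y 0)) * h.mul_eq_one

/-! ### Orthogonality with respect to `μ` -/

theorem toLaurent_eq_sum {p : ℂ[X]} {n : ℕ} (h : p.natDegree ≤ n) :
    Polynomial.toLaurent p =
      ∑ i ∈ Finset.range (n + 1), p.coeff i • (LaurentPolynomial.T i : ℂ[T;T⁻¹]) := by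
  conv_lhs => rw [p.as_sum_range_C_mul_X_pow' (Nat.lt_succ_of_le h), map_sum]
  refine Finset.sum_congr rfl fun i _ => ?_
  rw [Polynomial.toLaurent_C_mul_X_pow, LaurentPolynomial.smul_eq_C_mul]

theorem mu_T_mul_toLaurent (a : ℕ → ℂ) (k : ℤ) {p : ℂ[X]} {n : ℕ} (h : p.natDegree ≤ n) :
    mu a (LaurentPolynomial.T k * Polynomial.toLaurent p) =
      ∑ i ∈ Finset.range (n + 1), p.coeff i * intMoment a (k + i) := by
  rw [toLaurent_eq_sum h, Finset.mul_sum, map_sum]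
  refine Finset.sum_congr rfl fun i _ => ?_
  rw [mul_smul_comm, map_smul, ← LaurentPolynomial.T_add, mu_T, smul_eq_mul]

theorem mu_toLaurent_Phi (a : ℕ → ℂ) (n : ℕ) :
    mu a (LaurentPolynomial.T 0 * Polynomial.toLaurent (Phi a (n + 1))) = 0 := by
  rw [mu_T_mul_toLaurent a 0 (natDegree_Phi_le a (n + 1)), ← sum_coeff_Phi_mul_moment a n]
  simp [intMoment_natCast]

theorem mu_T_neg_mul_toLaurent_PhiStar (α : ℕ → ℝ) (n : ℕ) :
    mu (cx α) (LaurentPolynomial.T (-(n + 1 : ℕ) : ℤ) *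
      Polynomial.toLaurent (PhiStar (cx α) (n + 1))) = 0 := by
  rw [mu_T_mul_toLaurent _ _ (natDegree_PhiStar_le _ (n + 1)),
    ← sum_coeff_Phi_mul_moment (cx α) n, ← Finset.sum_range_reflect]
  refine Finset.sum_congr rfl fun i hi => ?_
  have hi := Finset.mem_range.mp hi
  rw [coeff_PhiStar_of_le' α (by omega), intMoment_eq]
  congr 2 <;> omega

/-- The recurrence carries the orthogonality relations over except at one new index each: `j = 0`
for `Φ_{m+1}`, which is the definition of the moment, and `j = m + 1` for `Φ_{m+1}^*`, which is its
reflection by the evenness of the moments. -/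
theorem mu_orthogonality (α : ℕ → ℝ) (m : ℕ) :
    (∀ j : ℕ, j < m → mu (cx α) (LaurentPolynomial.T (-(j : ℤ)) *
        Polynomial.toLaurent (Phi (cx α) m)) = 0) ∧
      ∀ j : ℕ, 1 ≤ j → j ≤ m → mu (cx α) (LaurentPolynomial.T (-(j : ℤ)) *
        Polynomial.toLaurent (PhiStar (cx α) m)) = 0 := by
  induction m with
  | zero => exact ⟨fun j hj => absurd hj (by omega), fun j h1 h2 => by omega⟩
  | succ m ih =>
    have hT : ∀ j : ℕ, ∀ q : ℂ[T;T⁻¹], LaurentPolynomial.T (-((j + 1 : ℕ) : ℤ)) *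
        (LaurentPolynomial.T 1 * q) = LaurentPolynomial.T (-(j : ℤ)) * q := fun j q => by
      rw [← mul_assoc, ← LaurentPolynomial.T_add]
      congr 2
      push_cast
      ring
    have e1 : Polynomial.toLaurent (Phi (cx α) (m + 1)) =
        LaurentPolynomial.T 1 * Polynomial.toLaurent (Phi (cx α) m) -
          cx α m • Polynomial.toLaurent (PhiStar (cx α) m) := by
      rw [(isSzegoSolution_Phi α).fst, map_sub, map_mul, map_mul, Polynomial.toLaurent_X,
        Polynomial.toLaurent_C, LaurentPolynomial.smul_eq_C_mul]
    have e2 : Polynomial.toLaurent (PhiStar (cx α) (m + 1)) =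
        Polynomial.toLaurent (PhiStar (cx α) m) -
          cx α m • (LaurentPolynomial.T 1 * Polynomial.toLaurent (Phi (cx α) m)) := by
      rw [(isSzegoSolution_Phi α).snd, map_sub, map_mul, map_mul, Polynomial.toLaurent_X,
        Polynomial.toLaurent_C, LaurentPolynomial.smul_eq_C_mul]
    refine ⟨fun j hj => ?_, fun j h1 h2 => ?_⟩
    · rcases j with _ | j
      · simpa using mu_toLaurent_Phi (cx α) m
      · rw [e1, mul_sub, hT, mul_smul_comm, map_sub, map_smul, ih.1 j (by omega), ih.2 (j + 1) (by omega) (by omega)]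
        simp
    · obtain ⟨j, rfl⟩ : ∃ i, j = i + 1 := ⟨j - 1, by omega⟩
      rcases Nat.lt_or_ge j m with hj | hj
      · rw [e2, mul_sub, mul_smul_comm, hT, map_sub, map_smul, ih.1 j (by omega), ih.2 (j + 1) (by omega) (by omega)]
        simp
      · obtain rfl : j = m := by omega
        exact mu_T_neg_mul_toLaurent_PhiStar α j

/-! ### The orthogonal polynomials of `γ` -/

/-- The monic polynomials with given recurrence coefficients. -/
def recPoly (b c : ℕ → ℝ) : ℕ → ℂ[X]
  | 0 => 1
  | 1 => Polynomial.X - Polynomial.C (b 1 : ℂ)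
  | n + 2 => (Polynomial.X - Polynomial.C (b (n + 2) : ℂ)) * recPoly b c (n + 1) -
      Polynomial.C (c (n + 1) : ℂ) * recPoly b c n

theorem isRecurrence_recPoly (b c : ℕ → ℝ) : IsRecurrence (recPoly b c) b c where
  zero := by simp [recPoly]
  succ n := by rw [recPoly]; ring

theorem IsRecurrence.natDegree_and_monic {P : ℕ → ℂ[X]} {b c : ℕ → ℝ} (h : IsRecurrence P b c)
    (h0 : P 0 = 1) (n : ℕ) : ((P n).natDegree = n ∧ (P n).Monic) ∧
      ((P (n + 1)).natDegree = n + 1 ∧ (P (n + 1)).Monic) := by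
  induction n with
  | zero =>
    have h1 : P 1 = Polynomial.X - Polynomial.C (b 1 : ℂ) := by
      have := h.zero
      rw [h0] at this
      linear_combination -this
    rw [h0, zero_add, h1]
    exact ⟨⟨Polynomial.natDegree_one, Polynomial.monic_one⟩, Polynomial.natDegree_X_sub_C _,
      Polynomial.monic_X_sub_C _⟩
  | succ n ih =>
    refine ⟨ih.2, ?_⟩
    have h1 : P (n + 2) = (Polynomial.X - Polynomial.C (b (n + 2) : ℂ)) * P (n + 1) -
        Polynomial.C (c (n + 1) : ℂ) * P n := by linear_combination -h.succ n
    have hm := (Polynomial.monic_X_sub_C (b (n + 2) : ℂ)).mul ih.2.2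
    have hd : ((Polynomial.X - Polynomial.C (b (n + 2) : ℂ)) * P (n + 1)).natDegree = n + 2 := by
      rw [(Polynomial.monic_X_sub_C _).natDegree_mul ih.2.2, Polynomial.natDegree_X_sub_C, ih.2.1]
      ring
    have hlt : (Polynomial.C (c (n + 1) : ℂ) * P n).degree <
        ((Polynomial.X - Polynomial.C (b (n + 2) : ℂ)) * P (n + 1)).degree := by
      refine Polynomial.degree_lt_degree ?_
      rw [hd]
      exact (Polynomial.natDegree_C_mul_le _ _).trans_lt (by rw [ih.1.1]; omega)
    rw [show n + 1 + 1 = n + 2 by ring, h1]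
    exact ⟨by rw [Polynomial.natDegree_sub_eq_left_of_natDegree_lt
      (by rw [hd]; exact (Polynomial.natDegree_C_mul_le _ _).trans_lt (by rw [ih.1.1]; omega)), hd],
      hm.sub_of_left hlt⟩

/-- Favard's theorem: the polynomials of a three-term recurrence annihilated by `L` are orthogonal. -/
theorem IsRecurrence.pairing {P : ℕ → ℂ[X]} {b c : ℕ → ℝ} (h : IsRecurrence P b c)
    {L : ℂ[X] →ₗ[ℂ] ℂ} (h0 : L (P 0) = 1) (hL : ∀ n, L (P (n + 1)) = 0) (k : ℕ) :
    (∀ n, k < n → L (Polynomial.X ^ k * P n) = 0) ∧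
      L (Polynomial.X ^ k * P k) = ∏ i ∈ Finset.range k, (c (i + 1) : ℂ) := by
  induction k with
  | zero =>
    refine ⟨fun n hn => ?_, by simpa using h0⟩
    obtain ⟨n, rfl⟩ : ∃ m, n = m + 1 := ⟨n - 1, by omega⟩
    simpa using hL n
  | succ k ih =>
    have key : ∀ n, L (Polynomial.X ^ (k + 1) * P (n + 1)) = L (Polynomial.X ^ k * P (n + 2)) +
        b (n + 2) * L (Polynomial.X ^ k * P (n + 1)) + c (n + 1) * L (Polynomial.X ^ k * P n) := by
      intro n
      have h1 : Polynomial.X ^ (k + 1) * P (n + 1) = Polynomial.X ^ k * P (n + 2) +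
          (b (n + 2) : ℂ) • (Polynomial.X ^ k * P (n + 1)) +
            (c (n + 1) : ℂ) • (Polynomial.X ^ k * P n) := by
        rw [Polynomial.smul_eq_C_mul, Polynomial.smul_eq_C_mul]
        linear_combination Polynomial.X ^ k * h.succ n
      rw [h1, map_add, map_add, map_smul, map_smul, smul_eq_mul, smul_eq_mul]
    refine ⟨fun n hn => ?_, ?_⟩
    · obtain ⟨n, rfl⟩ : ∃ m, n = m + 1 := ⟨n - 1, by omega⟩
      rw [key, ih.1 _ (by omega), ih.1 _ (by omega), ih.1 _ (by omega)]
      simp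
    · rw [key, ih.1 _ (by omega), ih.1 _ (by omega), ih.2, Finset.prod_range_succ]
      ring

theorem IsRecurrence.isMonicOrthogonal {P : ℕ → ℂ[X]} {b c : ℕ → ℝ} (h : IsRecurrence P b c)
    {L : ℂ[X] →ₗ[ℂ] ℂ} (hP : P 0 = 1) (h0 : L 1 = 1) (hL : ∀ n, L (P (n + 1)) = 0)
    (hc : ∀ n, c (n + 1) ≠ 0) : IsMonicOrthogonal L P where
  monic n := (h.natDegree_and_monic hP n).1.2
  natDegree n := (h.natDegree_and_monic hP n).1.1
  orthogonal n k hk := (h.pairing (by rwa [hP]) hL k).1 n hk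
  ne_zero n := by
    rw [(h.pairing (by rwa [hP]) hL n).2]
    exact Finset.prod_ne_zero_iff.mpr fun i _ => Complex.ofReal_ne_zero.mpr (hc i)

theorem IsMonicOrthogonal.pairing_mul {L : ℂ[X] →ₗ[ℂ] ℂ} {P : ℕ → ℂ[X]}
    (h : IsMonicOrthogonal L P) (n : ℕ) {q : ℂ[X]} (hq : q.natDegree ≤ n) :
    L (q * P n) = q.coeff n * L (Polynomial.X ^ n * P n) := by
  conv_lhs => rw [q.as_sum_range_C_mul_X_pow' (Nat.lt_succ_of_le hq), Finset.sum_mul, map_sum]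
  rw [Finset.sum_range_succ, Finset.sum_eq_zero fun k hk => ?_, zero_add, mul_assoc,
    ← Polynomial.smul_eq_C_mul, map_smul, smul_eq_mul]
  rw [mul_assoc, ← Polynomial.smul_eq_C_mul, map_smul, h.orthogonal n k (Finset.mem_range.mp hk),
    smul_zero]

/-- If `d = P n - Q n` is nonzero of degree `m < n`, then `L (d * P m)` vanishes by orthogonality of
`P n` and `Q n` to degree `m`, yet equals the leading coefficient of `d` times a nonzero number. -/
theorem IsMonicOrthogonal.eq {L : ℂ[X] →ₗ[ℂ] ℂ} {P Q : ℕ → ℂ[X]}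
    (h : IsMonicOrthogonal L P) (h' : IsMonicOrthogonal L Q) : P = Q := by
  funext n
  by_contra hne
  set d := P n - Q n with hd
  have hd0 : d ≠ 0 := sub_ne_zero.mpr hne
  have hdeg : d.natDegree < n := by
    rcases Nat.eq_zero_or_pos n with rfl | hn
    · exfalso
      have h1 := Polynomial.eq_one_of_monic_natDegree_zero (h.monic 0) (h.natDegree 0)
      have h2 := Polynomial.eq_one_of_monic_natDegree_zero (h'.monic 0) (h'.natDegree 0)
      exact hne (h1.trans h2.symm)
    · refine lt_of_le_of_ne ((Polynomial.natDegree_sub_le _ _).trans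
        (by rw [h.natDegree, h'.natDegree, max_self])) fun he => hd0 ?_
      rw [← Polynomial.leadingCoeff_eq_zero, Polynomial.leadingCoeff, he, hd,
        Polynomial.coeff_sub]
      have h1 := (h.monic n).coeff_natDegree
      have h2 := (h'.monic n).coeff_natDegree
      rw [h.natDegree] at h1
      rw [h'.natDegree] at h2
      rw [h1, h2, sub_self]
  set m := d.natDegree
  have h1 := h.pairing_mul m (q := d) le_rfl
  have h2 : L (d * P m) = 0 := by
    rw [hd, sub_mul, map_sub, mul_comm (P n), mul_comm (Q n), h.pairing_mul n, h'.pairing_mul n,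
      Polynomial.coeff_eq_zero_of_natDegree_lt] <;> simp [h.natDegree, hdeg, hdeg.le]
  rw [h2] at h1
  exact mul_ne_zero (Polynomial.leadingCoeff_ne_zero.mpr hd0) (h.ne_zero m) h1.symm

theorem IsRecurrence.eq_coeffs {P : ℕ → ℂ[X]} {b c b' c' : ℕ → ℝ} (h : IsRecurrence P b c)
    (h' : IsRecurrence P b' c') (hP : P 0 = 1) (n : ℕ) :
    b (n + 1) = b' (n + 1) ∧ c (n + 1) = c' (n + 1) := by
  have hco : ∀ n, (P n).coeff n = 1 := fun n => by
    have h1 := (h.natDegree_and_monic hP n).1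
    have h2 := h1.2.coeff_natDegree
    rwa [h1.1] at h2
  have hb : ∀ n, b (n + 1) = b' (n + 1) := fun n => by
    rcases n with _ | n
    · have h1 : Polynomial.C (b 1 : ℂ) * P 0 = Polynomial.C (b' 1 : ℂ) * P 0 := by
        linear_combination h'.zero - h.zero
      have h2 := congrArg (fun p => p.coeff 0) h1
      simp only [Polynomial.coeff_C_mul, hco, mul_one] at h2
      exact_mod_cast h2
    · have h1 : Polynomial.C (b (n + 2) : ℂ) * P (n + 1) + Polynomial.C (c (n + 1) : ℂ) * P n =
          Polynomial.C (b' (n + 2) : ℂ) * P (n + 1) + Polynomial.C (c' (n + 1) : ℂ) * P n := by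
        linear_combination h'.succ n - h.succ n
      have h2 := congrArg (fun p => p.coeff (n + 1)) h1
      have h3 : (P n).coeff (n + 1) = 0 := Polynomial.coeff_eq_zero_of_natDegree_lt (by
        rw [(h.natDegree_and_monic hP n).1.1]; omega)
      simp only [Polynomial.coeff_add, Polynomial.coeff_C_mul, hco, mul_one, h3, mul_zero,
        add_zero] at h2
      exact_mod_cast h2
  refine ⟨hb n, ?_⟩
  have h1 : Polynomial.C (c (n + 1) : ℂ) * P n = Polynomial.C (c' (n + 1) : ℂ) * P n := by
    have := hb (n + 1)
    have h2 := h.succ n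
    rw [this] at h2
    linear_combination h'.succ n - h2
  have h2 := congrArg (fun p => p.coeff n) h1
  simp only [Polynomial.coeff_C_mul, hco, mul_one] at h2
  exact_mod_cast h2

/-- The Geronimus coefficients `b_1, b_2, …` (with an unused value at `0`). -/
def lineB (α : ℕ → ℝ) (n : ℕ) : ℝ := geronimusB α (n - 1)

/-- The Geronimus coefficients `c_1, c_2, …` (with an unused value at `0`). -/
def lineC (α : ℕ → ℝ) (n : ℕ) : ℝ := geronimusC α (n - 1)

/-- Under `x = w + w⁻¹` the polynomial becomes the Szegő image of `(Φ, Φ^*)`, that is `w ^ (-n)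
Φ_{2n+1} + w ^ (-(n+1)) Φ_{2n+1}^*`; both terms are annihilated by `μ`. -/
theorem gam_recPoly (α : ℕ → ℝ) (n : ℕ) :
    gam (cx α) (recPoly (lineB α) (lineC α) (n + 1)) = 0 := by
  set x : ℂ[T;T⁻¹] := LaurentPolynomial.T 1 + LaurentPolynomial.T (-1) with hx
  set X : ℕ → ℂ[T;T⁻¹] := fun n => Polynomial.toLaurent (Phi (cx α) n)
  set Y : ℕ → ℂ[T;T⁻¹] := fun n => Polynomial.toLaurent (PhiStar (cx α) n)
  set y : ℕ → ℂ[T;T⁻¹] := fun n => Nat.casesOn n 1 fun n =>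
    LaurentPolynomial.T (-1) ^ (n + 1) * (LaurentPolynomial.T 1 * X (2 * n + 1) + Y (2 * n + 1))
  have hs : IsSzegoSolution (fun n => algebraMap ℝ ℂ[T;T⁻¹] (α n)) (LaurentPolynomial.T 1) X Y := by
    have h := (isSzegoSolution_Phi α).map (Polynomial.toLaurent (R := ℂ))
    simp only [Polynomial.toLaurent_X, Polynomial.toLaurent_C] at h
    exact h
  have hy : IsSzegoImage (LaurentPolynomial.T 1) (LaurentPolynomial.T (-1)) X Y y := by
    refine ⟨?_, ?_, fun n => rfl⟩
    · rw [← LaurentPolynomial.T_add]; simp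
    · simp only [X, Y, y, Phi, PhiStar_zero, map_one]; norm_num
  have hev : ∀ n, Polynomial.aeval x (recPoly (lineB α) (lineC α) n) = y n ∧
      Polynomial.aeval x (recPoly (lineB α) (lineC α) (n + 1)) = y (n + 1) := by
    intro n
    induction n with
    | zero =>
      refine ⟨by simp [recPoly, y], ?_⟩
      have h1 := hy.first hs
      simp only [X, Y, Phi, PhiStar_zero, map_one, mul_one] at h1
      rw [show y 0 = 1 from rfl, mul_one] at h1
      rw [zero_add, recPoly, map_sub, Polynomial.aeval_X, Polynomial.aeval_C, hx, ← h1]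
      simp only [lineB, Nat.sub_self]
      exact add_sub_cancel_right _ _
    | succ n ih =>
      refine ⟨ih.2, ?_⟩
      have h1 := hy.recurrence hs n
      rw [recPoly, map_sub, map_mul, map_mul, ih.1, ih.2, map_sub, Polynomial.aeval_X,
        Polynomial.aeval_C, Polynomial.aeval_C, sub_mul, hx, h1]
      simp only [lineB, lineC, Nat.add_sub_cancel, show n + 2 - 1 = n + 1 by omega]
      rw [sub_sub, sub_eq_iff_eq_add, ← add_assoc]
      rfl
  change mu (cx α) (Polynomial.aeval x (recPoly (lineB α) (lineC α) (n + 1))) = 0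
  rw [(hev n).2]
  change mu (cx α) (LaurentPolynomial.T (-1) ^ (n + 1) *
    (LaurentPolynomial.T 1 * X (2 * n + 1) + Y (2 * n + 1))) = 0
  have h := mu_orthogonality α (2 * n + 1)
  rw [LaurentPolynomial.T_pow, mul_add, ← mul_assoc, ← LaurentPolynomial.T_add, map_add]
  have h1 := h.1 n (by omega)
  have h2 := h.2 (n + 1) (by omega) (by omega)
  rw [show ((n + 1 : ℕ) : ℤ) * -1 + 1 = -(n : ℤ) by push_cast; ring,
    show ((n + 1 : ℕ) : ℤ) * -1 = -((n + 1 : ℕ) : ℤ) by ring, h1, h2, add_zero]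

theorem gam_one (a : ℕ → ℂ) : gam a 1 = 1 := by
  change mu a (Polynomial.aeval _ 1) = 1
  rw [map_one, ← LaurentPolynomial.T_zero, mu_T]
  simp [intMoment, moment_zero]

theorem isMonicOrthogonal_recPoly {α : ℕ → ℝ} (hα1 : ∀ n, |α n| ≠ 1) :
    IsMonicOrthogonal (gam (cx α)) (recPoly (lineB α) (lineC α)) :=
  (isRecurrence_recPoly _ _).isMonicOrthogonal (by rw [recPoly]) (gam_one _) (gam_recPoly α)
    fun n => geronimusC_ne_zero hα1 n

theorem IsRecurrence.eq_geronimus {α : ℕ → ℝ} (hα1 : ∀ n, |α n| ≠ 1) {P : ℕ → ℂ[X]}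
    {b c : ℕ → ℝ} (hP : IsMonicOrthogonal (gam (cx α)) P) (h : IsRecurrence P b c) (n : ℕ) :
    b (n + 1) = geronimusB α n ∧ c (n + 1) = geronimusC α n := by
  rw [hP.eq (isMonicOrthogonal_recPoly hα1)] at h
  exact h.eq_coeffs (isRecurrence_recPoly _ _) (by rw [recPoly]) n

/-! ### Tridiagonal operators on `ℓ²` -/

theorem basisVec_apply (i j : ℕ) : basisVec j i = if i = j then 1 else 0 := by
  rw [basisVec, lp.single_apply, Pi.single_apply]

/-- Weighted composition operators `x ↦ (a_i x_{σ(i)})` on `ℓ²`. -/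
theorem exists_weighted_comp {a : ℕ → ℝ} {C : ℝ} (ha : ∀ i, |a i| ≤ C) {σ : ℕ → ℕ}
    (hσ : Set.InjOn σ {i | a i ≠ 0}) :
    ∃ W : ell2 →L[ℂ] ell2, ∀ x i, W x i = a i * x (σ i) := by
  have hC : 0 ≤ C := (abs_nonneg _).trans (ha 0)
  have key : ∀ (x : ell2) (s : Finset ℕ),
      ∑ i ∈ s, ‖(a i : ℂ) * x (σ i)‖ ^ (2 : ENNReal).toReal ≤ (C * ‖x‖) ^ (2 : ENNReal).toReal := by
    intro x s
    simp only [ENNReal.toReal_ofNat, Real.rpow_ofNat]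
    have h1 := lp.sum_rpow_le_norm_rpow (p := 2) (by simp) x
      ((s.filter fun i => a i ≠ 0).image σ)
    simp only [ENNReal.toReal_ofNat, Real.rpow_ofNat] at h1
    rw [Finset.sum_image (hσ.mono (by intro i; simp))] at h1
    calc ∑ i ∈ s, ‖(a i : ℂ) * x (σ i)‖ ^ 2
        = ∑ i ∈ s with a i ≠ 0, ‖(a i : ℂ) * x (σ i)‖ ^ 2 := by
          refine (Finset.sum_filter_of_ne ?_).symm
          intro i _ h h0
          simp [h0] at h
      _ ≤ ∑ i ∈ s with a i ≠ 0, C ^ 2 * ‖x (σ i)‖ ^ 2 := by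
          refine Finset.sum_le_sum fun i _ => ?_
          rw [norm_mul, mul_pow, Complex.norm_real, Real.norm_eq_abs]
          gcongr
          exact ha i
      _ ≤ (C * ‖x‖) ^ 2 := by
          rw [← Finset.mul_sum, mul_pow]
          gcongr
  let L : ell2 →ₗ[ℂ] ell2 :=
    { toFun x := ⟨fun i => a i * x (σ i), memℓp_gen' (key x)⟩
      map_add' x y := by
        ext i
        exact mul_add _ _ _
      map_smul' r x := by
        ext i
        simp [mul_left_comm] }
  exact ⟨L.mkContinuous C fun x =>
    lp.norm_le_of_forall_sum_le (by simp) (by positivity) (key x), fun _ _ => rfl⟩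

/-- `A` is the operator with the tridiagonal matrix whose diagonal, superdiagonal and subdiagonal
are `d`, `u` and `l`. -/
structure IsTridiagonal (A : ell2 →L[ℂ] ell2) (d u l : ℕ → ℝ) : Prop where
  zero : ∀ x, A x 0 = d 0 * x 0 + u 0 * x 1
  succ : ∀ x n, A x (n + 1) = l n * x n + d (n + 1) * x (n + 1) + u (n + 1) * x (n + 2)

theorem exists_isTridiagonal {d u l : ℕ → ℝ} {C : ℝ} (hd : ∀ n, |d n| ≤ C) (hu : ∀ n, |u n| ≤ C)
    (hl : ∀ n, |l n| ≤ C) : ∃ A, IsTridiagonal A d u l := by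
  obtain ⟨D, hD⟩ := exists_weighted_comp hd (σ := id) (Set.injOn_id _)
  obtain ⟨U, hU⟩ := exists_weighted_comp hu (σ := (· + 1)) (fun i _ j _ h => by simpa using h)
  -- The zero weight at `0` excludes the one index where the truncated predecessor fails to be
  -- injective.
  obtain ⟨L, hL⟩ := exists_weighted_comp (a := fun n => if n = 0 then 0 else l (n - 1)) (C := C)
    (by
      intro n
      split_ifs
      · simpa using (abs_nonneg _).trans (hd 0)
      · exact hl _) (σ := (· - 1)) (by
      intro i hi j hj h
      have hi0 : i ≠ 0 := by rintro rfl; simp at hi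
      have hj0 : j ≠ 0 := by rintro rfl; simp at hj
      simp only at h
      omega)
  refine ⟨L + D + U, ⟨fun x => ?_, fun x n => ?_⟩⟩
  · simp [hD, hU, hL]
  · simp [hD, hU, hL]

theorem IsTridiagonal.affine {A : ell2 →L[ℂ] ell2} {d u l : ℕ → ℝ} (h : IsTridiagonal A d u l)
    (r s : ℝ) : IsTridiagonal (algebraMap ℂ (ell2 →L[ℂ] ell2) r + (s : ℂ) • A)
      (fun n => r + s * d n) (fun n => s * u n) (fun n => s * l n) := by
  have key : ∀ x n, (algebraMap ℂ (ell2 →L[ℂ] ell2) r + (s : ℂ) • A) x n =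
      r * x n + s * A x n := by
    intro x n
    rw [Algebra.algebraMap_eq_smul_one]
    rfl
  refine ⟨fun x => ?_, fun x n => ?_⟩
  · rw [key, h.zero]
    push_cast
    ring
  · rw [key, h.succ]
    push_cast
    ring

theorem IsTridiagonal.unique {A A' : ell2 →L[ℂ] ell2} {d u l : ℕ → ℝ}
    (h : IsTridiagonal A d u l) (h' : IsTridiagonal A' d u l) : A = A' := by
  ext x n
  cases n with
  | zero => rw [h.zero, h'.zero]
  | succ n => rw [h.succ, h'.succ]

theorem clm_ext_basisVec {φ ψ : ell2 →L[ℂ] ℂ} (h : ∀ j, φ (basisVec j) = ψ (basisVec j)) :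
    φ = ψ := by
  refine lp.ext_continuousLinearMap (p := 2) (by simp) fun j => ?_
  ext
  simpa [basisVec] using h j

theorem HasMatrix.isTridiagonal {H : ell2 →L[ℂ] ell2} {b c : ℕ → ℝ} (hH : HasMatrix H (jacobi b c)) :
    IsTridiagonal H (fun n => b (n + 1)) (fun n => √|c (n + 1)|)
      (fun n => c (n + 1) / √|c (n + 1)|) := by
  let ev : ℕ → ell2 →L[ℂ] ℂ := fun i => lp.evalCLM ℂ (fun _ : ℕ => ℂ) 2 i
  have hev : ∀ i x, ev i x = x i := fun i x => rfl
  constructor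
  · intro x
    have : (ev 0).comp H = ((b 1 : ℝ) : ℂ) • ev 0 + ((√|c 1| : ℝ) : ℂ) • ev 1 := by
      refine clm_ext_basisVec fun j => ?_
      have := hH 0 j
      simp only [ContinuousLinearMap.comp_apply, hev, this, _root_.add_apply,
        _root_.smul_apply, basisVec_apply, jacobi]
      rcases j with _ | _ | j <;> simp
    simpa [hev] using congrArg (fun φ => φ x) this
  · intro x n
    have : (ev (n + 1)).comp H = ((c (n + 1) / √|c (n + 1)| : ℝ) : ℂ) • ev n
        + ((b (n + 2) : ℝ) : ℂ) • ev (n + 1) + ((√|c (n + 2)| : ℝ) : ℂ) • ev (n + 2) := by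
      refine clm_ext_basisVec fun j => ?_
      have := hH (n + 1) j
      simp only [ContinuousLinearMap.comp_apply, hev, this, _root_.add_apply,
        _root_.smul_apply, basisVec_apply, jacobi]
      rcases eq_or_ne j n with rfl | h1
      · simp [show j ≠ j + 1 + 1 by omega]
      rcases eq_or_ne j (n + 1) with rfl | h2
      · simp
      rcases eq_or_ne j (n + 2) with rfl | h3
      · simp
      · simp [h3, h1.symm, h2.symm, h3.symm]
    simpa [hev] using congrArg (fun φ => φ x) this

theorem IsTridiagonal.hasMatrix {H : ell2 →L[ℂ] ell2} {b c : ℕ → ℝ}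
    (h : IsTridiagonal H (fun n => b (n + 1)) (fun n => √|c (n + 1)|)
      (fun n => c (n + 1) / √|c (n + 1)|)) : HasMatrix H (jacobi b c) := by
  intro i j
  rcases i with _ | n
  · rw [h.zero]
    simp only [basisVec_apply, jacobi]
    rcases j with _ | _ | j <;> simp
  · rw [h.succ]
    simp only [basisVec_apply, jacobi]
    rcases eq_or_ne j n with rfl | h1
    · simp [show j ≠ j + 1 + 1 by omega]
    rcases eq_or_ne j (n + 1) with rfl | h2
    · simp
    rcases eq_or_ne j (n + 2) with rfl | h3
    · simp
    · simp [h3, h1.symm, h2.symm, h3.symm]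

/-- A tridiagonal matrix factors as `L* L` with bidiagonal `L`. -/
theorem exists_star_mul_self_isTridiagonal {p q : ℕ → ℝ} {C : ℝ} (hp : ∀ n, |p n| ≤ C)
    (hq : ∀ n, |q n| ≤ C) :
    ∃ L : ell2 →L[ℂ] ell2, IsTridiagonal (star L * L)
      (fun n => p n ^ 2 + if n = 0 then 0 else q (n - 1) ^ 2) (fun n => p n * q n)
      (fun n => p n * q n) := by
  have hC : 0 ≤ C := (abs_nonneg _).trans (hp 0)
  obtain ⟨L, hL⟩ := exists_isTridiagonal hp hq (l := 0) (C := C) (by simpa using hC)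
  have hLr : ∀ x n, L x n = p n * x n + q n * x (n + 1) := by
    intro x n
    cases n with
    | zero => exact hL.zero x
    | succ n => simp [hL.succ x n]
  have hinner : ∀ (x : ell2) i, (star L) x i = inner ℂ (L (basisVec i)) x := by
    intro x i
    rw [ContinuousLinearMap.star_eq_adjoint, ← ContinuousLinearMap.adjoint_inner_right, basisVec,
      lp.inner_single_left]
    simp
  have h0 : L (basisVec 0) = (p 0 : ℂ) • basisVec 0 := by
    ext n
    rw [hLr]
    simp only [lp.coeFn_smul, Pi.smul_apply, basisVec_apply, smul_eq_mul]
    rcases n with _ | n <;> simp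
  have h1 : ∀ i, L (basisVec (i + 1)) = (p (i + 1) : ℂ) • basisVec (i + 1)
      + (q i : ℂ) • basisVec i := by
    intro i
    ext n
    rw [hLr]
    simp only [lp.coeFn_add, lp.coeFn_smul, Pi.add_apply, Pi.smul_apply, basisVec_apply,
      smul_eq_mul]
    rcases eq_or_ne n i with rfl | h1
    · simp
    rcases eq_or_ne n (i + 1) with rfl | h2
    · simp
    · simp [h1, h2]
  have hb : ∀ i (x : ell2), inner ℂ (basisVec i) x = x i := by
    intro i x
    rw [basisVec, lp.inner_single_left]
    simp
  refine ⟨L, ⟨fun x => ?_, fun x n => ?_⟩⟩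
  · rw [mul_apply_eq_comp, hinner, h0, inner_smul_left, hb, hLr]
    simp
    ring
  · rw [mul_apply_eq_comp, hinner, h1, inner_add_left, inner_smul_left,
      inner_smul_left, hb, hb, hLr, hLr]
    simp
    ring

/-! ### Spectra -/

theorem isCompactOperator_of_finite_rows {K : ell2 →L[ℂ] ell2} {m : ℕ}
    (h : ∀ x i, m ≤ i → K x i = 0) : IsCompactOperator K := by
  have hs : ∀ s : Finset ℕ, IsCompactOperator
      (∑ i ∈ s, ((lp.evalCLM ℂ (fun _ : ℕ => ℂ) 2 i).comp K).smulRight (basisVec i)) := by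
    intro s
    induction s using Finset.induction_on with
    | empty => simpa using isCompactOperator_zero
    | insert i s hi ih =>
      rw [Finset.sum_insert hi]
      refine IsCompactOperator.add ?_ ih
      exact (isCompactOperator_of_locallyCompactSpace_dom
        ((lp.evalCLM ℂ (fun _ : ℕ => ℂ) 2 i).comp K)).clm_comp
        ((1 : ℂ →L[ℂ] ℂ).smulRight (basisVec i))
  convert hs (Finset.range m) using 1
  ext x n
  rw [Finset.sum_apply, lp.coeFn_sum, Finset.sum_apply]
  simp only [ContinuousLinearMap.smulRight_apply, lp.coeFn_smul, Pi.smul_apply, basisVec_apply, smul_eq_mul, mul_ite, mul_one, mul_zero,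
    Finset.sum_ite_eq, Finset.mem_range]
  split_ifs with hn
  · rfl
  · exact h x n (not_lt.mp hn)

/-- Injectivity suffices for membership in the resolvent set off the spectrum of a compact
perturbation. -/
theorem mem_resolventSet_of_isCompactOperator_sub {H T : ell2 →L[ℂ] ell2} {l : ℂ}
    (hK : IsCompactOperator (H - T)) (hl : l ∈ resolventSet ℂ T)
    (hinj : ∀ x, H x = l • x → x = 0) : l ∈ resolventSet ℂ H := by
  rw [spectrum.mem_resolventSet_iff] at hl ⊢
  obtain ⟨S, hS⟩ := hl
  have hRK : IsCompactOperator (((S⁻¹ : (ell2 →L[ℂ] ell2)ˣ) : ell2 →L[ℂ] ell2) * (H - T)) :=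
    hK.clm_comp _
  -- `l - H = (l - T) (1 - (l - T)⁻¹ (H - T))`; the Fredholm alternative applies to the compact
  -- operator at the value `1`.
  have hfac : algebraMap ℂ (ell2 →L[ℂ] ell2) l - H =
      S * (algebraMap ℂ (ell2 →L[ℂ] ell2) 1 -
        ((S⁻¹ : (ell2 →L[ℂ] ell2)ˣ) : ell2 →L[ℂ] ell2) * (H - T)) := by
    rw [mul_sub, ← mul_assoc, Units.mul_inv, one_mul, map_one, mul_one, hS]
    abel
  rcases hRK.hasEigenvalue_or_mem_resolventSet one_ne_zero with he | hr
  · exfalso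
    obtain ⟨x, hx⟩ := he.exists_hasEigenvector
    refine hx.2 (hinj x ?_)
    have h1 := hx.apply_eq_smul
    simp only [ContinuousLinearMap.coe_coe, one_smul] at h1
    have h2 : (algebraMap ℂ (ell2 →L[ℂ] ell2) l - H) x = 0 := by
      rw [hfac, mul_apply_eq_comp, _root_.sub_apply, h1, map_one]
      simp
    rw [_root_.sub_apply, sub_eq_zero, Algebra.algebraMap_eq_smul_one] at h2
    simpa using h2.symm
  · rw [hfac]
    exact S.isUnit.mul (spectrum.mem_resolventSet_iff.mp hr)

theorem abs_shiftParam_le {α : ℕ → ℝ} (hα : ∀ n, |α n| ≤ 1) (n : ℕ) : |shiftParam α n| ≤ 1 := by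
  cases n with
  | zero => simp [shiftParam]
  | succ n => exact hα n

/-- The spectrum of the tridiagonal operator with Geronimus coefficients of a positive measure lies
in `[-2, 2]`. -/
theorem mem_Icc_of_mem_spectrum {α : ℕ → ℝ} (hα : ∀ n, |α n| ≤ 1) {T : ell2 →L[ℂ] ell2}
    (hT : IsTridiagonal T (geronimusB α) (fun n => √(geronimusC α n)) (fun n => √(geronimusC α n)))
    {l : ℂ} (hl : l ∈ spectrum ℂ T) : ∃ x ∈ Set.Icc (-2 : ℝ) 2, l = x := by
  have h1 : ∀ n, 0 ≤ 1 - α n := fun n => by linarith [(abs_le.mp (hα n)).2]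
  have h2 : ∀ n, 0 ≤ 1 + α n := fun n => by linarith [(abs_le.mp (hα n)).1]
  have h3 : ∀ n, 0 ≤ 1 - shiftParam α n := fun n => by
    linarith [(abs_le.mp (abs_shiftParam_le hα n)).2]
  have hb : ∀ {x y : ℝ}, 0 ≤ x → x ≤ 2 → 0 ≤ y → y ≤ 2 → |√(x * y)| ≤ 2 := by
    intro x y hx hx2 hy hy2
    rw [abs_of_nonneg (Real.sqrt_nonneg _), Real.sqrt_le_left (by norm_num)]
    nlinarith
  have h1' : ∀ n, 1 - α n ≤ 2 := fun n => by linarith [h2 n]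
  have h2' : ∀ n, 1 + α n ≤ 2 := fun n => by linarith [h1 n]
  have h3' : ∀ n, 1 - shiftParam α n ≤ 2 := fun n => by
    linarith [(abs_le.mp (abs_shiftParam_le hα n)).1]
  -- The entries are chosen so that `p n * q n` is the square root of the Geronimus `c` and the
  -- diagonal of `L* L` is `2 + b`: hence `2 + T = L* L`. With `α_{2n}` replaced by `-α_{2n}` and a
  -- sign in `q`, the same gives `2 - T = M* M`.
  obtain ⟨L, hL⟩ := exists_star_mul_self_isTridiagonal
    (p := fun n => √((1 - shiftParam α (2 * n)) * (1 + α (2 * n))))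
    (q := fun n => √((1 - α (2 * n)) * (1 + α (2 * n + 1))))
    (fun n => hb (h3 _) (h3' _) (h2 _) (h2' _)) (fun n => hb (h1 _) (h1' _) (h2 _) (h2' _))
  obtain ⟨M, hM⟩ := exists_star_mul_self_isTridiagonal
    (p := fun n => √((1 - shiftParam α (2 * n)) * (1 - α (2 * n))))
    (q := fun n => -√((1 + α (2 * n)) * (1 + α (2 * n + 1))))
    (fun n => hb (h3 _) (h3' _) (h1 _) (h1' _))
    (fun n => by simpa only [abs_neg] using hb (h2 (2 * n)) (h2' _) (h2 (2 * n + 1)) (h2' _))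
  have eL : algebraMap ℂ (ell2 →L[ℂ] ell2) ((2 : ℝ) : ℂ) + ((1 : ℝ) : ℂ) • T = star L * L := by
    refine (hT.affine 2 1).unique ?_
    convert hL using 2 with n n n
    · rw [Real.sq_sqrt (mul_nonneg (h3 _) (h2 _))]
      cases n with
      | zero => simp [geronimusB_zero, shiftParam]; ring
      | succ n =>
        simp only [Nat.add_eq_zero_iff, one_ne_zero, and_false, if_false, Nat.add_sub_cancel]
        rw [Real.sq_sqrt (mul_nonneg (h1 _) (h2 _)), geronimusB_succ]
        change _ = (1 - α (2 * n + 1)) * (1 + α (2 * n + 2)) + _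
        ring
    all_goals
      rw [← Real.sqrt_mul (mul_nonneg (h3 _) (h2 _)), one_mul, geronimusC]
      congr 1
      ring
  have eM : algebraMap ℂ (ell2 →L[ℂ] ell2) ((2 : ℝ) : ℂ) + ((-1 : ℝ) : ℂ) • T = star M * M := by
    refine (hT.affine 2 (-1)).unique ?_
    convert hM using 2 with n n n
    · rw [Real.sq_sqrt (mul_nonneg (h3 _) (h1 _))]
      cases n with
      | zero => simp [geronimusB_zero, shiftParam]; ring
      | succ n =>
        simp only [Nat.add_eq_zero_iff, one_ne_zero, and_false, if_false, Nat.add_sub_cancel,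
          neg_sq]
        rw [Real.sq_sqrt (mul_nonneg (h2 _) (h2 _)), geronimusB_succ]
        change _ = (1 - α (2 * n + 1)) * (1 - α (2 * n + 2)) + _
        ring
    all_goals
      rw [mul_neg, ← Real.sqrt_mul (mul_nonneg (h3 _) (h1 _)), neg_one_mul, geronimusC]
      congr 2
      ring
  have eT : T = star L * L - algebraMap ℂ (ell2 →L[ℂ] ell2) ((2 : ℝ) : ℂ) := by
    rw [← eL]
    simp
  have hsa : IsSelfAdjoint T := by
    rw [eT]
    refine (IsSelfAdjoint.star_mul_self L).sub ?_
    rw [IsSelfAdjoint, ← algebraMap_star_comm]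
    simp
  have hre := hsa.mem_spectrum_eq_re hl
  have hl' : ((l.re : ℝ) : ℂ) ∈ spectrum ℂ T := hre ▸ hl
  refine ⟨l.re, ⟨?_, ?_⟩, hre⟩
  · have : ((2 + l.re : ℝ) : ℂ) ∈ spectrum ℂ (star L * L) := by
      rw [← eL, Complex.ofReal_one, one_smul, Complex.ofReal_add, ← spectrum.singleton_add_eq]
      exact Set.add_mem_add rfl hl'
    have : 0 ≤ 2 + l.re := spectrum_star_mul_self_nonneg _ ((spectrum.algebraMap_mem_iff ℂ).mp this)
    linarith
  · have : ((2 - l.re : ℝ) : ℂ) ∈ spectrum ℂ (star M * M) := by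
      rw [← eM, Complex.ofReal_neg, Complex.ofReal_one, neg_smul, one_smul, Complex.ofReal_sub,
        ← spectrum.singleton_add_eq, ← spectrum.neg_eq, sub_eq_add_neg]
      exact Set.add_mem_add rfl (by simpa using hl')
    have : 0 ≤ 2 - l.re := spectrum_star_mul_self_nonneg _ ((spectrum.algebraMap_mem_iff ℂ).mp this)
    linarith

/-! ### Square-summable solutions and the resolvent -/

theorem tendsto_ell2_apply (x : ell2) : Filter.Tendsto (fun n => x n) Filter.atTop (𝓝 0) := by
  have h := (lp.hasSum_norm (p := 2) (by simp) x).summable.tendsto_atTop_zero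
  simp only [ENNReal.toReal_ofNat, Real.rpow_ofNat] at h
  rw [tendsto_zero_iff_norm_tendsto_zero]
  simpa using h.sqrt

/-- Wronskian argument. Subdiagonal and superdiagonal entries have equal moduli, so the weighted
Wronskian of `v` and `u` has constant modulus; it tends to zero as both are in `ℓ²`. Its initial
value is `v 0 * κ`, so `v 0 = 0`, and the recurrence propagates this. -/
theorem eq_zero_of_apply_eq_smul {H : ell2 →L[ℂ] ell2} {d C : ℕ → ℝ} {M : ℝ}
    (hH : IsTridiagonal H d (fun n => √|C n|) (fun n => C n / √|C n|)) (hC : ∀ n, C n ≠ 0)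
    (hM : ∀ n, |C n| ≤ M) {u v : ell2} {κ l : ℂ} (hκ : κ ≠ 0)
    (hu : H u = l • u + κ • basisVec 0) (hv : H v = l • v) : v = 0 := by
  have hs : ∀ n, √|C n| ≠ 0 := fun n => (Real.sqrt_pos.mpr (abs_pos.mpr (hC n))).ne'
  have hsC : ∀ n, ((√|C n| : ℝ) : ℂ) ≠ 0 := fun n => Complex.ofReal_ne_zero.mpr (hs n)
  have hv0 : d 0 * v 0 + (√|C 0| : ℝ) * v 1 = l * v 0 := by
    rw [← hH.zero, hv]
    rfl
  have hvs : ∀ n, ((C n / √|C n| : ℝ) : ℂ) * v n + d (n + 1) * v (n + 1)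
      + (√|C (n + 1)| : ℝ) * v (n + 2) = l * v (n + 1) := fun n => by
    rw [← hH.succ, hv]
    rfl
  have hu0 : d 0 * u 0 + (√|C 0| : ℝ) * u 1 = l * u 0 + κ := by
    rw [← hH.zero, hu]
    change l * u 0 + κ * basisVec 0 0 = _
    simp [basisVec_apply]
  have hus : ∀ n, ((C n / √|C n| : ℝ) : ℂ) * u n + d (n + 1) * u (n + 1)
      + (√|C (n + 1)| : ℝ) * u (n + 2) = l * u (n + 1) := fun n => by
    rw [← hH.succ, hu]
    change l * u (n + 1) + κ * basisVec 0 (n + 1) = _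
    simp [basisVec_apply]
  let W : ℕ → ℂ := fun n => (√|C n| : ℝ) * (v n * u (n + 1) - v (n + 1) * u n)
  have hW0 : W 0 = v 0 * κ := by
    simp only [W]
    linear_combination v 0 * hu0 - u 0 * hv0
  have hWs : ∀ n, ‖W (n + 1)‖ = ‖W n‖ := by
    intro n
    have h1 : W (n + 1) = ((C n / √|C n| : ℝ) : ℂ) * (v n * u (n + 1) - v (n + 1) * u n) := by
      simp only [W]
      linear_combination v (n + 1) * hus n - u (n + 1) * hvs n
    have h2 : |C n / √(|C n|)| = √|C n| := by
      rw [abs_div, abs_of_nonneg (Real.sqrt_nonneg _), Real.div_sqrt]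
    simp only [h1, W, norm_mul, Complex.norm_real, Real.norm_eq_abs, h2,
      abs_of_nonneg (Real.sqrt_nonneg _)]
  have hWc : ∀ n, ‖W n‖ = ‖W 0‖ := fun n => by
    induction n with
    | zero => rfl
    | succ n ih => rw [hWs, ih]
  have hlim : Filter.Tendsto W Filter.atTop (𝓝 0) := by
    have hun := tendsto_ell2_apply u
    have hvn := tendsto_ell2_apply v
    have hun1 := hun.comp (Filter.tendsto_add_atTop_nat 1)
    have hvn1 := hvn.comp (Filter.tendsto_add_atTop_nat 1)
    have hd := (hvn.mul hun1).sub (hvn1.mul hun)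
    simp only [mul_zero, sub_zero] at hd
    have hd' := hd.norm.const_mul (√M)
    rw [norm_zero, mul_zero] at hd'
    refine squeeze_zero_norm (fun n => ?_) hd'
    rw [norm_mul, Complex.norm_real, Real.norm_eq_abs, abs_of_nonneg (Real.sqrt_nonneg _)]
    exact mul_le_mul_of_nonneg_right (Real.sqrt_le_sqrt (hM n)) (norm_nonneg _)
  have hW : W 0 = 0 := by
    have h := hlim.norm
    simp only [hWc, norm_zero] at h
    exact norm_eq_zero.mp (tendsto_nhds_unique tendsto_const_nhds h)
  have hv00 : v 0 = 0 := (mul_eq_zero.mp (hW0 ▸ hW)).resolve_right hκ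
  have hall : ∀ n, v n = 0 ∧ v (n + 1) = 0 := by
    intro n
    induction n with
    | zero =>
      refine ⟨hv00, ?_⟩
      rw [hv00, mul_zero, zero_add, mul_zero] at hv0
      exact (mul_eq_zero.mp hv0).resolve_left (hsC 0)
    | succ n ih =>
      refine ⟨ih.2, ?_⟩
      have := hvs n
      rw [ih.1, ih.2, mul_zero, mul_zero, mul_zero, zero_add, zero_add] at this
      exact (mul_eq_zero.mp this).resolve_left (hsC (n + 1))
  ext n
  exact (hall n).1

theorem mFun_eq_div {H : ell2 →L[ℂ] ell2} {l κ : ℂ} (c : ℕ → ℝ) (hl : l ∈ resolventSet ℂ H)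
    (hκ : κ ≠ 0) {u : ell2} (hu : H u = l • u + κ • basisVec 0) : mFun c H l = u 0 / κ := by
  have hunit : IsUnit (H - algebraMap ℂ (ell2 →L[ℂ] ell2) l) := by
    rw [← neg_sub]
    exact (spectrum.mem_resolventSet_iff.mp hl).neg
  have h1 : (H - algebraMap ℂ (ell2 →L[ℂ] ell2) l) (κ⁻¹ • u) = basisVec 0 := by
    rw [Algebra.algebraMap_eq_smul_one, _root_.sub_apply, map_smul, hu]
    change κ⁻¹ • (l • u + κ • basisVec 0) - l • (κ⁻¹ • u) = _
    rw [smul_add, smul_smul κ⁻¹ κ, inv_mul_cancel₀ hκ, one_smul, smul_comm]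
    abel
  have h2 : Ring.inverse (H - algebraMap ℂ (ell2 →L[ℂ] ell2) l) (basisVec 0) = κ⁻¹ • u := by
    rw [← h1, ← mul_apply_eq_comp, Ring.inverse_mul_cancel _ hunit]
    rfl
  rw [mFun, h2, gForm, tsum_eq_single 0]
  · simp [basisVec_apply, signs, div_eq_inv_mul]
  · intro n hn
    simp [basisVec_apply, hn]

/-- With `r = |z|²`, multiplying by `conj z` gives `r z + conj z = x r`. Since `r ≠ 1` this forces
`z` to be real, and then `(r + 1)² = x² r ≤ 4 r` contradicts `r ≠ 1`. -/
theorem add_inv_notMem_Icc {z : ℂ} (hz : z ∈ disk) (hz0 : z ≠ 0) {x : ℝ}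
    (hx : x ∈ Set.Icc (-2 : ℝ) 2) : z + z⁻¹ ≠ x := by
  intro h
  have h1 : z ^ 2 + 1 = x * z := by
    rw [← h]
    field_simp
  set r := Complex.normSq z with hr
  have hr0 : 0 < r := Complex.normSq_pos.mpr hz0
  have hr1 : r < 1 := by
    rw [hr, Complex.normSq_eq_norm_sq]
    have := one_sub_norm_sq_pos hz
    linarith
  have h2 : (r : ℂ) * z + conj z = x * r := by
    rw [hr, ← Complex.mul_conj]
    linear_combination conj z * h1
  have him := congrArg Complex.im h2
  have hre := congrArg Complex.re h2
  simp at him hre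
  have him0 : z.im = 0 := by
    have : (r - 1) * z.im = 0 := by linarith
    exact (mul_eq_zero.mp this).resolve_left (by linarith)
  have hrr : r = z.re ^ 2 := by
    rw [hr, Complex.normSq_apply, him0]
    ring
  have h3 : (r + 1) ^ 2 * r = x ^ 2 * r ^ 2 := by
    linear_combination ((r + 1) * z.re + x * r) * hre + (r + 1) ^ 2 * hrr
  have h4 : x ^ 2 ≤ 4 := by nlinarith [hx.1, hx.2]
  have h5 : (r + 1) ^ 2 ≤ 4 * r := by
    have : (r + 1) ^ 2 * r ≤ 4 * r * r := by
      rw [h3]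
      nlinarith [sq_nonneg r]
    exact le_of_mul_le_mul_right this hr0
  nlinarith [sq_nonneg (r - 1), mul_pos (sub_pos.mpr hr1) (sub_pos.mpr hr1)]

/-! ### Boundedness of the recurrence coefficients -/

theorem exists_abs_le {α : ℕ → ℝ} {N : ℕ} (hα : ∀ n, N ≤ n → |α n| < 1) :
    ∃ M, 1 ≤ M ∧ ∀ n, |α n| ≤ M := by
  have hnn : ∀ s : Finset ℕ, 0 ≤ ∑ k ∈ s, |α k| :=
    fun s => Finset.sum_nonneg fun _ _ => abs_nonneg _
  refine ⟨1 + ∑ k ∈ Finset.range N, |α k|, by linarith [hnn (Finset.range N)], fun n => ?_⟩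
  rcases lt_or_ge n N with h | h
  · have := Finset.single_le_sum (f := fun k => |α k|) (fun _ _ => abs_nonneg _)
      (Finset.mem_range.mpr h)
    linarith
  · linarith [hα n h, hnn (Finset.range N)]

theorem exists_bound_geronimus {α : ℕ → ℝ} {N : ℕ} (hα : ∀ n, N ≤ n → |α n| < 1) :
    ∃ M, 1 ≤ M ∧ (∀ n, |geronimusB α n| ≤ M) ∧ ∀ n, |geronimusC α n| ≤ M := by
  obtain ⟨M, hM1, hM⟩ := exists_abs_le hα
  have hs : ∀ n, |shiftParam α n| ≤ M := fun n => by
    cases n with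
    | zero => simpa [shiftParam] using hM1
    | succ n => exact hM n
  have h1 : ∀ {x : ℝ}, |x| ≤ M → |1 - x| ≤ 1 + M := fun h => by
    rw [abs_le] at h ⊢
    constructor <;> linarith
  have h2 : ∀ {x : ℝ}, |x| ≤ M → |1 + x| ≤ 1 + M := fun h => by
    rw [abs_le] at h ⊢
    constructor <;> linarith
  have hMM : 1 ≤ (1 + M) ^ 4 := one_le_pow₀ (by linarith)
  refine ⟨(1 + M) ^ 4, hMM, fun n => ?_, fun n => ?_⟩
  · calc |geronimusB α n|
        ≤ |1 - shiftParam α (2 * n)| * |α (2 * n)| +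
          |1 + shiftParam α (2 * n)| * |shiftParam α (2 * n - 1)| := by
          rw [← abs_mul, ← abs_mul]
          exact abs_sub _ _
      _ ≤ (1 + M) * M + (1 + M) * M := by
          gcongr
          exacts [h1 (hs _), hM _, h2 (hs _), hs _]
      _ ≤ (1 + M) ^ 4 := by nlinarith [sq_nonneg M, pow_pos (by linarith : 0 < M) 3]
  · calc |geronimusC α n| = |1 - shiftParam α (2 * n)| * (|1 - α (2 * n)| * |1 + α (2 * n)|) *
          |1 + α (2 * n + 1)| := by
          rw [← abs_mul, ← abs_mul, ← abs_mul, geronimusC]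
          congr 1
          ring
      _ ≤ (1 + M) * ((1 + M) * (1 + M)) * (1 + M) := by
          gcongr
          exacts [h1 (hs _), h1 (hM _), h2 (hM _), h2 (hM _)]
      _ = (1 + M) ^ 4 := by ring

theorem abs_sqrt_abs_le {x M : ℝ} (hM : 1 ≤ M) (h : |x| ≤ M) : |√(|x|)| ≤ M := by
  rw [abs_of_nonneg (Real.sqrt_nonneg _), Real.sqrt_le_left (by linarith)]
  nlinarith

theorem abs_div_sqrt_abs_le {x M : ℝ} (hM : 1 ≤ M) (h : |x| ≤ M) : |x / √(|x|)| ≤ M := by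
  rw [abs_div, abs_of_nonneg (Real.sqrt_nonneg _), Real.div_sqrt]
  exact (le_abs_self _).trans (abs_sqrt_abs_le hM h)

theorem exists_isTridiagonal_geronimus {α : ℕ → ℝ} {N : ℕ} (hα : ∀ n, N ≤ n → |α n| < 1) :
    ∃ H, IsTridiagonal H (geronimusB α) (fun n => √|geronimusC α n|)
      (fun n => geronimusC α n / √|geronimusC α n|) := by
  obtain ⟨M, hM, hB, hC⟩ := exists_bound_geronimus hα
  exact exists_isTridiagonal hB (fun n => abs_sqrt_abs_le hM (hC n))
    (fun n => abs_div_sqrt_abs_le hM (hC n))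

theorem geronimusC_nonneg_of_abs_le {α : ℕ → ℝ} (hα : ∀ n, |α n| ≤ 1) (n : ℕ) :
    0 ≤ geronimusC α n := by
  have h1 := abs_le.mp (abs_shiftParam_le hα (2 * n))
  have h2 := (sq_le_one_iff_abs_le_one _).mpr (hα (2 * n))
  have h3 := abs_le.mp (hα (2 * n + 1))
  exact mul_nonneg (mul_nonneg (by linarith [h1.2]) (by linarith)) (by linarith [h3.1])

/-- Off the closed interval `[-2, 2]`, points that are not eigenvalues lie in the resolvent set. -/
theorem add_inv_mem_resolventSet {α : ℕ → ℝ} {N : ℕ} (hα : ∀ n, N ≤ n → |α n| < 1)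
    {H : ell2 →L[ℂ] ell2} (hH : IsTridiagonal H (geronimusB α) (fun n => √|geronimusC α n|)
      (fun n => geronimusC α n / √|geronimusC α n|)) {z : ℂ} (hz : z ∈ disk) (hz0 : z ≠ 0)
    (hinj : ∀ x, H x = (z + z⁻¹) • x → x = 0) : z + z⁻¹ ∈ resolventSet ℂ H := by
  -- All these parameters have modulus at most one, so the spectral bound applies to their operator.
  -- The coefficients `b` and `c` involve only nearby parameters, so only finitely many rows change.
  let β : ℕ → ℝ := fun n => if n < N then 0 else α n
  have hβα : ∀ n, N ≤ n → β n = α n := fun n hn => if_neg (not_lt.mpr hn)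
  have hβ : ∀ n, |β n| ≤ 1 := fun n => by
    simp only [β]
    split_ifs with h
    · simp
    · exact (hα n (not_lt.mp h)).le
  obtain ⟨T, hT⟩ := exists_isTridiagonal_geronimus (α := β) (N := N)
    (fun n hn => by rw [hβα n hn]; exact hα n hn)
  have hB : ∀ n, N ≤ n → geronimusB α (n + 1) = geronimusB β (n + 1) := fun n hn => by
    rw [geronimusB_succ, geronimusB_succ, hβα (2 * n) (by omega), hβα (2 * n + 1) (by omega),
      hβα (2 * n + 2) (by omega)]
  have hC : ∀ n, N ≤ n → geronimusC α (n + 1) = geronimusC β (n + 1) := fun n hn => by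
    rw [geronimusC_succ, geronimusC_succ, hβα (2 * n + 1) (by omega), hβα (2 * n + 2) (by omega),
      hβα (2 * n + 3) (by omega)]
  have hK : IsCompactOperator (H - T) := by
    refine isCompactOperator_of_finite_rows (m := N + 2) fun x i hi => ?_
    obtain ⟨n, rfl⟩ := Nat.exists_eq_add_of_le hi
    rw [_root_.sub_apply, lp.coeFn_sub, Pi.sub_apply, show N + 2 + n = (N + n + 1) + 1 by ring,
      hH.succ, hT.succ, hB (N + n + 1) (by omega), hC (N + n + 1) (by omega),
      hC (N + n) (by omega), sub_self]
  refine mem_resolventSet_of_isCompactOperator_sub hK ?_ hinj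
  by_contra hmem
  have hC0 := geronimusC_nonneg_of_abs_le hβ
  simp only [abs_of_nonneg (hC0 _), Real.div_sqrt] at hT
  obtain ⟨x, hx, hxe⟩ := mem_Icc_of_mem_spectrum hβ hT hmem
  exact add_inv_notMem_Icc hz hz0 hx hxe

/-! ### The square-summable solution -/

/-- The relation `Y = z g X` is propagated by the Schur recursion, and along it `X_{n+1} = z (1 -
α_n ^ 2) X_n / (1 + α_n z g_{n+1})`. One of the two factors `1 - α_n ^ 2` in the square goes into
the chain factor. -/
theorem IsSzegoSolution.norm_sq_eq {α : ℕ → ℝ} {z : ℂ} {X Y g : ℕ → ℂ} {N : ℕ}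
    (hs : IsSzegoSolution (cx α) z X Y) (hg : ∀ m, IsSchurChain α z N m g)
    (hα : ∀ n, N ≤ n → |α n| < 1) (hz : z ∈ disk) (hN : Y N = z * g N * X N) (n : ℕ) (hn : N ≤ n) :
    Y n = z * g n * X n ∧ ‖X n‖ ^ 2 = ‖X N‖ ^ 2 * (‖z‖ ^ 2) ^ (n - N) * chainFactor α z g N n *
      ∏ k ∈ Finset.Ico N n, (1 - α k ^ 2) := by
  induction n, hn using Nat.le_induction with
  | base => simp [hN, chainFactor]
  | succ n hn ih =>
    have hd := (hg (n + 1)).denom_ne_zero hα hz hn n.lt_succ_self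
    have hr := (hg (n + 1)).recursion n hn n.lt_succ_self
    have h1 : X (n + 1) * (1 + α n * z * g (n + 1)) = z * (1 - α n ^ 2 : ℝ) * X n := by
      rw [hs.fst, ih.1, cx]
      push_cast
      linear_combination -z * α n * X n * hr
    have h2 : Y (n + 1) * (1 + α n * z * g (n + 1)) =
        z * g (n + 1) * X (n + 1) * (1 + α n * z * g (n + 1)) := by
      rw [mul_assoc (z * g (n + 1)), h1, hs.snd, ih.1, cx]
      push_cast
      linear_combination z * X n * hr
    refine ⟨mul_right_cancel₀ hd h2, ?_⟩
    have h3 : X (n + 1) = z * (1 - α n ^ 2 : ℝ) * X n / (1 + α n * z * g (n + 1)) :=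
      eq_div_of_mul_eq hd h1
    rw [h3, norm_div, norm_mul, norm_mul, Complex.norm_real, Real.norm_eq_abs, div_pow, mul_pow,
      mul_pow, sq_abs, ih.2, chainFactor, chainFactor, Finset.prod_Ico_succ_top hn,
      Finset.prod_Ico_succ_top hn, Nat.sub_add_comm hn, pow_succ (‖z‖ ^ 2)]
    ring

theorem IsSzegoSolution.exists_norm_sq_le {α : ℕ → ℝ} {z : ℂ} {X Y g : ℕ → ℂ} {N : ℕ}
    (hs : IsSzegoSolution (cx α) z X Y) (hg : ∀ m, IsSchurChain α z N m g)
    (hα1 : ∀ n, |α n| ≠ 1) (hα : ∀ n, N ≤ n → |α n| < 1) (hz : z ∈ disk) (hz0 : z ≠ 0)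
    (hN : Y N = z * g N * X N) :
    ∃ K, 0 ≤ K ∧ ∀ n, N ≤ n →
      ‖X n‖ ^ 2 ≤ K * ‖z‖ ^ (2 * n) * |∏ k ∈ Finset.range n, (1 - α k ^ 2)| := by
  have hpos := one_sub_norm_sq_pos hz
  have hzp : 0 < ‖z‖ := norm_pos_iff.mpr hz0
  have hω : 0 < |∏ k ∈ Finset.range N, (1 - α k ^ 2)| :=
    abs_pos.mpr (Finset.prod_ne_zero_iff.mpr fun k _ h =>
      hα1 k ((pow_eq_one_iff_of_nonneg (abs_nonneg _) two_ne_zero).mp (by rw [sq_abs]; linarith)))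
  refine ⟨‖X N‖ ^ 2 / (‖z‖ ^ (2 * N) * (1 - ‖z‖ ^ 2) *
    |∏ k ∈ Finset.range N, (1 - α k ^ 2)|), by positivity, fun n hn => ?_⟩
  have hρ : 0 ≤ ∏ k ∈ Finset.Ico N n, (1 - α k ^ 2) := Finset.prod_nonneg fun k hk => by
    have := (sq_lt_one_iff_abs_lt_one (α k)).mpr (hα k (Finset.mem_Ico.mp hk).1)
    linarith
  rw [(hs.norm_sq_eq hg hα hz hN n hn).2, ← Finset.prod_range_mul_prod_Ico _ hn, abs_mul,
    abs_of_nonneg hρ]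
  calc ‖X N‖ ^ 2 * (‖z‖ ^ 2) ^ (n - N) * chainFactor α z g N n *
        ∏ k ∈ Finset.Ico N n, (1 - α k ^ 2)
      ≤ ‖X N‖ ^ 2 * (‖z‖ ^ 2) ^ (n - N) * (1 / (1 - ‖z‖ ^ 2)) *
        ∏ k ∈ Finset.Ico N n, (1 - α k ^ 2) := by
        gcongr
        exact (hg n).chainFactor_le hα hz hn
    _ = _ := by
        have hpow : ‖z‖ ^ (2 * n) = ‖z‖ ^ (2 * N) * (‖z‖ ^ 2) ^ (n - N) := by
          rw [← pow_mul, ← pow_add]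
          congr 1
          omega
        rw [hpow]
        field_simp

/-- Telescoping: the factor `1 + α_{2n+1}` of one `c` meets `1 - α_{2n+1}` of the next. This matches
the decay of `X_n` to the normalization by `∏ √|c_i|`. -/
theorem one_sub_shiftParam_mul_prod_geronimusC (α : ℕ → ℝ) (n : ℕ) :
    (1 - shiftParam α (2 * n)) * ∏ i ∈ Finset.range n, geronimusC α i =
      2 * ∏ k ∈ Finset.range (2 * n), (1 - α k ^ 2) := by
  induction n with
  | zero =>
    simp [shiftParam]
    norm_num
  | succ n ih =>
    rw [Finset.prod_range_succ, show 2 * (n + 1) = 2 * n + 1 + 1 by ring, Finset.prod_range_succ,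
      Finset.prod_range_succ, geronimusC, shiftParam]
    linear_combination (1 - α (2 * n) ^ 2) * (1 - α (2 * n + 1) ^ 2) * ih

theorem prod_geronimusC_succ (α : ℕ → ℝ) (n : ℕ) :
    ∏ i ∈ Finset.range (n + 1), geronimusC α i =
      2 * (1 + α (2 * n + 1)) * ∏ k ∈ Finset.range (2 * n + 1), (1 - α k ^ 2) := by
  rw [Finset.prod_range_succ, Finset.prod_range_succ, geronimusC]
  linear_combination (1 - α (2 * n) ^ 2) * (1 + α (2 * n + 1)) *
    one_sub_shiftParam_mul_prod_geronimusC α n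

/-- The product of the `c_i` contains `1 + a` with `a = α_{2n+1}`, which has no uniform lower bound.
For `a ≥ 0` the odd-index form of `y` suffices. For `a < 0` the even-index form gains `1 - a ^ 2`,
and division by `1 - a ≥ 1` leaves the required `1 + a`. -/
theorem IsSzegoImage.norm_sq_le {α : ℕ → ℝ} {z : ℂ} {X Y g y : ℕ → ℂ} {N : ℕ} {K : ℝ}
    (hy : IsSzegoImage z z⁻¹ X Y y) (hs : IsSzegoSolution (cx α) z X Y)
    (hα : ∀ n, N ≤ n → |α n| < 1) (hz : z ∈ disk) (hg : ∀ n, N ≤ n → ‖g n‖ ≤ 1)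
    (hYX : ∀ n, N ≤ n → Y n = z * g n * X n) (hK : 0 ≤ K) (hX : ∀ n, N ≤ n →
      ‖X n‖ ^ 2 ≤ K * ‖z‖ ^ (2 * n) * |∏ k ∈ Finset.range n, (1 - α k ^ 2)|)
    {n : ℕ} (hn : N ≤ 2 * n + 1) :
    ‖y (n + 1)‖ ^ 2 ≤ 2 * K * ‖z‖ ^ (2 * (n + 1)) *
      |∏ i ∈ Finset.range (n + 1), geronimusC α i| := by
  have hz0 : z ≠ 0 := left_ne_zero_of_mul_eq_one hy.mul_eq_one
  have hzp : 0 < ‖z‖ := norm_pos_iff.mpr hz0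
  have hz1 : ‖z‖ < 1 := mem_disk_iff.mp hz
  set a := α (2 * n + 1) with ha
  have ha' := abs_lt.mp (hα _ hn)
  rw [← ha] at ha'
  set ω := |∏ k ∈ Finset.range (2 * n + 1), (1 - α k ^ 2)| with hω
  have hω0 : 0 ≤ ω := abs_nonneg _
  have hprod : |∏ i ∈ Finset.range (n + 1), geronimusC α i| = 2 * (1 + a) * ω := by
    rw [prod_geronimusC_succ, abs_mul, abs_mul, abs_two, ← ha, abs_of_pos (by linarith : 0 < 1 + a)]
  rw [hprod]
  set R := ‖z‖ ^ (2 * (n + 1)) with hR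
  have hRp : 0 < R := pow_pos hzp _
  have hRR : R * R = ‖z‖ ^ (2 * (2 * n + 2)) := by
    rw [hR, ← pow_add]
    congr 1
    ring
  have hzi : (‖z⁻¹ ^ (n + 1)‖) ^ 2 * R = 1 := by
    rw [hR, norm_pow, norm_inv, ← pow_mul, mul_comm (n + 1) 2, ← mul_pow, inv_mul_cancel₀ hzp.ne',
      one_pow]
  have h1g : ∀ m, N ≤ m → ‖1 + g m‖ ≤ 2 := fun m hm =>
    (norm_add_le _ _).trans (by rw [norm_one]; linarith [hg m hm])
  have h1zg : ∀ m, N ≤ m → ‖1 + z * g m‖ ≤ 2 := fun m hm =>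
    (norm_add_le _ _).trans (by
      rw [norm_one, norm_mul]
      nlinarith [hg m hm, norm_nonneg (g m)])
  rcases le_or_gt 0 a with h0 | h0
  · have h1 : z * X (2 * n + 1) + Y (2 * n + 1) = z * (1 + g (2 * n + 1)) * X (2 * n + 1) := by
      rw [hYX _ hn]
      ring
    have h2 : ‖z * X (2 * n + 1) + Y (2 * n + 1)‖ ^ 2 ≤ 4 * K * (R * R) * ω := by
      rw [h1, norm_mul, norm_mul, mul_pow, mul_pow]
      calc ‖z‖ ^ 2 * ‖1 + g (2 * n + 1)‖ ^ 2 * ‖X (2 * n + 1)‖ ^ 2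
          ≤ ‖z‖ ^ 2 * 2 ^ 2 * (K * ‖z‖ ^ (2 * (2 * n + 1)) * ω) := by
            gcongr
            exacts [h1g _ hn, hX _ hn]
        _ = 4 * K * (R * R) * ω := by
            rw [hRR]
            ring
    rw [hy.succ, norm_mul, mul_pow]
    calc ‖z⁻¹ ^ (n + 1)‖ ^ 2 * ‖z * X (2 * n + 1) + Y (2 * n + 1)‖ ^ 2
        ≤ ‖z⁻¹ ^ (n + 1)‖ ^ 2 * (4 * K * (R * R) * ω) := by gcongr
      _ = 4 * K * R * ω := by linear_combination 4 * K * R * ω * hzi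
      _ ≤ 2 * K * R * (2 * (1 + a) * ω) := by
          have : 0 ≤ K * R * ω * a := by positivity
          linarith
  · have hn2 : N ≤ 2 * (n + 1) := by omega
    have h1 := hy.even hs (n + 1)
    have h3 : X (2 * (n + 1)) + Y (2 * (n + 1)) =
        (1 + z * g (2 * (n + 1))) * X (2 * (n + 1)) := by
      rw [hYX _ hn2]
      ring
    have hωs : |∏ k ∈ Finset.range (2 * (n + 1)), (1 - α k ^ 2)| = ω * (1 - a ^ 2) := by
      rw [show 2 * (n + 1) = 2 * n + 1 + 1 by ring, Finset.prod_range_succ, abs_mul, ← hω, ← ha,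
        abs_of_pos (by nlinarith : 0 < 1 - a ^ 2)]
    have h2 : ‖X (2 * (n + 1)) + Y (2 * (n + 1))‖ ^ 2 ≤ 4 * K * (R * R) * (ω * (1 - a ^ 2)) := by
      rw [h3, norm_mul, mul_pow]
      calc ‖1 + z * g (2 * (n + 1))‖ ^ 2 * ‖X (2 * (n + 1))‖ ^ 2
          ≤ 2 ^ 2 * (K * ‖z‖ ^ (2 * (2 * (n + 1))) * (ω * (1 - a ^ 2))) := by
            gcongr
            exacts [h1zg _ hn2, hωs ▸ hX _ hn2]
        _ = 4 * K * (R * R) * (ω * (1 - a ^ 2)) := by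
            rw [hRR]
            ring
    have h4 : ‖((1 - a : ℝ) : ℂ) * y (n + 1)‖ ^ 2 ≤ 4 * K * R * (ω * (1 - a ^ 2)) := by
      have e : ((1 - a : ℝ) : ℂ) * y (n + 1) =
          z⁻¹ ^ (n + 1) * (X (2 * (n + 1)) + Y (2 * (n + 1))) := h1
      rw [e, norm_mul, mul_pow]
      calc ‖z⁻¹ ^ (n + 1)‖ ^ 2 * ‖X (2 * (n + 1)) + Y (2 * (n + 1))‖ ^ 2
          ≤ ‖z⁻¹ ^ (n + 1)‖ ^ 2 * (4 * K * (R * R) * (ω * (1 - a ^ 2))) := by gcongr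
        _ = 4 * K * R * (ω * (1 - a ^ 2)) := by
          linear_combination 4 * K * R * (ω * (1 - a ^ 2)) * hzi
    rw [norm_mul, mul_pow, Complex.norm_real, Real.norm_eq_abs, sq_abs] at h4
    have h5 : (1 - a) * ((1 - a) * ‖y (n + 1)‖ ^ 2) ≤ (1 - a) * (4 * K * R * ω * (1 + a)) := by
      linarith
    have h6 := le_of_mul_le_mul_left h5 (by linarith)
    have : 0 ≤ -a * ‖y (n + 1)‖ ^ 2 := mul_nonneg (by linarith) (sq_nonneg _)
    linarith

/-- The square-summable solution of the inhomogeneous eigenvalue equation for `H`. -/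
theorem exists_apply_eq_smul_add {α : ℕ → ℝ} {N : ℕ} (hα1 : ∀ n, |α n| ≠ 1)
    (hα : ∀ n, N ≤ n → |α n| < 1) {H : ell2 →L[ℂ] ell2}
    (hH : IsTridiagonal H (geronimusB α) (fun n => √|geronimusC α n|)
      (fun n => geronimusC α n / √|geronimusC α n|)) {z : ℂ} (hz : z ∈ disk) (hz0 : z ≠ 0)
    {X Y g : ℕ → ℂ} (hs : IsSzegoSolution (cx α) z X Y) (hg : ∀ m, IsSchurChain α z N m g)
    (hN : Y N = z * g N * X N) :
    ∃ u : ell2, u 0 = (X 0 + Y 0) / 2 ∧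
      H u = (z + z⁻¹) • u + ((z - z⁻¹) * (X 0 - Y 0) / 2) • basisVec 0 := by
  obtain ⟨K, hK, hX⟩ := hs.exists_norm_sq_le hg hα1 hα hz hz0 hN
  let y : ℕ → ℂ := fun n => if n = 0 then (X 0 + Y 0) / 2 else
    z⁻¹ ^ n * (z * X (2 * n - 1) + Y (2 * n - 1))
  have hy : IsSzegoImage z z⁻¹ X Y y :=
    ⟨mul_inv_cancel₀ hz0, by simp [y]; ring, fun n => by simp [y, mul_add]⟩
  -- Dividing by `σ` turns the monic recurrence into the rows of `H`: it moves `√|c|` to the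
  -- superdiagonal and leaves `c / √|c|` on the subdiagonal.
  let σ : ℕ → ℝ := fun n => ∏ i ∈ Finset.range n, √|geronimusC α i|
  have hσ2 : ∀ n, σ n ^ 2 = |∏ i ∈ Finset.range n, geronimusC α i| := fun n => by
    simp only [σ]
    rw [← Finset.prod_pow, Finset.abs_prod]
    exact Finset.prod_congr rfl fun i _ => Real.sq_sqrt (abs_nonneg _)
  have hs0 : ∀ n, √|geronimusC α n| ≠ 0 := fun n =>
    (Real.sqrt_pos.mpr (abs_pos.mpr (geronimusC_ne_zero hα1 n))).ne'
  have hσ0 : ∀ n, σ n ≠ 0 := fun n => Finset.prod_ne_zero_iff.mpr fun i _ => hs0 i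
  have hσs : ∀ n, σ (n + 1) = σ n * √|geronimusC α n| := fun n => Finset.prod_range_succ _ _
  have hmem : Memℓp (fun n => y n / σ n) 2 := by
    refine memℓp_gen ?_
    simp only [ENNReal.toReal_ofNat, Real.rpow_ofNat]
    have hgeom : Summable fun n : ℕ => 2 * K * (‖z‖ ^ 2) ^ n := by
      refine (summable_geometric_of_lt_one (sq_nonneg _) ?_).mul_left _
      linarith [one_sub_norm_sq_pos hz]
    refine Summable.of_norm_bounded_eventually_nat hgeom ?_
    filter_upwards [Filter.eventually_ge_atTop (N + 1)] with m hm
    obtain ⟨n, rfl⟩ := Nat.exists_eq_add_of_le' (Nat.le_of_add_left_le hm)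
    have h := hy.norm_sq_le hs hα hz (fun n hn => (hg n).norm_le n hn le_rfl)
      (fun n hn => (hs.norm_sq_eq hg hα hz hN n hn).1) hK hX (n := n) (by omega)
    rw [Real.norm_eq_abs, abs_of_nonneg (sq_nonneg _), norm_div, div_pow, Complex.norm_real,
      Real.norm_eq_abs, sq_abs, div_le_iff₀ (pow_pos (lt_of_le_of_ne
        (Finset.prod_nonneg fun i _ => Real.sqrt_nonneg _) (hσ0 _).symm) 2), hσ2, ← pow_mul]
    exact h
  have hσc : ∀ n, (σ n : ℂ) ≠ 0 := fun n => Complex.ofReal_ne_zero.mpr (hσ0 n)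
  have hsc : ∀ n, ((√|geronimusC α n| : ℝ) : ℂ) ≠ 0 := fun n => Complex.ofReal_ne_zero.mpr (hs0 n)
  have hσsc : ∀ n, (σ (n + 1) : ℂ) = σ n * (√|geronimusC α n| : ℝ) := fun n => by
    rw [hσs, Complex.ofReal_mul]
  have hy0 : y 0 = (X 0 + Y 0) / 2 := by simp [y]
  have hσ00 : σ 0 = 1 := by simp [σ]
  refine ⟨⟨fun n => y n / σ n, hmem⟩, by simp [hy0, hσ00], ?_⟩
  ext n
  cases n with
  | zero =>
    rw [hH.zero]
    change (geronimusB α 0 : ℂ) * (y 0 / σ 0) + (√|geronimusC α 0| : ℝ) * (y 1 / σ 1) =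
      (z + z⁻¹) * (y 0 / σ 0) + ((z - z⁻¹) * (X 0 - Y 0) / 2) * basisVec 0 0
    have h1 : y 1 + (geronimusB α 0 : ℂ) * y 0 = z * X 0 + z⁻¹ * Y 0 := hy.first hs
    have h2 : ((√|geronimusC α 0| : ℝ) : ℂ) * (y 1 / σ 1) = y 1 := by
      rw [hσsc 0, hσ00, Complex.ofReal_one, one_mul, mul_div_cancel₀ _ (hsc 0)]
    rw [h2, hσ00, Complex.ofReal_one, div_one, basisVec_apply, if_pos rfl]
    linear_combination h1 - (z + z⁻¹) * hy0
  | succ n =>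
    rw [hH.succ]
    change ((geronimusC α n / √|geronimusC α n| : ℝ) : ℂ) * (y n / σ n) +
      (geronimusB α (n + 1) : ℂ) * (y (n + 1) / σ (n + 1)) +
      (√|geronimusC α (n + 1)| : ℝ) * (y (n + 2) / σ (n + 2)) =
      (z + z⁻¹) * (y (n + 1) / σ (n + 1)) + ((z - z⁻¹) * (X 0 - Y 0) / 2) * basisVec 0 (n + 1)
    have h1 : (z + z⁻¹) * y (n + 1) = y (n + 2) + (geronimusB α (n + 1) : ℂ) * y (n + 1) +
      (geronimusC α n : ℂ) * y n := hy.recurrence hs n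
    have h2 : ((√|geronimusC α (n + 1)| : ℝ) : ℂ) * (y (n + 2) / σ (n + 2)) =
        y (n + 2) / σ (n + 1) := by
      rw [hσsc (n + 1)]
      field_simp [hsc (n + 1), hσc (n + 1)]
    have h3 : ((geronimusC α n / √|geronimusC α n| : ℝ) : ℂ) * (y n / σ n) =
        geronimusC α n * y n / σ (n + 1) := by
      rw [hσsc n, Complex.ofReal_div]
      field_simp [hsc n, hσc n]
    rw [h2, h3, basisVec_apply, if_neg n.succ_ne_zero]
    linear_combination -(1 / (σ (n + 1) : ℂ)) * h1

theorem sub_inv_ne_zero {z : ℂ} (hz : z ∈ disk) (hz0 : z ≠ 0) : z - z⁻¹ ≠ 0 := by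
  intro h
  have h3 : z * z = 1 := by
    rw [sub_eq_zero] at h
    nth_rewrite 2 [h]
    exact mul_inv_cancel₀ hz0
  have h4 := congrArg norm h3
  rw [norm_mul, norm_one] at h4
  nlinarith [one_sub_norm_sq_pos hz]

/-- The relation between `F` and `m` at a given point. -/
theorem IsSchurSequence.mem_resolventSet_and_mFun_eq {α : ℕ → ℝ} {N : ℕ} {f : ℕ → ℂ → ℂ}
    (hf : IsSchurSequence (cx α) N f) (hα1 : ∀ n, |α n| ≠ 1) (hα : ∀ n, N ≤ n → |α n| < 1)
    {H : ell2 →L[ℂ] ell2} (hH : IsTridiagonal H (geronimusB α) (fun n => √|geronimusC α n|)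
      (fun n => geronimusC α n / √|geronimusC α n|)) (c : ℕ → ℝ) {z : ℂ} (hz : z ∈ disk)
    (hz0 : z ≠ 0) (hd : denomF α (f N) N z ≠ 0) :
    z + z⁻¹ ∈ resolventSet ℂ H ∧ mFun c H (z + z⁻¹) = bigF (f 0) z / (z - z⁻¹) := by
  set p := numerF α (f N) N z with hp
  set q := denomF α (f N) N z with hq
  have h1 := isSzegoSolution_eval_Phi α z
  have h2 := isSzegoSolution_eval_Phi_neg α z
  -- With these weights `Y_N = z f_N X_N` is an identity, while `X_0 + Y_0 = p` and `X_0 - Y_0 = q`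
  -- are the numerator and denominator of `F`.
  let X : ℕ → ℂ := fun n => (p * (Phi (cx α) n).eval z + q * (Phi (cx (-α)) n).eval z) / 2
  let Y : ℕ → ℂ := fun n => (p * (PhiStar (cx α) n).eval z + q * -(PhiStar (cx (-α)) n).eval z) / 2
  have hs : IsSzegoSolution (cx α) z X Y := by
    constructor
    · intro n
      linear_combination (p / 2) * h1.fst n + (q / 2) * h2.fst n
    · intro n
      linear_combination (p / 2) * h1.snd n + (q / 2) * h2.snd n
  have hN : Y N = z * f N z * X N := by
    simp only [X, Y, hp, hq, numerF, denomF]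
    ring
  have hX0 : X 0 = (p + q) / 2 := by simp [X, Phi]
  have hY0 : Y 0 = (p - q) / 2 := by simp [Y, PhiStar_zero, sub_eq_add_neg]
  obtain ⟨u, hu0, hu⟩ := exists_apply_eq_smul_add hα1 hα hH hz hz0 hs
    (fun m => hf.isSchurChain hα hz m) hN
  have hzz := sub_inv_ne_zero hz hz0
  have hκ : (z - z⁻¹) * (X 0 - Y 0) / 2 ≠ 0 := by
    rw [hX0, hY0, show (p + q) / 2 - (p - q) / 2 = q by ring]
    exact div_ne_zero (mul_ne_zero hzz hd) two_ne_zero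
  obtain ⟨M, -, -, hM⟩ := exists_bound_geronimus hα
  have hres := add_inv_mem_resolventSet hα hH hz hz0 fun v hv =>
    eq_zero_of_apply_eq_smul hH (geronimusC_ne_zero hα1) hM hκ hu hv
  refine ⟨hres, ?_⟩
  rw [mFun_eq_div c hres hκ hu, hu0, (hf.bigF_eventuallyEq le_rfl hz hd).eq_of_nhds, ← hp, ← hq,
    hX0, hY0, show (p + q) / 2 - (p - q) / 2 = q by ring,
    show (p + q) / 2 + (p - q) / 2 = p by ring]
  generalize z - z⁻¹ = w at hzz
  field_simp

/-! ### The main theorem -/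

theorem exists_add_inv_eq (z : ℂ) : ∃ ζ : ℂ, ζ ≠ 0 ∧ ζ + ζ⁻¹ = z ∧ ‖ζ‖ * ‖z‖ ≤ 2 := by
  have key : ∀ ζ η : ℂ, ζ * η = 1 → ζ + η = z → ‖ζ‖ ≤ ‖η‖ →
      ∃ ζ : ℂ, ζ ≠ 0 ∧ ζ + ζ⁻¹ = z ∧ ‖ζ‖ * ‖z‖ ≤ 2 := by
    intro ζ η h1 h2 h3
    refine ⟨ζ, left_ne_zero_of_mul_eq_one h1, by rw [inv_eq_of_mul_eq_one_right h1, h2], ?_⟩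
    have h4 : ‖ζ‖ * ‖η‖ = 1 := by rw [← norm_mul, h1, norm_one]
    calc ‖ζ‖ * ‖z‖ ≤ ‖ζ‖ * (‖ζ‖ + ‖η‖) := by
          rw [← h2]
          exact mul_le_mul_of_nonneg_left (norm_add_le _ _) (norm_nonneg _)
      _ ≤ 2 := by nlinarith [norm_nonneg ζ]
  -- The roots of `ζ ^ 2 - z ζ + 1` have product one; the smaller satisfies `|ζ| |z| ≤ |ζ|² + 1 ≤
  -- 2`, so it tends to zero as `z` tends to infinity.
  obtain ⟨s, hs⟩ := IsAlgClosed.exists_pow_nat_eq (z ^ 2 - 4) two_pos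
  rcases le_total ‖(z + s) / 2‖ ‖(z - s) / 2‖ with h | h
  · exact key _ _ (by linear_combination -hs / 4) (by ring) h
  · exact key _ _ (by linear_combination -hs / 4) (by ring) h

theorem eventually_cobounded_of_eventually_nhds_zero {p q : ℂ → Prop} (hp : ∀ᶠ z in 𝓝 (0 : ℂ), p z)
    (h : ∀ z, z ≠ 0 → p z → q (z + z⁻¹)) : ∀ᶠ z in Bornology.cobounded ℂ, q z := by
  obtain ⟨ε, hε, hb⟩ := Metric.eventually_nhds_iff.mp hp
  filter_upwards [tendsto_norm_cobounded_atTop.eventually_gt_atTop (2 / ε)] with z hz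
  obtain ⟨ζ, hζ0, hζ, hn⟩ := exists_add_inv_eq z
  rw [← hζ]
  refine h ζ hζ0 (hb ?_)
  rw [dist_zero_right]
  by_contra hle
  rw [div_lt_iff₀ hε] at hz
  nlinarith [mul_le_mul_of_nonneg_right (not_lt.mp hle) (norm_nonneg z)]

end SzegoMap
end

theorem mainTheorem9 (α : ℕ → ℝ) (N : ℕ)
    (hne : ∀ n, n < N → |α n| ≠ 1) (hlt : ∀ n, N ≤ n → |α n| < 1) :
    -- the objects in question exist
    (∃ f, SzegoMap.IsSchurSequence (fun n => (α n : ℂ)) N f) ∧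
    (∃ B, SzegoMap.IsBlaschkeLimit (fun n => (α n : ℂ)) B) ∧
    (∃ P b c H, SzegoMap.IsMonicOrthogonal (SzegoMap.gam fun n => (α n : ℂ)) P ∧
      SzegoMap.IsRecurrence P b c ∧ SzegoMap.HasMatrix H (SzegoMap.jacobi b c)) ∧
    -- and whenever they are as described
    ∀ (f : ℕ → ℂ → ℂ) (B : ℂ → ℂ) (P : ℕ → Polynomial ℂ) (b c : ℕ → ℝ)
      (H : SzegoMap.ell2 →L[ℂ] SzegoMap.ell2),
      SzegoMap.IsSchurSequence (fun n => (α n : ℂ)) N f →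
      SzegoMap.IsBlaschkeLimit (fun n => (α n : ℂ)) B →
      SzegoMap.IsMonicOrthogonal (SzegoMap.gam fun n => (α n : ℂ)) P →
      SzegoMap.IsRecurrence P b c →
      SzegoMap.HasMatrix H (SzegoMap.jacobi b c) →
      -- representation of `F` near zero
      (∀ᶠ z in 𝓝 (0 : ℂ), SzegoMap.HasPairing (SzegoMap.mu fun n => (α n : ℂ))
        (fun w => (w + z) / (w - z)) (SzegoMap.bigF (f 0) z)) ∧
      -- representation of the `m`-function near infinity
      (∀ᶠ z in Bornology.cobounded ℂ, z ∈ resolventSet ℂ H ∧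
        SzegoMap.HasGamPairing (fun n => (α n : ℂ)) (fun x => 1 / (x - z))
          (SzegoMap.mFun c H z)) ∧
      -- the relation between `F` and `m`; at `z = 0` the right-hand side is read as a limit
      (∀ z ∈ SzegoMap.disk, B z ≠ 0 → z ≠ 0 →
        z + z⁻¹ ∈ resolventSet ℂ H ∧
        SzegoMap.bigF (f 0) z = (z - z⁻¹) * SzegoMap.mFun c H (z + z⁻¹)) ∧
      B 0 ≠ 0 ∧
      Filter.Tendsto (fun z : ℂ => (z - z⁻¹) * SzegoMap.mFun c H (z + z⁻¹)) (𝓝[≠] 0)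
        (𝓝 (SzegoMap.bigF (f 0) 0)) := by
  have hα1 : ∀ n, |α n| ≠ 1 := fun n => by
    rcases lt_or_ge n N with h | h
    · exact hne n h
    · exact (hlt n h).ne
  obtain ⟨f₀, hf₀⟩ := SzegoMap.exists_isSchurSequence hlt
  refine ⟨⟨f₀, hf₀⟩, hf₀.exists_isBlaschkeLimit hα1 hlt, ?_, ?_⟩
  · obtain ⟨H, hH⟩ := SzegoMap.exists_isTridiagonal_geronimus hlt
    exact ⟨_, _, _, H, SzegoMap.isMonicOrthogonal_recPoly hα1,
      SzegoMap.isRecurrence_recPoly _ _, SzegoMap.IsTridiagonal.hasMatrix hH⟩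
  intro f B P b c H hf hB hP hbc hM
  -- By uniqueness of monic orthogonal polynomials and of their recurrence coefficients, any
  -- admissible `H` has the Geronimus entries.
  have hH : SzegoMap.IsTridiagonal H (SzegoMap.geronimusB α) (fun n => √|SzegoMap.geronimusC α n|)
      (fun n => SzegoMap.geronimusC α n / √|SzegoMap.geronimusC α n|) := by
    have h := hM.isTridiagonal
    simp only [(hbc.eq_geronimus hα1 hP _).1, (hbc.eq_geronimus hα1 hP _).2] at h
    exact h
  have hcore := fun z hz hz0 hd => hf.mem_resolventSet_and_mFun_eq hα1 hlt hH c (z := z) hz hz0 hd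
  have hd0 : ∀ᶠ z in 𝓝 (0 : ℂ), SzegoMap.denomF α (f N) N z ≠ 0 :=
    (SzegoMap.analyticAt_denomF α N
      ((hf.schur N le_rfl).analyticOnNhd 0 SzegoMap.zero_mem_disk)).continuousAt.eventually_ne
      (by simp [SzegoMap.denomF_zero])
  have hdisk : ∀ᶠ z in 𝓝 (0 : ℂ), z ∈ SzegoMap.disk :=
    Metric.isOpen_ball.mem_nhds SzegoMap.zero_mem_disk
  obtain ⟨hB0, hBd⟩ := hf.blaschke_limit_ne_zero hα1 hlt hB
  refine ⟨?_, ?_, fun z hz hBz hz0 => ?_, hB0, ?_⟩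
  · filter_upwards [hf.eventually_hasSum_bigF, hdisk] with z hz hzd
    exact SzegoMap.hasPairing_caratheodory α hzd hz
  · refine SzegoMap.eventually_cobounded_of_eventually_nhds_zero
      (hf.eventually_hasSum_bigF.and (hdisk.and hd0)) fun z hz0 hz => ?_
    obtain ⟨hr, hm⟩ := hcore z hz.2.1 hz0 hz.2.2
    refine ⟨hr, ?_⟩
    rw [hm]
    exact SzegoMap.hasGamPairing_resolvent α hz.2.1 hz0 hz.1
  · obtain ⟨hr, hm⟩ := hcore z hz hz0 (hBd z hz hBz)
    exact ⟨hr, by rw [hm, mul_div_cancel₀ _ (SzegoMap.sub_inv_ne_zero hz hz0)]⟩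
  · refine ((hf.analyticAt_bigF SzegoMap.zero_mem_disk
      (by simp [SzegoMap.denomF_zero])).continuousAt.tendsto.mono_left nhdsWithin_le_nhds).congr' ?_
    filter_upwards [hdisk.filter_mono nhdsWithin_le_nhds, hd0.filter_mono nhdsWithin_le_nhds,
      self_mem_nhdsWithin] with z hz hd hz0
    rw [(hcore z hz hz0 hd).2, mul_div_cancel₀ _ (SzegoMap.sub_inv_ne_zero hz hz0)]
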